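/- Let $\Sigma$ be a compact connected Riemann surface with canonical bundle $K$, and let $a_i\in H^0(\Sigma,K^i)$ for $i=2,3,4$. Let $\pi:S\to\Sigma$ be the four-fold spectral cover $$S=\{\eta\in K:\ \eta^4+a_2\eta^2+a_3\eta+a_4=0\}$$ in the total space of $K$. Assume that $(a_2,a_3,a_4)$ is generic in the sense that $S$ is smooth and has only the most generic ramification: every fibre of $\pi$ consists either of four points, or of two unramified points and one simple ramification point. Let $(S\times_\Sigma S)_0$ be the closure of the complement of the diagonal in $S\times_\Sigma S$, with projections $p_1,p_2$ to $S$ and the involution $\tau(x,y)=(y,x)$. Let $\hat S_6=(S\times_\Sigma S)_0/\tau$, embedded in $K\oplus K^2$ by $[x,y]\mapsto(\tfrac{x+y}{2},xy)$, let $\hat\pi_\tau:(S\times_\Sigma S)_0\to\hat S_6$ be the quotient map, and let $\sigma:\hat S_6\to\hat S_6$ be the involution which sends a pair of roots of $\eta^4+a_2\eta^2+a_3\eta+a_4$ over a point of $\Sigma$ to the pair of the two remaining roots, counted with multiplicity. For a finite branched covering $f:Z\to Y$ of Riemann surfaces (which may be disconnected), $\mathrm{Prym}(Z,Y)$ denotes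 the set of holomorphic line bundles $E$ on $Z$ with trivial norm $Nm_f(E)\cong\mathcal O_Y$; here $Nm_f(E)$ is the line bundle with fibre $\bigotimes_{f(z)=y}E_z^{\otimes e_z}$ at $y$, where $e_z$ is the multiplicity of $f$ at $z$. For a line bundle $L$ on $S$ put $\mathcal L=p_1^*L\otimes p_2^*L$. The involution $\tau$ lifts to $\mathcal L$ by exchanging the two factors. Let $\mathcal L_-$ and $T$ be the subsheaves of $\tau$-anti-invariant sections of $(\hat\pi_\tau)_*\mathcal L$ and of $(\hat\pi_\tau)_*\mathcal O_{(S\times_\Sigma S)_0}$ respectively. If $L\in\mathrm{Prym}(S,\Sigma)$, then $\mathcal L_-$ and $T$ are locally free of rank one, and the line bundle $$\mathcal I_3(L):=\mathcal L_-\otimes T^{-1}$$ on $\hat S_6$ lies in $\mathrm{Prym}(\hat S_6,\hat S_6/\sigma)$. -/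

import Mathlib

open scoped Manifold Topology ContDiff TensorProduct
open Bundle TopologicalSpace

universe u v w v'

noncomputable section

namespace SpectralPrym

/-! ### Spaces with a sheaf of holomorphic functions -/

/-- The structure sheaf of a (reduced) complex space, given by the predicate
`HolAt f x`: the function `f` is holomorphic near the point `x`. -/
class HolSpace (Y : Type u) [TopologicalSpace Y] where
  HolAt : (Y → ℂ) → Y → Prop

/-- Holomorphic functions on a complex manifold: complex differentiable near the point. -/
def ManifoldHolAt {V : Type u} [NormedAddCommGroup V] [NormedSpace ℂ V]
    {H : Type v} [TopologicalSpace H] (I : ModelWithCorners ℂ V H)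
    {M : Type w} [TopologicalSpace M] [ChartedSpace H M] (f : M → ℂ) (p : M) : Prop :=
  ∀ᶠ q in 𝓝 p, MDifferentiableAt I 𝓘(ℂ, ℂ) f q

/-- A one-dimensional complex manifold as a space with holomorphic functions. -/
instance riemannSurfaceHolSpace (X : Type u) [TopologicalSpace X] [ChartedSpace ℂ X] :
    HolSpace X where
  HolAt := ManifoldHolAt 𝓘(ℂ, ℂ)

/-! ### Line bundles on a space with holomorphic functions -/

/-- A family of complex vector spaces together with a notion of holomorphic section:
`HolAt s x` says that the section `s` is holomorphic near `x`. -/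
structure Family (Y : Type u) [TopologicalSpace Y] [HolSpace Y] where
  Fiber : Y → Type v
  [instAddCommGroup : ∀ y, AddCommGroup (Fiber y)]
  [instModule : ∀ y, Module ℂ (Fiber y)]
  HolAt : (∀ y, Fiber y) → Y → Prop

attribute [instance] Family.instAddCommGroup Family.instModule

namespace Family

variable {Y : Type u} [TopologicalSpace Y] [HolSpace Y]

/-- `e` is a holomorphic frame of a line bundle over `U`: at each point of `U` it spans the
one-dimensional fibre, and the holomorphic sections are exactly the holomorphic multiples of `e`. -/
def IsFrameOn (E : Family.{u, v} Y) (U : Set Y) (e : ∀ y, E.Fiber y) : Prop :=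
  ∀ x ∈ U, (e x ≠ 0 ∧ ∀ a : E.Fiber x, ∃ c : ℂ, a = c • e x) ∧
    ∀ s : ∀ y, E.Fiber y, E.HolAt s x ↔
      ∃ f : Y → ℂ, HolSpace.HolAt f x ∧ ∀ᶠ y in 𝓝 x, s y = f y • e y

/-- Holomorphic line bundles: families with a holomorphic frame near each point. -/
def IsLineBundle (E : Family.{u, v} Y) : Prop :=
  ∀ x : Y, ∃ U : Set Y, IsOpen U ∧ x ∈ U ∧ ∃ e : ∀ y, E.Fiber y, E.IsFrameOn U e

/-- Isomorphism of bundles: fibrewise linear isomorphisms preserving holomorphic sections. -/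
def Iso (E : Family.{u, v} Y) (F : Family.{u, w} Y) : Prop :=
  ∃ φ : ∀ y, E.Fiber y ≃ₗ[ℂ] F.Fiber y,
    ∀ (s : ∀ y, E.Fiber y) (x : Y), E.HolAt s x ↔ F.HolAt (fun y => φ y (s y)) x

/-- The trivial line bundle `𝒪`. -/
def trivial (Y : Type u) [TopologicalSpace Y] [HolSpace Y] : Family.{u, 0} Y where
  Fiber _ := ℂ
  HolAt f x := HolSpace.HolAt f x

/-- The tensor product `E ⊗ F` of line bundles. -/
def tensor (E : Family.{u, v} Y) (F : Family.{u, w} Y) : Family.{u, max v w} Y where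
  Fiber y := E.Fiber y ⊗[ℂ] F.Fiber y
  HolAt s x := ∃ U : Set Y, IsOpen U ∧ x ∈ U ∧
    ∃ (e : ∀ y, E.Fiber y) (e' : ∀ y, F.Fiber y), E.IsFrameOn U e ∧ F.IsFrameOn U e' ∧
      ∃ f : Y → ℂ, HolSpace.HolAt f x ∧ ∀ᶠ y in 𝓝 x, s y = f y • (e y ⊗ₜ[ℂ] e' y)

/-- The dual (inverse) `E⁻¹` of a line bundle. -/
def dual (E : Family.{u, v} Y) : Family.{u, v} Y where
  Fiber y := Module.Dual ℂ (E.Fiber y)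
  HolAt s x := ∃ U : Set Y, IsOpen U ∧ x ∈ U ∧
    ∃ e : ∀ y, E.Fiber y, E.IsFrameOn U e ∧ HolSpace.HolAt (fun y => s y (e y)) x

/-- The pull-back `φ^* E` of a line bundle. -/
def pullback {Z : Type w} [TopologicalSpace Z] [HolSpace Z] (φ : Z → Y) (E : Family.{u, v} Y) :
    Family.{w, v} Z where
  Fiber z := E.Fiber (φ z)
  HolAt s z := ∃ U : Set Y, IsOpen U ∧ φ z ∈ U ∧ ∃ e : ∀ y, E.Fiber y, E.IsFrameOn U e ∧
    ∃ f : Z → ℂ, HolSpace.HolAt f z ∧ ∀ᶠ z' in 𝓝 z, s z' = f z' • e (φ z')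

/-- Sections of `E` over an open set. -/
def Sec (E : Family.{u, v} Y) (U : Opens Y) : Type (max u v) :=
  {s : ∀ y : U, E.Fiber y //
    ∃ t : ∀ y, E.Fiber y, (∀ y ∈ U, E.HolAt t y) ∧ ∀ y : U, s y = t y}

end Family

/-! ### Norms and Prym varieties -/

/-- The multiplicity `e_x` of a branched covering `pr` at `x`: the least `n` such that `pr` is at most
`n`-to-one near `x` (it is `n` for `z ↦ z ^ n` at the origin). -/
def mult {Z : Type u} {Y : Type v} [TopologicalSpace Z] (pr : Z → Y) (x : Z) : ℕ :=
  sInf {n : ℕ | ∃ U ∈ 𝓝 x, ∀ y : Y, (U ∩ pr ⁻¹' {y}).encard ≤ n}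

/-- The norm `Nm_pr(E)` of a line bundle along a finite branched covering `pr : Z → Y`: the fibre at
`y` is `⨂_{pr x = y} E_x^{⊗ e_x}`, and a frame `e` of `E` over `pr⁻¹(V)` gives the frame
`y ↦ ⨂_{pr x = y} e(x)^{⊗ e_x}` over `V`. Its transition functions are thus the
norms `y ↦ ∏_{pr x = y} g(x)^{e_x}` of those of `E`. -/
def norm {Z : Type u} {Y : Type w} [TopologicalSpace Z] [HolSpace Z] [TopologicalSpace Y]
    [HolSpace Y] (pr : Z → Y) (E : Family.{u, v} Z) : Family.{w, max u v} Y where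
  Fiber y := PiTensorProduct ℂ
    (fun i : (Σ x : {x : Z // pr x = y}, Fin (mult pr x.1)) => E.Fiber i.1.1)
  HolAt s y := ∃ V : Set Y, IsOpen V ∧ y ∈ V ∧ ∃ e : ∀ x, E.Fiber x, E.IsFrameOn (pr ⁻¹' V) e ∧
    ∃ f : Y → ℂ, HolSpace.HolAt f y ∧
      ∀ᶠ y' in 𝓝 y, s y' = f y' • PiTensorProduct.tprod ℂ
        (fun i : (Σ x : {x : Z // pr x = y'}, Fin (mult pr x.1)) => e i.1.1)

/-- `E ∈ Prym(Z, Y)`: `E` is a line bundle on `Z` whose norm along `pr : Z → Y` is trivial. -/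
def InPrym {Z : Type u} {Y : Type w} [TopologicalSpace Z] [HolSpace Z] [TopologicalSpace Y]
    [HolSpace Y] (pr : Z → Y) (E : Family.{u, v} Z) : Prop :=
  E.IsLineBundle ∧ (norm pr E).Iso (Family.trivial Y)

/-! ### Anti-invariant parts of direct images -/

/-- Sections over `U` of the anti-invariant part of the direct image `pr_* E`, where the map
`τ : Z → Z` over `Y` is lifted to `E` by the linear maps `θ z : E_z → E_{τ z}`: holomorphic sections
`s` of `E` over `pr⁻¹(U)` with `s (τ z) = - θ z (s z)`. -/
def AntiSec {Z : Type u} {Y : Type w} [TopologicalSpace Z] [HolSpace Z] [TopologicalSpace Y]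
    (pr : Z → Y) (τ : Z → Z) (E : Family.{u, v} Z)
    (θ : ∀ z, E.Fiber z →ₗ[ℂ] E.Fiber (τ z)) (U : Opens Y) : Type (max u v) :=
  {s : ∀ z : {z : Z // pr z ∈ U}, E.Fiber z.1 //
    (∃ t : ∀ z, E.Fiber z, (∀ z, pr z ∈ U → E.HolAt t z) ∧
      ∀ z : {z : Z // pr z ∈ U}, s z = t z.1) ∧
    ∀ (z : Z) (h : pr z ∈ U) (h' : pr (τ z) ∈ U), s ⟨τ z, h'⟩ = - θ z (s ⟨z, h⟩)}

/-- The sheaf of sections of `N` is isomorphic, as a sheaf of `𝒪_Y`-modules, to the anti-invariant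
part of `pr_* E`: there are bijections `N(U) ≃ (pr_* E)_-(U)` for all open `U` which are
additive, `𝒪_Y(U)`-linear and compatible with restrictions. -/
def IsAntiInvariantPart {Z : Type u} {Y : Type w} [TopologicalSpace Z] [HolSpace Z]
    [TopologicalSpace Y] [HolSpace Y] (pr : Z → Y) (τ : Z → Z) (E : Family.{u, v} Z)
    (θ : ∀ z, E.Fiber z →ₗ[ℂ] E.Fiber (τ z)) (N : Family.{w, v'} Y) : Prop :=
  ∃ φ : ∀ U : Opens Y, N.Sec U ≃ AntiSec pr τ E θ U,
    (∀ (U : Opens Y) (r s t : N.Sec U), (∀ y, r.1 y = s.1 y + t.1 y) →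
      ∀ z, (φ U r).1 z = (φ U s).1 z + (φ U t).1 z) ∧
    (∀ (U : Opens Y) (f : Y → ℂ), (∀ y ∈ U, HolSpace.HolAt f y) →
      ∀ s t : N.Sec U, (∀ y : U, t.1 y = f y • s.1 y) →
        ∀ z, (φ U t).1 z = f (pr z.1) • (φ U s).1 z) ∧
    (∀ (U V : Opens Y) (h : U ≤ V) (s : N.Sec V) (t : N.Sec U),
      (∀ y : U, t.1 y = s.1 ⟨y.1, h y.2⟩) →
        ∀ z : {z : Z // pr z ∈ U}, (φ U t).1 z = (φ V s).1 ⟨z.1, h z.2⟩)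

/-! ### The canonical bundle and spectral curves -/

section Curves

variable (X : Type u) [TopologicalSpace X] [ChartedSpace ℂ X]

/-- The fibre `K_x = T_x^* X` of the canonical bundle. -/
abbrev Cot (x : X) : Type := TangentSpace 𝓘(ℂ, ℂ) x →L[ℂ] Bundle.Trivial X ℂ x

/-- The fibre `K_x^i` of the `i`-th power of the canonical bundle. -/
abbrev KPow (i : ℕ) (x : X) : Type :=
  ContinuousMultilinearMap ℂ (fun _ : Fin i => TangentSpace 𝓘(ℂ, ℂ) x) ℂ

/-- The total space of the canonical bundle. -/
abbrev TotK : Type u := TotalSpace (ℂ →L[ℂ] ℂ) (Cot X)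

variable [IsManifold 𝓘(ℂ, ℂ) ω X]

variable {X}

/-- The coordinate vector field `∂/∂z` of the chart at `x₀`. -/
def coordVec (x₀ x : X) : TangentSpace 𝓘(ℂ, ℂ) x :=
  (trivializationAt ℂ (TangentSpace 𝓘(ℂ, ℂ)) x₀).symm x (1 : ℂ)

/-- Holomorphic sections of `K^i`: in each chart, `a = f(z) dz^i` with `f` holomorphic. -/
def IsHolDiff {i : ℕ} (a : ∀ x : X, KPow X i x) : Prop :=
  ∀ x₀ : X, MDifferentiableOn 𝓘(ℂ, ℂ) 𝓘(ℂ, ℂ) (fun x => a x (fun _ => coordVec x₀ x))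
    (chartAt ℂ x₀).source

variable (X) in
/-- The base of the Hitchin fibration for `SL(4, ℂ)`: triples `(a₂, a₃, a₄)` with
`a_i ∈ H⁰(X, K^i)`. -/
structure HitchinBase where
  a₂ : ∀ x : X, KPow X 2 x
  a₃ : ∀ x : X, KPow X 3 x
  a₄ : ∀ x : X, KPow X 4 x
  hol₂ : IsHolDiff a₂
  hol₃ : IsHolDiff a₃
  hol₄ : IsHolDiff a₄

namespace HitchinBase

variable (a : HitchinBase X)

/-- The polynomial `t⁴ + a₂ t² + a₃ t + a₄` at `x`, evaluated on a tangent vector `v`.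
For `η ∈ K_x`, the value at `t = η v` is that of `η⁴ + a₂ η² + a₃ η + a₄ ∈ K_x^4` on
`(v, v, v, v)`. -/
def poly (x : X) (v : TangentSpace 𝓘(ℂ, ℂ) x) (t : ℂ) : ℂ :=
  t ^ 4 + a.a₂ x (fun _ => v) * t ^ 2 + a.a₃ x (fun _ => v) * t + a.a₄ x (fun _ => v)

/-- The zero locus of `η⁴ + a₂ η² + a₃ η + a₄` in the total space of `K`. -/
def zeroLocus : Set (TotK X) :=
  {p | ∀ v : TangentSpace 𝓘(ℂ, ℂ) p.proj, a.poly p.proj v (p.2 v) = 0}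

/-- The section `η⁴ + a₂ η² + a₃ η + a₄` of the pull-back of `K^4` to the total space of `K`,
as a function, in the trivialization given by the chart at `x₀`. -/
def localEq (x₀ : X) (p : TotK X) : ℂ :=
  a.poly p.proj (coordVec x₀ p.proj) (p.2 (coordVec x₀ p.proj))

/-- Generic points of the Hitchin base: the spectral curve is smooth, and it has only the most
generic ramification, that is, each fibre of the four-fold cover consists of four
points, or of three points (two unramified ones and a simple ramification point). -/
structure IsGeneric : Prop where
  smooth : ∀ p ∈ a.zeroLocus,
    mfderiv (𝓘(ℂ, ℂ).prod 𝓘(ℂ, ℂ →L[ℂ] ℂ)) 𝓘(ℂ, ℂ) (a.localEq p.proj) p ≠ 0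
  ramification : ∀ x : X, 3 ≤ {η : Cot X x | (⟨x, η⟩ : TotK X) ∈ a.zeroLocus}.encard

/-- The spectral curve `S`. -/
def S : Type u := {p : TotK X // p ∈ a.zeroLocus}

instance : TopologicalSpace a.S := inferInstanceAs (TopologicalSpace {p // p ∈ a.zeroLocus})

/-- Holomorphic functions on `S`: local restrictions of holomorphic functions on the total
space of `K`. -/
instance : HolSpace a.S where
  HolAt f s := ∃ F : TotK X → ℂ, ManifoldHolAt (𝓘(ℂ, ℂ).prod 𝓘(ℂ, ℂ →L[ℂ] ℂ)) F s.1 ∧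
    ∀ᶠ s' in 𝓝 s, f s' = F s'.1

/-- The covering `π : S → X`. -/
def proj (s : a.S) : X := s.1.proj

/-- The component of `S ×_X S` other than the diagonal: the closure of the
complement of the diagonal. -/
def offDiagonal : Set (a.S × a.S) := closure {q | a.proj q.1 = a.proj q.2 ∧ q.1 ≠ q.2}

theorem swap_mem_offDiagonal {q : a.S × a.S} (hq : q ∈ a.offDiagonal) :
    (q.2, q.1) ∈ a.offDiagonal :=
  map_mem_closure (f := Prod.swap) continuous_swap hq
    (fun _ h => ⟨h.1.symm, fun h' => h.2 h'.symm⟩)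

/-- The curve `(S ×_X S)_0`. -/
def SS : Type u := {q : a.S × a.S // q ∈ a.offDiagonal}

instance : TopologicalSpace a.SS := inferInstanceAs (TopologicalSpace {q // q ∈ a.offDiagonal})

/-- Holomorphic functions on `(S ×_X S)_0`: local restrictions of holomorphic functions on
`Tot(K) × Tot(K)`. -/
instance : HolSpace a.SS where
  HolAt f q := ∃ F : TotK X × TotK X → ℂ,
    ManifoldHolAt ((𝓘(ℂ, ℂ).prod 𝓘(ℂ, ℂ →L[ℂ] ℂ)).prod (𝓘(ℂ, ℂ).prod 𝓘(ℂ, ℂ →L[ℂ] ℂ)))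
      F (q.1.1.1, q.1.2.1) ∧
    ∀ᶠ q' in 𝓝 q, f q' = F (q'.1.1.1, q'.1.2.1)

/-- The projections `p₁, p₂ : (S ×_X S)_0 → S`. -/
def p₁ (q : a.SS) : a.S := q.1.1

/-- The second projection. -/
def p₂ (q : a.SS) : a.S := q.1.2

/-- The involution `τ : (x, y) ↦ (y, x)` of `(S ×_X S)_0`. -/
def τ (q : a.SS) : a.SS := ⟨(q.1.2, q.1.1), a.swap_mem_offDiagonal q.2⟩

/-- The six-fold cover `Ŝ₆ = (S ×_X S)_0 / τ`, identified with its image in `K ⊕ K²` under the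
biholomorphism `[x, y] ↦ ((x + y) / 2, x y)` from `(K ⊕ K) / τ` to `K ⊕ K²`. -/
def S₆ : Type u := Quot (fun q q' : a.SS => q' = a.τ q)

instance : TopologicalSpace a.S₆ :=
  inferInstanceAs (TopologicalSpace (Quot (fun q q' : a.SS => q' = a.τ q)))

/-- The quotient map `π_τ : (S ×_X S)_0 → Ŝ₆`. -/
def πτ (q : a.SS) : a.S₆ := Quot.mk _ q

/-- Holomorphic functions on `Ŝ₆`: those whose pull-backs to `(S ×_X S)_0` are holomorphic. -/
instance : HolSpace a.S₆ where
  HolAt f y := ∀ q : a.SS, a.πτ q = y → HolSpace.HolAt (fun q' => f (a.πτ q')) q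

/-- The graph of the involution `σ` of `Ŝ₆`, which sends a pair of roots of
`t⁴ + a₂ t² + a₃ t + a₄` to the pair formed by the two other roots (with multiplicities):
`{η₁, η₂}` is sent to `{η₃, η₄}` if `t⁴ + a₂ t² + a₃ t + a₄ = (t - η₁)(t - η₂)(t - η₃)(t - η₄)`. -/
def sigmaRel (y y' : a.S₆) : Prop :=
  ∃ q q' : a.SS, a.πτ q = y ∧ a.πτ q' = y' ∧
    ∃ (x : X) (η₁ η₂ η₃ η₄ : Cot X x),
      q.1.1.1 = ⟨x, η₁⟩ ∧ q.1.2.1 = ⟨x, η₂⟩ ∧ q'.1.1.1 = ⟨x, η₃⟩ ∧ q'.1.2.1 = ⟨x, η₄⟩ ∧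
      ∀ (v : TangentSpace 𝓘(ℂ, ℂ) x) (t : ℂ),
        a.poly x v t = (t - η₁ v) * (t - η₂ v) * (t - η₃ v) * (t - η₄ v)

/-- The quotient `Ŝ₆ / σ`. -/
def S₆σ : Type u := Quot a.sigmaRel

instance : TopologicalSpace a.S₆σ := inferInstanceAs (TopologicalSpace (Quot a.sigmaRel))

/-- The quotient map `Ŝ₆ → Ŝ₆ / σ`. -/
def πσ (y : a.S₆) : a.S₆σ := Quot.mk _ y

/-- Holomorphic functions on `Ŝ₆ / σ`: those whose pull-backs to `Ŝ₆` are holomorphic. -/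
instance : HolSpace a.S₆σ where
  HolAt f z := ∀ y : a.S₆, a.πσ y = z → HolSpace.HolAt (fun y' => f (a.πσ y')) y

/-- The line bundle `𝓛 = p₁^* L ⊗ p₂^* L` on `(S ×_X S)_0`. -/
def calL (L : Family.{u, v} a.S) : Family.{u, v} a.SS :=
  (Family.pullback a.p₁ L).tensor (Family.pullback a.p₂ L)

/-- The lift of `τ` to `𝓛`, which exchanges the two factors. -/
def swapL (L : Family.{u, v} a.S) (q : a.SS) :
    (a.calL L).Fiber q →ₗ[ℂ] (a.calL L).Fiber (a.τ q) :=
  (TensorProduct.comm ℂ (L.Fiber (a.p₁ q)) (L.Fiber (a.p₂ q))).toLinearMap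

/-- `N` is the line bundle `𝓛_-` on `Ŝ₆`: the anti-invariant part of `(π_τ)_* 𝓛`. -/
def IsLMinus (L : Family.{u, v} a.S) (N : Family.{u, w} a.S₆) : Prop :=
  N.IsLineBundle ∧ IsAntiInvariantPart a.πτ a.τ (a.calL L) (a.swapL L) N

/-- `T` is the line bundle on `Ŝ₆` with `(π_τ)_* 𝒪 = 𝒪 ⊕ T`: the anti-invariant part
of `(π_τ)_* 𝒪`. -/
def IsT (T : Family.{u, v} a.S₆) : Prop :=
  T.IsLineBundle ∧
    IsAntiInvariantPart a.πτ a.τ (Family.trivial a.SS) (fun _ => (LinearMap.id : ℂ →ₗ[ℂ] ℂ)) T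

end HitchinBase

end Curves

end SpectralPrym

end

/-! The norm of $\mathcal I_3(L)$ along $\hat S_6\to\hat S_6/\sigma$ is the pull-back to $\hat
S_6/\sigma$ of the norm of $L$ along $\pi$. The proof shows this on transition functions.

A trivialization of $Nm_\pi(L)$ supplies, over small open sets $V$ of the base, frames $e_V$ of $L$
on all of $\pi^{-1}(V)$ and nowhere zero functions $f_V$ such that the sections $f_V\,Nm(e_V)$ agree
on overlaps. The frame $e_V\boxtimes e_V$ of $\mathcal L$ is $\tau$-invariant, so an anti-invariant
section of $\mathcal L$ is an anti-invariant function times $e_V\boxtimes e_V$. The anti-invariant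
functions are freely generated over $\mathcal O_{\hat S_6}$ by the difference of roots
$\eta_1-\eta_2$ (`IsGeneric.isAntiFrameOn_rootDiff`). Hence $\mathcal L_-$ and $T$ are locally free
of rank one (`exists_isAntiInvariantPart`), and in $\mathcal L_-\otimes T^{-1}$ the factor
$\eta_1-\eta_2$ cancels. If $e_V=g\,e_{V'}$, the transition function is $g(\eta_1)g(\eta_2)$
(`IsBoxFrame.eq_smul`). Its norm along $\sigma$ is $g(\eta_1)g(\eta_2)g(\eta_3)g(\eta_4)$, which is
the norm of $g$ along $\pi$ and equals $f_{V'}/f_V$. So the functions $1/f_V$, pulled back to $\hat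
S_6/\sigma$, trivialize the norm (`IsGeneric.inPrym_tensor_dual`).

The local analysis rests on genericity. At most two of the four roots coincide over a point, so near
a double root the quartic splits as $((t-u)^2-d)(t-\rho_3)(t-\rho_4)$ with $u,d,\rho_3,\rho_4$
holomorphic on the base. Smoothness of $S$ prevents $d$ from vanishing identically. Functions of
$(z,w)$ that are odd or even in $w$ then become $w\psi(z)$ or $\psi(z)$ on the curve $w^2=d(z)$
(`exists_odd_quotient`, `exists_even_quotient`). The odd case gives the generator of $T$; the even
case gives the holomorphy of $\sigma$ where the complementary roots collide. Since a fibre has at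
least three points, $\sigma$ has no fixed points, so $\hat S_6\to\hat S_6/\sigma$ is unramified and
all its multiplicities are 1. -/

open Filter

noncomputable section

namespace SpectralPrym

/-! ### Fibre coordinates on the total space of the canonical bundle -/

section Coordinates

variable {X : Type u} [TopologicalSpace X] [ChartedSpace ℂ X] [IsManifold 𝓘(ℂ, ℂ) ω X]

/-- The model with corners of the total space of `K`. -/
abbrev modelK : ModelWithCorners ℂ (ℂ × (ℂ →L[ℂ] ℂ)) (ModelProd ℂ (ℂ →L[ℂ] ℂ)) :=
  𝓘(ℂ, ℂ).prod 𝓘(ℂ, ℂ →L[ℂ] ℂ)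

/-- The fibre coordinate `η ↦ η(∂/∂z)` on the total space of `K`. -/
def crd (x₀ : X) (p : TotK X) : ℂ := p.2 (coordVec x₀ p.proj)

variable (X) in
/-- The trivialization of the canonical bundle over a chart. -/
abbrev trivK (x₀ : X) : Trivialization (ℂ →L[ℂ] ℂ) (TotalSpace.proj : TotK X → X) :=
  trivializationAt (ℂ →L[ℂ] ℂ) (Cot X) x₀

/-- The covector `s dz` at `x`. -/
def pt (x₀ x : X) (s : ℂ) : TotK X :=
  (trivK X x₀).toOpenPartialHomeomorph.symm (x, s • ContinuousLinearMap.id ℂ ℂ)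

instance : IsManifold 𝓘(ℂ, ℂ) (1 + 1) X := IsManifold.of_le (n := ω) le_top
instance : IsManifold 𝓘(ℂ, ℂ) 1 X := IsManifold.of_le (n := ω) le_top


theorem trivK_baseSet (x₀ : X) : (trivK X x₀).baseSet = (chartAt ℂ x₀).source := by
  ext x
  simp [trivK, hom_trivializationAt_baseSet]

/-- The trivialization of the cotangent bundle is induced by that of the tangent bundle, hence reads
off the value of a covector on the coordinate vector field. -/
theorem trivK_apply {x₀ : X} {p : TotK X} (hp : p.proj ∈ (chartAt ℂ x₀).source) :
    trivK X x₀ p = (p.proj, (p.2 (coordVec x₀ p.proj)) • ContinuousLinearMap.id ℂ ℂ) := by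
  rw [trivK, hom_trivializationAt_apply]
  ext
  · rfl
  · simp [ContinuousLinearMap.inCoordinates, coordVec]
    exact congrArg p.2 (Trivialization.symmL_apply _ (by simpa using hp) _)

theorem mem_trivK_source (x₀ : X) (p : TotK X) :
    p ∈ (trivK X x₀).source ↔ p.proj ∈ (chartAt ℂ x₀).source := by
  rw [Trivialization.mem_source, trivK_baseSet]

theorem mem_trivK_target (x₀ x : X) (l : ℂ →L[ℂ] ℂ) :
    (x, l) ∈ (trivK X x₀).target ↔ x ∈ (chartAt ℂ x₀).source := by
  rw [Trivialization.mem_target, trivK_baseSet]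

theorem proj_pt {x₀ x : X} (hx : x ∈ (chartAt ℂ x₀).source) (s : ℂ) : (pt x₀ x s).proj = x :=
  (trivK X x₀).proj_symm_apply ((mem_trivK_target x₀ x _).2 hx)

theorem crd_eq_trivK {x₀ : X} {p : TotK X} (hp : p.proj ∈ (chartAt ℂ x₀).source) :
    crd x₀ p = (trivK X x₀ p).2 1 := by
  simp [trivK_apply hp, crd]

theorem crd_pt {x₀ x : X} (hx : x ∈ (chartAt ℂ x₀).source) (s : ℂ) : crd x₀ (pt x₀ x s) = s := by
  have h := (trivK X x₀).apply_symm_apply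
    ((mem_trivK_target x₀ x (s • ContinuousLinearMap.id ℂ ℂ)).2 hx)
  rw [crd_eq_trivK (by rwa [proj_pt hx]), pt]
  erw [h]
  simp

theorem pt_crd {x₀ : X} {p : TotK X} (hp : p.proj ∈ (chartAt ℂ x₀).source) :
    pt x₀ p.proj (crd x₀ p) = p := by
  have h := (trivK X x₀).symm_apply_apply ((mem_trivK_source x₀ p).2 hp)
  rw [trivK_apply hp] at h
  exact h

theorem ext_crd {x₀ : X} {p p' : TotK X} (hp : p.proj ∈ (chartAt ℂ x₀).source)
    (h : p.proj = p'.proj) (h' : crd x₀ p = crd x₀ p') : p = p' := by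
  rw [← pt_crd hp, h, h', pt_crd (h ▸ hp)]

theorem mdifferentiableAt_proj (p : TotK X) :
    MDifferentiableAt modelK 𝓘(ℂ, ℂ) (TotalSpace.proj : TotK X → X) p :=
  Bundle.mdifferentiableAt_proj _

theorem mdifferentiableAt_crd {x₀ : X} {p : TotK X} (hp : p.proj ∈ (chartAt ℂ x₀).source) :
    MDifferentiableAt modelK 𝓘(ℂ, ℂ) (crd x₀) p := by
  have h := (Trivialization.mdifferentiableAt_totalSpace_iff (IB := 𝓘(ℂ, ℂ)) (trivK X x₀)
    (fun p : TotK X => p) (x₀ := p) ((mem_trivK_source x₀ p).2 hp)).1 mdifferentiableAt_id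
  have h2 := h.2
  refine ((ContinuousLinearMap.apply ℂ ℂ (1 : ℂ)).differentiableAt.comp_mdifferentiableAt
    h2).congr_of_eventuallyEq ?_
  filter_upwards [(mdifferentiableAt_proj p).continuousAt.eventually
    ((chartAt ℂ x₀).open_source.mem_nhds hp)] with p' hp'
  exact crd_eq_trivK hp'

/-- The covector with coordinates `(z, s)` in a chart. -/
def chartPt (x₀ : X) (w : ℂ × ℂ) : TotK X := pt x₀ ((chartAt ℂ x₀).symm w.1) w.2

/-- The coordinates of a covector in a chart. -/
def chartCrd (x₀ : X) (p : TotK X) : ℂ × ℂ := (chartAt ℂ x₀ p.proj, crd x₀ p)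

theorem mdifferentiableAt_chartPt {x₀ : X} {w : ℂ × ℂ} (hw : w.1 ∈ (chartAt ℂ x₀).target) :
    MDifferentiableAt 𝓘(ℂ, ℂ × ℂ) modelK (chartPt x₀) w := by
  have hx : (chartAt ℂ x₀).symm w.1 ∈ (chartAt ℂ x₀).source := (chartAt ℂ x₀).map_target hw
  have h1 : MDifferentiableAt 𝓘(ℂ, ℂ × ℂ) 𝓘(ℂ, ℂ) (fun w : ℂ × ℂ => w.1) w :=
    differentiableAt_fst.mdifferentiableAt
  have h2 : MDifferentiableAt 𝓘(ℂ, ℂ × ℂ) 𝓘(ℂ, ℂ)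
      (fun w : ℂ × ℂ => (chartAt ℂ x₀).symm w.1) w :=
    (mdifferentiableAt_atlas_symm (I := 𝓘(ℂ, ℂ)) (chart_mem_atlas ℂ x₀) hw).comp w h1
  have h3 : MDifferentiableAt 𝓘(ℂ, ℂ × ℂ) 𝓘(ℂ, ℂ →L[ℂ] ℂ)
      (fun w : ℂ × ℂ => w.2 • ContinuousLinearMap.id ℂ ℂ) w :=
    (differentiableAt_snd.smul_const _).mdifferentiableAt
  have h4 := ((Trivialization.mdifferentiable (I := 𝓘(ℂ, ℂ)) (Cot X) (trivK X x₀)).mdifferentiableAt_symm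
    ((mem_trivK_target x₀ _ (w.2 • ContinuousLinearMap.id ℂ ℂ)).2 hx))
  exact h4.comp w (h2.prodMk h3)

theorem mdifferentiableAt_chartCrd {x₀ : X} {p : TotK X} (hp : p.proj ∈ (chartAt ℂ x₀).source) :
    MDifferentiableAt modelK 𝓘(ℂ, ℂ × ℂ) (chartCrd x₀) p := by
  have h2 : MDifferentiableAt modelK 𝓘(ℂ, ℂ) (fun p : TotK X => chartAt ℂ x₀ p.proj) p :=
    (mdifferentiableAt_atlas (I := 𝓘(ℂ, ℂ)) (chart_mem_atlas ℂ x₀) hp).comp p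
      (mdifferentiableAt_proj p)
  exact h2.prodMk_space (mdifferentiableAt_crd hp)

theorem chartPt_chartCrd {x₀ : X} {p : TotK X} (hp : p.proj ∈ (chartAt ℂ x₀).source) :
    chartPt x₀ (chartCrd x₀ p) = p := by
  simp only [chartPt, chartCrd]
  rw [(chartAt ℂ x₀).left_inv hp, pt_crd hp]

/-- Base point and fibre coordinate together are a local homeomorphism with inverse `pt`. In `comap`
form this reduces convergence in $S$, and then in $(S\times_\Sigma S)_0$, to convergence of
coordinates. -/
theorem nhds_eq_comap_crd {x₀ : X} {p : TotK X} (hp : p.proj ∈ (chartAt ℂ x₀).source) :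
    𝓝 p = comap (fun p' : TotK X => (p'.proj, crd x₀ p')) (𝓝 (p.proj, crd x₀ p)) := by
  apply le_antisymm
  · rw [← tendsto_iff_comap]
    exact (mdifferentiableAt_proj p).continuousAt.prodMk (mdifferentiableAt_crd hp).continuousAt
  · have hc : ContinuousAt (fun y : X × ℂ => pt x₀ y.1 y.2) (p.proj, crd x₀ p) := by
      have h := (trivK X x₀).toOpenPartialHomeomorph.continuousAt_symm
        ((mem_trivK_target x₀ p.proj (crd x₀ p • ContinuousLinearMap.id ℂ ℂ)).2 hp)
      refine ContinuousAt.comp (f := fun y : X × ℂ => (y.1, y.2 • ContinuousLinearMap.id ℂ ℂ)) h ?_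
      fun_prop
    have ht : Tendsto (fun p' : TotK X => pt x₀ p'.proj (crd x₀ p'))
        (comap (fun p' : TotK X => (p'.proj, crd x₀ p')) (𝓝 (p.proj, crd x₀ p))) (𝓝 p) := by
      have := hc.tendsto.comp (tendsto_comap (f := fun p' : TotK X => (p'.proj, crd x₀ p')))
      rwa [pt_crd hp] at this
    refine (tendsto_id'.1 (ht.congr' ?_))
    have hs : ∀ᶠ y : X × ℂ in 𝓝 (p.proj, crd x₀ p), y.1 ∈ (chartAt ℂ x₀).source :=
      continuousAt_fst.eventually ((chartAt ℂ x₀).open_source.mem_nhds hp)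
    filter_upwards [hs.comap _] with p' hp'
    exact pt_crd hp'

end Coordinates

/-! ### Formal properties of holomorphic functions on subspaces and quotients -/

/-- The formal properties of a sheaf of holomorphic functions. -/
class LawfulHol (Y : Type u) [TopologicalSpace Y] [HolSpace Y] : Prop where
  const : ∀ (c : ℂ) (x : Y), HolSpace.HolAt (fun _ => c) x
  mul : ∀ {f g : Y → ℂ} {x : Y}, HolSpace.HolAt f x → HolSpace.HolAt g x →
    HolSpace.HolAt (fun y => f y * g y) x
  inv : ∀ {f : Y → ℂ} {x : Y}, HolSpace.HolAt f x → f x ≠ 0 → HolSpace.HolAt (fun y => (f y)⁻¹) x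
  congr : ∀ {f g : Y → ℂ} {x : Y}, HolSpace.HolAt f x → f =ᶠ[𝓝 x] g → HolSpace.HolAt g x
  continuousAt : ∀ {f : Y → ℂ} {x : Y}, HolSpace.HolAt f x → ContinuousAt f x
  eventually : ∀ {f : Y → ℂ} {x : Y}, HolSpace.HolAt f x → ∀ᶠ y in 𝓝 x, HolSpace.HolAt f y

section Manifold

variable {V : Type u} [NormedAddCommGroup V] [NormedSpace ℂ V]
  {H : Type v} [TopologicalSpace H] {I : ModelWithCorners ℂ V H}
  {M : Type w} [TopologicalSpace M] [ChartedSpace H M] {f g : M → ℂ} {p : M}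

theorem ManifoldHolAt.const (c : ℂ) (p : M) : ManifoldHolAt I (fun _ => c) p :=
  Eventually.of_forall fun _ => mdifferentiableAt_const

theorem ManifoldHolAt.mul (hf : ManifoldHolAt I f p) (hg : ManifoldHolAt I g p) :
    ManifoldHolAt I (fun q => f q * g q) p := by
  filter_upwards [hf, hg] with q h1 h2 using h1.mul h2

theorem ManifoldHolAt.continuousAt (hf : ManifoldHolAt I f p) : ContinuousAt f p :=
  hf.self_of_nhds.continuousAt

theorem ManifoldHolAt.inv (hf : ManifoldHolAt I f p) (h0 : f p ≠ 0) :
    ManifoldHolAt I (fun q => (f q)⁻¹) p := by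
  filter_upwards [hf, hf.continuousAt.eventually_ne h0] with q h1 h2
  exact (differentiableAt_inv h2).comp_mdifferentiableAt h1

theorem ManifoldHolAt.congr (hf : ManifoldHolAt I f p) (h : f =ᶠ[𝓝 p] g) :
    ManifoldHolAt I g p := by
  filter_upwards [hf, h.eventuallyEq_nhds] with q h1 h2
  exact h1.congr_of_eventuallyEq h2.symm

theorem ManifoldHolAt.eventually (hf : ManifoldHolAt I f p) : ∀ᶠ q in 𝓝 p, ManifoldHolAt I f q :=
  eventually_eventually_nhds.2 hf

end Manifold

instance (X : Type u) [TopologicalSpace X] [ChartedSpace ℂ X] : LawfulHol X where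
  const := ManifoldHolAt.const
  mul := ManifoldHolAt.mul
  inv := ManifoldHolAt.inv
  congr := ManifoldHolAt.congr
  continuousAt := ManifoldHolAt.continuousAt
  eventually := ManifoldHolAt.eventually

/-- Holomorphic functions on a subspace of a manifold. -/
theorem lawfulHol_of_restrict {Y : Type u} [TopologicalSpace Y] [HolSpace Y]
    {V : Type*} [NormedAddCommGroup V] [NormedSpace ℂ V]
    {H : Type*} [TopologicalSpace H] (I : ModelWithCorners ℂ V H)
    {M : Type*} [TopologicalSpace M] [ChartedSpace H M] (i : Y → M) (hi : Continuous i)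
    (h : ∀ (f : Y → ℂ) (y : Y), HolSpace.HolAt f y ↔
      ∃ F : M → ℂ, ManifoldHolAt I F (i y) ∧ ∀ᶠ y' in 𝓝 y, f y' = F (i y')) : LawfulHol Y where
  const c x := (h _ _).2 ⟨_, ManifoldHolAt.const c _, Eventually.of_forall fun _ => rfl⟩
  mul {f g x} hf hg := by
    obtain ⟨F, hF, hf⟩ := (h _ _).1 hf
    obtain ⟨G, hG, hg⟩ := (h _ _).1 hg
    refine (h _ _).2 ⟨_, hF.mul hG, ?_⟩
    filter_upwards [hf, hg] with y h1 h2
    rw [h1, h2]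
  inv {f x} hf h0 := by
    obtain ⟨F, hF, hf⟩ := (h _ _).1 hf
    refine (h _ _).2 ⟨_, hF.inv (hf.self_of_nhds ▸ h0), ?_⟩
    filter_upwards [hf] with y h1
    rw [h1]
  congr {f g x} hf hg := by
    obtain ⟨F, hF, hf⟩ := (h _ _).1 hf
    refine (h _ _).2 ⟨F, hF, ?_⟩
    filter_upwards [hf, hg] with y h1 h2
    rw [← h1, h2]
  continuousAt {f x} hf := by
    obtain ⟨F, hF, hf⟩ := (h _ _).1 hf
    exact (ContinuousAt.comp (f := i) hF.continuousAt hi.continuousAt).congr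
      (hf.mono fun _ => Eq.symm)
  eventually {f x} hf := by
    obtain ⟨F, hF, hf⟩ := (h _ _).1 hf
    filter_upwards [hi.continuousAt.eventually hF.eventually, eventually_eventually_nhds.2 hf]
      with y h1 h2
    exact (h _ _).2 ⟨F, h1, h2⟩

/-- Holomorphic functions on a quotient. -/
theorem lawfulHol_of_quotient {Y : Type u} [TopologicalSpace Y] [HolSpace Y]
    {Z : Type v} [TopologicalSpace Z] [HolSpace Z] [LawfulHol Z] (pr : Z → Y)
    (hs : Function.Surjective pr) (hn : ∀ z, 𝓝 (pr z) = map pr (𝓝 z))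
    (h : ∀ (f : Y → ℂ) (y : Y), HolSpace.HolAt f y ↔
      ∀ z, pr z = y → HolSpace.HolAt (fun z' => f (pr z')) z)
    (hi : ∀ (f : Y → ℂ) (z z' : Z), pr z = pr z' → HolSpace.HolAt (fun z => f (pr z)) z →
      HolSpace.HolAt (fun z => f (pr z)) z') : LawfulHol Y where
  const c x := (h _ _).2 fun _ _ => LawfulHol.const c _
  mul hf hg := (h _ _).2 fun z hz => LawfulHol.mul ((h _ _).1 hf z hz) ((h _ _).1 hg z hz)
  inv {f x} hf h0 := (h _ _).2 fun z hz => LawfulHol.inv ((h _ _).1 hf z hz) (by rwa [hz])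
  congr {f g x} hf hg := (h _ _).2 fun z hz => by
    refine LawfulHol.congr ((h _ _).1 hf z hz) ?_
    subst hz
    rw [hn] at hg
    exact hg
  continuousAt {f x} hf := by
    obtain ⟨z, rfl⟩ := hs x
    have := LawfulHol.continuousAt ((h _ _).1 hf z rfl)
    rw [ContinuousAt, hn]
    exact this
  eventually {f x} hf := by
    obtain ⟨z, rfl⟩ := hs x
    rw [hn]
    refine (LawfulHol.eventually ((h _ _).1 hf z rfl)).mono fun z' hz' => ?_
    exact (h _ _).2 fun z'' hz'' => hi f z' z'' hz''.symm hz'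

/-! ### Quotients by an involution -/

section Involution

variable {A : Type u} {r : A → A → Prop} {i : A → A}

/-- `Quot` divides by the generated equivalence relation; for the graph of an involution its classes
are the orbits. Both $\tau$ and $\sigma$ are treated this way. -/
theorem quot_mk_eq_iff (hr : ∀ a b, r a b ↔ b = i a) (hi : ∀ a, i (i a) = a) {a b : A} :
    Quot.mk r a = Quot.mk r b ↔ b = a ∨ b = i a := by
  constructor
  · intro h
    have h' := Quot.eqvGen_exact h
    clear h
    induction h' with
    | rel x y h => exact Or.inr ((hr _ _).1 h)
    | refl x => exact Or.inl rfl
    | symm x y _ ih =>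
      rcases ih with rfl | rfl
      · exact Or.inl rfl
      · exact Or.inr (hi _).symm
    | trans x y z _ _ ih1 ih2 =>
      rcases ih1 with rfl | rfl <;> rcases ih2 with rfl | rfl
      · exact Or.inl rfl
      · exact Or.inr rfl
      · exact Or.inr rfl
      · exact Or.inl (hi _)
  · rintro (rfl | rfl)
    · rfl
    · exact Quot.sound ((hr _ _).2 rfl)

/-- The quotient map is open, because the saturation of `U` is `U ∪ i ⁻¹' U`. Germs on the quotient
can therefore be studied upstairs. -/
theorem nhds_quot_mk [TopologicalSpace A] (hr : ∀ a b, r a b ↔ b = i a) (hi : ∀ a, i (i a) = a)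
    (hc : Continuous i) (a : A) : 𝓝 (Quot.mk r a) = map (Quot.mk r) (𝓝 a) := by
  have ho : IsOpenMap (Quot.mk r) := by
    intro U hU
    refine isQuotientMap_quot_mk.isOpen_preimage.1 ?_
    have : Quot.mk r ⁻¹' (Quot.mk r '' U) = U ∪ i ⁻¹' U := by
      ext b
      simp only [Set.mem_preimage, Set.mem_image, Set.mem_union]
      constructor
      · rintro ⟨c, hc, h⟩
        rcases (quot_mk_eq_iff hr hi).1 h with rfl | rfl
        · exact Or.inl hc
        · right; rwa [hi]
      · rintro (h | h)
        · exact ⟨b, h, rfl⟩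
        · exact ⟨i b, h, (quot_mk_eq_iff hr hi).2 (Or.inr (hi b).symm)⟩
    rw [this]
    exact hU.union (hU.preimage hc)
  exact (ho.map_nhds_eq continuous_quot_mk.continuousAt).symm

end Involution

/-! ### Roots of the quartic, and the curves $S$ and $(S\times_\Sigma S)_0$ in charts -/

section Curve

variable {X : Type u} [TopologicalSpace X] [ChartedSpace ℂ X] [IsManifold 𝓘(ℂ, ℂ) ω X]

theorem exists_smul_coordVec {x₀ x : X} (hx : x ∈ (chartAt ℂ x₀).source)
    (v : TangentSpace 𝓘(ℂ, ℂ) x) : ∃ c : ℂ, v = c • coordVec x₀ x := by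
  set e := trivializationAt ℂ (TangentSpace 𝓘(ℂ, ℂ)) x₀
  have hb : x ∈ e.baseSet := by simpa [e] using hx
  refine ⟨(e ⟨x, v⟩).2, ?_⟩
  have h1 : e.symm x ((e ⟨x, v⟩).2) = v := e.symm_apply_apply_mk hb v
  have h2 : e.symm x ((e ⟨x, v⟩).2) = (e ⟨x, v⟩).2 • e.symm x 1 := by
    rw [← Trivialization.symmL_apply (R := ℂ) e hb, ← Trivialization.symmL_apply (R := ℂ) e hb,
      ← map_smul]
    simp
  exact h1.symm.trans h2

/-- Vieta's formulas for a depressed quartic. -/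
theorem quartic_factor_iff {A B C r₁ r₂ r₃ r₄ : ℂ} :
    (∀ t : ℂ, t ^ 4 + A * t ^ 2 + B * t + C = (t - r₁) * (t - r₂) * (t - r₃) * (t - r₄)) ↔
      r₁ + r₂ + r₃ + r₄ = 0 ∧ A = r₁ * r₂ + r₁ * r₃ + r₁ * r₄ + r₂ * r₃ + r₂ * r₄ + r₃ * r₄ ∧
      B = -(r₁ * r₂ * r₃ + r₁ * r₂ * r₄ + r₁ * r₃ * r₄ + r₂ * r₃ * r₄) ∧ C = r₁ * r₂ * r₃ * r₄ := by
  constructor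
  · intro h
    -- Both sides are monic quartics, so their difference is a cubic; evaluating at 0, ±1, ±2 is
    -- enough to separate its coefficients.
    have h0 := h 0
    have h1 := h 1
    have h2 := h (-1)
    have h3 := h 2
    have h4 := h (-2)
    have e1 : r₁ + r₂ + r₃ + r₄ = 0 := by
      linear_combination (1 / 12) * (h3 - h4) - (1 / 6) * (h1 - h2)
    refine ⟨e1, ?_, ?_, ?_⟩
    · linear_combination (1 / 2) * (h1 + h2) - h0
    · linear_combination (1 / 2) * (h1 - h2) - e1
    · linear_combination h0
  · rintro ⟨h1, rfl, rfl, rfl⟩ t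
    linear_combination t ^ 3 * h1

/-- Two roots of a depressed quartic, counted with multiplicity, in terms of their sum and product. -/
theorem exists_quartic_factor_iff {A B C r₁ r₂ : ℂ} :
    (∃ r₃ r₄ : ℂ, ∀ t : ℂ,
      t ^ 4 + A * t ^ 2 + B * t + C = (t - r₁) * (t - r₂) * (t - r₃) * (t - r₄)) ↔
      B = (r₁ + r₂) * (r₁ * r₂ - (A + (r₁ + r₂) ^ 2 - r₁ * r₂)) ∧
      C = r₁ * r₂ * (A + (r₁ + r₂) ^ 2 - r₁ * r₂) := by
  constructor
  · rintro ⟨r₃, r₄, h⟩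
    obtain ⟨h1, rfl, rfl, rfl⟩ := quartic_factor_iff.1 h
    obtain rfl : r₄ = -(r₁ + r₂ + r₃) := by linear_combination h1
    constructor <;> ring
  · rintro ⟨h1, h2⟩
    set s := r₁ + r₂
    -- The two remaining roots have sum `-s` and product `n`, so they solve `t ^ 2 + s * t + n = 0`,
    -- whose discriminant is `w ^ 2`.
    set n := A + s ^ 2 - r₁ * r₂ with hn
    obtain ⟨w, hw⟩ := IsAlgClosed.exists_eq_mul_self (s ^ 2 - 4 * n)
    refine ⟨(-s + w) / 2, (-s - w) / 2, quartic_factor_iff.2 ⟨by ring, ?_, ?_, ?_⟩⟩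
    · linear_combination -hn - (1 / 4 : ℂ) * hw
    · rw [h1]; linear_combination (s / 4 : ℂ) * hw
    · rw [h2]; linear_combination (-r₁ * r₂ / 4 : ℂ) * hw

namespace HitchinBase

variable (a : HitchinBase X)

/-- The coefficient `a₂` in a chart. -/
def c₂ (x₀ x : X) : ℂ := a.a₂ x fun _ => coordVec x₀ x
/-- The coefficient `a₃` in a chart. -/
def c₃ (x₀ x : X) : ℂ := a.a₃ x fun _ => coordVec x₀ x
/-- The coefficient `a₄` in a chart. -/
def c₄ (x₀ x : X) : ℂ := a.a₄ x fun _ => coordVec x₀ x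

/-- `r₁, r₂, r₃, r₄` are the roots of `η⁴ + a₂ η² + a₃ η + a₄` at `x`, in a chart. -/
def Fac (x₀ x : X) (r₁ r₂ r₃ r₄ : ℂ) : Prop :=
  ∀ t : ℂ, a.poly x (coordVec x₀ x) t = (t - r₁) * (t - r₂) * (t - r₃) * (t - r₄)

theorem fac_iff {x₀ x : X} {r₁ r₂ r₃ r₄ : ℂ} : a.Fac x₀ x r₁ r₂ r₃ r₄ ↔
    ∀ t : ℂ, t ^ 4 + a.c₂ x₀ x * t ^ 2 + a.c₃ x₀ x * t + a.c₄ x₀ x =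
      (t - r₁) * (t - r₂) * (t - r₃) * (t - r₄) := Iff.rfl

theorem poly_smul (x₀ x : X) (c t : ℂ) : a.poly x (c • coordVec x₀ x) t =
    t ^ 4 + c ^ 2 * a.c₂ x₀ x * t ^ 2 + c ^ 3 * a.c₃ x₀ x * t + c ^ 4 * a.c₄ x₀ x := by
  have h2 := (a.a₂ x).map_smul_univ (fun _ => c) (fun _ => coordVec x₀ x)
  have h3 := (a.a₃ x).map_smul_univ (fun _ => c) (fun _ => coordVec x₀ x)
  have h4 := (a.a₄ x).map_smul_univ (fun _ => c) (fun _ => coordVec x₀ x)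
  simp only [Finset.prod_const, Finset.card_univ, Fintype.card_fin, smul_eq_mul] at h2 h3 h4
  rw [poly, h2, h3, h4]
  rfl

/-- The equation is weighted homogeneous of degree 4 in the tangent vector, and the coordinate
vector spans the tangent line, so one vector suffices. -/
theorem mem_zeroLocus_iff {x₀ : X} {p : TotK X} (hp : p.proj ∈ (chartAt ℂ x₀).source) :
    p ∈ a.zeroLocus ↔ a.poly p.proj (coordVec x₀ p.proj) (crd x₀ p) = 0 := by
  constructor
  · intro h
    exact h _
  · intro h v
    obtain ⟨c, rfl⟩ := exists_smul_coordVec hp v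
    rw [poly_smul, map_smul, smul_eq_mul]
    have h' : crd x₀ p ^ 4 + a.c₂ x₀ p.proj * crd x₀ p ^ 2 + a.c₃ x₀ p.proj * crd x₀ p +
      a.c₄ x₀ p.proj = 0 := h
    rw [crd] at h'
    linear_combination c ^ 4 * h'

theorem Fac.poly_eq {a : HitchinBase X} {x₀ x : X} {r₁ r₂ r₃ r₄ : ℂ}
    (h : a.Fac x₀ x r₁ r₂ r₃ r₄) (hx : x ∈ (chartAt ℂ x₀).source) {η₁ η₂ η₃ η₄ : Cot X x}
    (h₁ : η₁ (coordVec x₀ x) = r₁) (h₂ : η₂ (coordVec x₀ x) = r₂) (h₃ : η₃ (coordVec x₀ x) = r₃)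
    (h₄ : η₄ (coordVec x₀ x) = r₄) (v : TangentSpace 𝓘(ℂ, ℂ) x) (t : ℂ) :
    a.poly x v t = (t - η₁ v) * (t - η₂ v) * (t - η₃ v) * (t - η₄ v) := by
  obtain ⟨e1, e2, e3, e4⟩ := quartic_factor_iff.1 (a.fac_iff.1 h)
  obtain ⟨c, rfl⟩ := exists_smul_coordVec hx v
  rw [poly_smul]
  simp only [map_smul, smul_eq_mul]
  rw [h₁, h₂, h₃, h₄, e2, e3, e4]
  linear_combination t ^ 3 * c * e1

theorem mdifferentiableAt_c₂ {x₀ x : X} (hx : x ∈ (chartAt ℂ x₀).source) :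
    MDifferentiableAt 𝓘(ℂ, ℂ) 𝓘(ℂ, ℂ) (a.c₂ x₀) x :=
  (a.hol₂ x₀).mdifferentiableAt ((chartAt ℂ x₀).open_source.mem_nhds hx)
theorem mdifferentiableAt_c₃ {x₀ x : X} (hx : x ∈ (chartAt ℂ x₀).source) :
    MDifferentiableAt 𝓘(ℂ, ℂ) 𝓘(ℂ, ℂ) (a.c₃ x₀) x :=
  (a.hol₃ x₀).mdifferentiableAt ((chartAt ℂ x₀).open_source.mem_nhds hx)
theorem mdifferentiableAt_c₄ {x₀ x : X} (hx : x ∈ (chartAt ℂ x₀).source) :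
    MDifferentiableAt 𝓘(ℂ, ℂ) 𝓘(ℂ, ℂ) (a.c₄ x₀) x :=
  (a.hol₄ x₀).mdifferentiableAt ((chartAt ℂ x₀).open_source.mem_nhds hx)

instance : LawfulHol a.S :=
  lawfulHol_of_restrict modelK (fun s : a.S => s.1) continuous_subtype_val fun _ _ => Iff.rfl

theorem continuous_S_val : Continuous (fun s : a.S => s.1) := continuous_subtype_val

theorem continuous_p₁ : Continuous a.p₁ := continuous_fst.comp continuous_subtype_val
theorem continuous_p₂ : Continuous a.p₂ := continuous_snd.comp continuous_subtype_val

instance : LawfulHol a.SS :=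
  lawfulHol_of_restrict (modelK.prod modelK) (fun q : a.SS => (q.1.1.1, q.1.2.1))
    ((a.continuous_S_val.comp a.continuous_p₁).prodMk (a.continuous_S_val.comp a.continuous_p₂))
    fun _ _ => Iff.rfl

theorem continuous_proj : Continuous a.proj :=
  continuous_iff_continuousAt.2 fun s =>
    ContinuousAt.comp (f := fun s : a.S => s.1) (mdifferentiableAt_proj s.1).continuousAt
      a.continuous_S_val.continuousAt

/-- The fibre coordinate on `S`. -/
def sc (x₀ : X) (s : a.S) : ℂ := crd x₀ s.1

theorem nhds_S {x₀ : X} {s : a.S} (hs : a.proj s ∈ (chartAt ℂ x₀).source) :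
    𝓝 s = comap (fun s => (a.proj s, a.sc x₀ s)) (𝓝 (a.proj s, a.sc x₀ s)) := by
  have h : 𝓝 s = comap (fun s : a.S => s.1) (𝓝 s.1) := nhds_subtype_eq_comap
  rw [h, nhds_eq_comap_crd hs, comap_comap]
  rfl

theorem continuousAt_sc {x₀ : X} {s : a.S} (hs : a.proj s ∈ (chartAt ℂ x₀).source) :
    ContinuousAt (a.sc x₀) s :=
  ContinuousAt.comp (f := fun s : a.S => s.1) (mdifferentiableAt_crd hs).continuousAt
      a.continuous_S_val.continuousAt

variable {a} in
theorem S_ext {x₀ : X} {s s' : a.S} (hs : a.proj s ∈ (chartAt ℂ x₀).source)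
    (h : a.proj s = a.proj s') (h' : a.sc x₀ s = a.sc x₀ s') : s = s' :=
  Subtype.ext (ext_crd hs h h')

theorem poly_sc (x₀ : X) (s : a.S) : a.poly (a.proj s) (coordVec x₀ (a.proj s)) (a.sc x₀ s) = 0 :=
  s.2 _

/-- The point of `S` with given fibre coordinate. -/
theorem exists_S {x₀ x : X} (hx : x ∈ (chartAt ℂ x₀).source) {r : ℂ}
    (h : a.poly x (coordVec x₀ x) r = 0) : ∃ s : a.S, a.proj s = x ∧ a.sc x₀ s = r := by
  have h1 := proj_pt hx r
  have h2 := crd_pt hx r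
  refine ⟨⟨pt x₀ x r, (a.mem_zeroLocus_iff (by rwa [h1])).2 ?_⟩, h1, h2⟩
  rw [h2, h1, h]

/-- The projection of `(S ×_X S)_0` to `X`. -/
def base (q : a.SS) : X := a.proj (a.p₁ q)

theorem continuous_base : Continuous a.base := a.continuous_proj.comp a.continuous_p₁

/-- Equality of the two projections is a closed condition because `X` is Hausdorff, so it survives
the passage to the closure. -/
theorem proj_p₂ [T2Space X] (q : a.SS) : a.proj (a.p₂ q) = a.base q := by
  have hc : IsClosed {q : a.S × a.S | a.proj q.1 = a.proj q.2} :=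
    isClosed_eq (a.continuous_proj.comp continuous_fst) (a.continuous_proj.comp continuous_snd)
  have : a.offDiagonal ⊆ {q : a.S × a.S | a.proj q.1 = a.proj q.2} :=
    closure_minimal (fun q hq => hq.1) hc
  exact (this q.2).symm

/-- The fibre coordinates on `(S ×_X S)_0`. -/
def e₁ (x₀ : X) (q : a.SS) : ℂ := a.sc x₀ (a.p₁ q)
/-- The second fibre coordinate. -/
def e₂ (x₀ : X) (q : a.SS) : ℂ := a.sc x₀ (a.p₂ q)

theorem continuousAt_e₁ {x₀ : X} {q : a.SS} (hq : a.base q ∈ (chartAt ℂ x₀).source) :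
    ContinuousAt (a.e₁ x₀) q :=
  ContinuousAt.comp (f := a.p₁) (a.continuousAt_sc hq) a.continuous_p₁.continuousAt

theorem tendsto_S {α : Type*} {l : Filter α} {f : α → a.S} {x₀ : X} {s : a.S}
    (hs : a.proj s ∈ (chartAt ℂ x₀).source) (h : Tendsto (fun i => a.proj (f i)) l (𝓝 (a.proj s)))
    (h₁ : Tendsto (fun i => a.sc x₀ (f i)) l (𝓝 (a.sc x₀ s))) : Tendsto f l (𝓝 s) := by
  rw [a.nhds_S hs, tendsto_comap_iff]
  exact h.prodMk_nhds h₁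

section T2
variable [T2Space X]

variable {a} in
theorem SS_ext {x₀ : X} {q q' : a.SS} (hq : a.base q ∈ (chartAt ℂ x₀).source)
    (h : a.base q = a.base q') (h₁ : a.e₁ x₀ q = a.e₁ x₀ q') (h₂ : a.e₂ x₀ q = a.e₂ x₀ q') :
    q = q' :=
  Subtype.ext (Prod.ext (S_ext hq h h₁)
    (S_ext (a := a) (s := a.p₂ q) (s' := a.p₂ q') (by rwa [proj_p₂])
      (by rw [proj_p₂, proj_p₂, h]) h₂))

theorem continuousAt_e₂ {x₀ : X} {q : a.SS} (hq : a.base q ∈ (chartAt ℂ x₀).source) :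
    ContinuousAt (a.e₂ x₀) q :=
  ContinuousAt.comp (f := a.p₂) (a.continuousAt_sc (by rwa [proj_p₂])) a.continuous_p₂.continuousAt

theorem tendsto_SS {α : Type*} {l : Filter α} {f : α → a.SS} {x₀ : X} {q : a.SS}
    (hq : a.base q ∈ (chartAt ℂ x₀).source) (h : Tendsto (fun i => a.base (f i)) l (𝓝 (a.base q)))
    (h₁ : Tendsto (fun i => a.e₁ x₀ (f i)) l (𝓝 (a.e₁ x₀ q)))
    (h₂ : Tendsto (fun i => a.e₂ x₀ (f i)) l (𝓝 (a.e₂ x₀ q))) : Tendsto f l (𝓝 q) := by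
  refine tendsto_subtype_rng.2 ?_
  have := (a.tendsto_S (f := fun i => a.p₁ (f i)) hq h h₁).prodMk_nhds
    (a.tendsto_S (f := fun i => a.p₂ (f i)) (s := a.p₂ q) (by rwa [proj_p₂])
      (by simpa only [proj_p₂] using h) h₂)
  exact this

/-- Two points over `x` are distinct roots or a multiple root. -/
theorem exists_fac {x₀ : X} {q : a.SS} (hq : a.base q ∈ (chartAt ℂ x₀).source) :
    ∃ r₃ r₄, a.Fac x₀ (a.base q) (a.e₁ x₀ q) (a.e₂ x₀ q) r₃ r₄ := by
  simp only [fac_iff]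
  rw [exists_quartic_factor_iff]
  -- `D` is the obstruction to the quartic being divisible by $(t-\eta_1)(t-\eta_2)$. It is
  -- continuous near the given point and vanishes at pairs of distinct roots over one base point,
  -- hence also at their limits.
  let D : a.S × a.S → ℂ × ℂ := fun p =>
    (a.c₃ x₀ (a.proj p.1) - (a.sc x₀ p.1 + a.sc x₀ p.2) * (a.sc x₀ p.1 * a.sc x₀ p.2 -
      (a.c₂ x₀ (a.proj p.1) + (a.sc x₀ p.1 + a.sc x₀ p.2) ^ 2 - a.sc x₀ p.1 * a.sc x₀ p.2)),
     a.c₄ x₀ (a.proj p.1) - a.sc x₀ p.1 * a.sc x₀ p.2 *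
      (a.c₂ x₀ (a.proj p.1) + (a.sc x₀ p.1 + a.sc x₀ p.2) ^ 2 - a.sc x₀ p.1 * a.sc x₀ p.2))
  have hq' : a.proj q.1.2 ∈ (chartAt ℂ x₀).source := by
    have := a.proj_p₂ q
    rw [p₂] at this
    rwa [this]
  have hp : ContinuousAt (fun p : a.S × a.S => a.proj p.1) q.1 :=
    (a.continuous_proj.comp continuous_fst).continuousAt
  have h1 : ContinuousAt (fun p : a.S × a.S => a.sc x₀ p.1) q.1 :=
    ContinuousAt.comp (f := Prod.fst) (a.continuousAt_sc hq) continuous_fst.continuousAt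
  have h2 : ContinuousAt (fun p : a.S × a.S => a.sc x₀ p.2) q.1 :=
    ContinuousAt.comp (f := Prod.snd) (a.continuousAt_sc hq') continuous_snd.continuousAt
  have g2 : ContinuousAt (fun p : a.S × a.S => a.c₂ x₀ (a.proj p.1)) q.1 :=
    ContinuousAt.comp (g := a.c₂ x₀) (a.mdifferentiableAt_c₂ hq).continuousAt hp
  have g3 : ContinuousAt (fun p : a.S × a.S => a.c₃ x₀ (a.proj p.1)) q.1 :=
    ContinuousAt.comp (g := a.c₃ x₀) (a.mdifferentiableAt_c₃ hq).continuousAt hp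
  have g4 : ContinuousAt (fun p : a.S × a.S => a.c₄ x₀ (a.proj p.1)) q.1 :=
    ContinuousAt.comp (g := a.c₄ x₀) (a.mdifferentiableAt_c₄ hq).continuousAt hp
  have hD : ContinuousAt D q.1 := by fun_prop
  have hD0 : D q.1 = 0 := by
    by_contra hne
    have hs := hp.eventually ((chartAt ℂ x₀).open_source.mem_nhds hq)
    obtain ⟨p, ⟨hpp, hpn⟩, hpd, hps⟩ :=
      ((mem_closure_iff_frequently.1 q.2).and_eventually ((hD.eventually_ne hne).and hs)).exists
    refine hpd ?_
    have r1 := a.poly_sc x₀ p.1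
    have r2 := a.poly_sc x₀ p.2
    rw [← hpp] at r2
    have hne' : a.sc x₀ p.1 - a.sc x₀ p.2 ≠ 0 := fun h =>
      hpn (S_ext hps hpp (sub_eq_zero.1 h))
    change a.sc x₀ p.1 ^ 4 + a.c₂ x₀ (a.proj p.1) * a.sc x₀ p.1 ^ 2 +
      a.c₃ x₀ (a.proj p.1) * a.sc x₀ p.1 + a.c₄ x₀ (a.proj p.1) = 0 at r1
    change a.sc x₀ p.2 ^ 4 + a.c₂ x₀ (a.proj p.1) * a.sc x₀ p.2 ^ 2 +
      a.c₃ x₀ (a.proj p.1) * a.sc x₀ p.2 + a.c₄ x₀ (a.proj p.1) = 0 at r2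
    -- Each component of `D`, multiplied by the difference of the two roots, is a combination of the
    -- two root equations.
    refine Prod.ext (mul_left_cancel₀ hne' ?_) (mul_left_cancel₀ hne' ?_) <;>
      simp only [D, Prod.fst_zero, Prod.snd_zero, mul_zero]
    · linear_combination r1 - r2
    · linear_combination a.sc x₀ p.1 * r2 - a.sc x₀ p.2 * r1
  exact ⟨sub_eq_zero.1 (congrArg Prod.fst hD0), sub_eq_zero.1 (congrArg Prod.snd hD0)⟩

end T2

end HitchinBase
end Curve

/-! ### Holomorphic roots, and division on the curve $w^2=d(z)$ -/

/-- A simple root of a depressed quartic depends holomorphically on the coefficients. -/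
theorem exists_analyticAt_root {α β γ : ℂ → ℂ} {z₀ r : ℂ} (hα : AnalyticAt ℂ α z₀)
    (hβ : AnalyticAt ℂ β z₀) (hγ : AnalyticAt ℂ γ z₀)
    (h0 : r ^ 4 + α z₀ * r ^ 2 + β z₀ * r + γ z₀ = 0) (h1 : 4 * r ^ 3 + 2 * α z₀ * r + β z₀ ≠ 0) :
    ∃ ρ : ℂ → ℂ, AnalyticAt ℂ ρ z₀ ∧ ρ z₀ = r ∧ ∀ᶠ w : ℂ × ℂ in 𝓝 (z₀, r),
      w.2 ^ 4 + α w.1 * w.2 ^ 2 + β w.1 * w.2 + γ w.1 = 0 ↔ ρ w.1 = w.2 := by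
  set f : ℂ × ℂ → ℂ := fun w => w.2 ^ 4 + α w.1 * w.2 ^ 2 + β w.1 * w.2 + γ w.1 with hf
  have ha : ContDiffAt ℂ 1 (fun w : ℂ × ℂ => α w.1) (z₀, r) :=
    ContDiffAt.comp (g := α) (z₀, r) hα.contDiffAt contDiffAt_fst
  have hb : ContDiffAt ℂ 1 (fun w : ℂ × ℂ => β w.1) (z₀, r) :=
    ContDiffAt.comp (g := β) (z₀, r) hβ.contDiffAt contDiffAt_fst
  have hc : ContDiffAt ℂ 1 (fun w : ℂ × ℂ => γ w.1) (z₀, r) :=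
    ContDiffAt.comp (g := γ) (z₀, r) hγ.contDiffAt contDiffAt_fst
  have hfc : ContDiffAt ℂ 1 f (z₀, r) := by
    exact (((contDiffAt_snd.pow 4).add (ha.mul (contDiffAt_snd.pow 2))).add
      (hb.mul contDiffAt_snd)).add hc
  have hd : HasFDerivAt f (fderiv ℂ f (z₀, r)) (z₀, r) :=
    (hfc.differentiableAt one_ne_zero).hasFDerivAt
  have hv : fderiv ℂ f (z₀, r) ((0 : ℂ), (1 : ℂ)) = 4 * r ^ 3 + 2 * α z₀ * r + β z₀ := by
    have e1 : HasDerivAt (fun t : ℂ => f (z₀, t)) (fderiv ℂ f (z₀, r) ((0 : ℂ), (1 : ℂ))) r :=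
      HasFDerivAt.comp_hasDerivAt (f := fun t : ℂ => (z₀, t)) r hd
        ((hasDerivAt_const r z₀).prodMk (hasDerivAt_id r))
    have e2 : HasDerivAt (fun t : ℂ => f (z₀, t)) (4 * r ^ 3 + 2 * α z₀ * r + β z₀) r := by
      have := (((hasDerivAt_pow 4 r).add ((hasDerivAt_pow 2 r).const_mul (α z₀))).add
        ((hasDerivAt_id r).const_mul (β z₀))).add_const (γ z₀)
      convert! this using 1
      norm_num
      ring
    exact e1.unique e2
  have hinv : (fderiv ℂ f (z₀, r) ∘L .inr ℂ ℂ ℂ).IsInvertible := by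
    refine ⟨ContinuousLinearEquiv.unitsEquivAut ℂ (Units.mk0 _ h1), ?_⟩
    ext
    simp [hv]
  refine ⟨hfc.implicitFunction one_ne_zero hinv, ?_,
    hfc.implicitFunction_apply_self one_ne_zero hinv, ?_⟩
  · rw [Complex.analyticAt_iff_eventually_differentiableAt]
    exact ((hfc.contDiffAt_implicitFunction one_ne_zero hinv).eventually (by simp)).mono
      fun z hz => hz.differentiableAt one_ne_zero
  · have := hfc.eventually_apply_eq_iff_implicitFunction one_ne_zero hinv
    have h0' : f (z₀, r) = 0 := h0
    rwa [h0'] at this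

/-- A square root of a function. -/
theorem cpow_half_sq (c : ℂ) : (c ^ (1 / 2 : ℂ)) ^ 2 = c := by
  simp

/-- The principal square root may jump across its cut, but its absolute value is $\sqrt{|d|}$, so it
is continuous where `d` vanishes. -/
theorem tendsto_cpow_half {d : ℂ → ℂ} {z₀ : ℂ} (hd : ContinuousAt d z₀) (hd0 : d z₀ = 0) :
    Tendsto (fun z => d z ^ (1 / 2 : ℂ)) (𝓝 z₀) (𝓝 0) := by
  have h1 : Tendsto (fun z => ‖d z‖) (𝓝 z₀) (𝓝 0) := by
    simpa [hd0] using hd.norm.tendsto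
  have h2 : Tendsto (fun z => Real.sqrt ‖d z‖) (𝓝 z₀) (𝓝 0) := by
    have := (Real.continuous_sqrt.tendsto 0).comp h1
    rwa [Real.sqrt_zero] at this
  refine tendsto_zero_iff_norm_tendsto_zero.2 (h2.congr fun z => ?_)
  rw [← cpow_half_sq (d z), norm_pow, Real.sqrt_sq (norm_nonneg _), cpow_half_sq]

/-- A holomorphic function of `(z, w)` which is odd in `w` is `w` times a holomorphic function
of `z` on the curve `w² = d(z)`. -/
theorem exists_odd_quotient {G : ℂ × ℂ → ℂ} {d : ℂ → ℂ} {z₀ : ℂ}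
    (hG : ∀ᶠ w in 𝓝 (z₀, (0 : ℂ)), DifferentiableAt ℂ G w)
    (hodd : ∀ᶠ w in 𝓝 (z₀, (0 : ℂ)), G (w.1, -w.2) = -G w)
    (hd : AnalyticAt ℂ d z₀) (hd0 : d z₀ = 0) (hd1 : ∀ᶠ z in 𝓝[≠] z₀, d z ≠ 0) :
    ∃ ψ : ℂ → ℂ, AnalyticAt ℂ ψ z₀ ∧
      ∀ᶠ w in 𝓝 (z₀, (0 : ℂ)), w.2 ^ 2 = d w.1 → G w = w.2 * ψ w.1 := by
  have hcont : ContinuousAt G (z₀, 0) := hG.self_of_nhds.continuousAt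
  have hbd : ∀ᶠ w in 𝓝 (z₀, (0 : ℂ)), ‖G w‖ < ‖G (z₀, 0)‖ + 1 :=
    hcont.norm.eventually (gt_mem_nhds (lt_add_one _))
  set M := ‖G (z₀, 0)‖ + 1
  obtain ⟨r, hr, hball⟩ := Metric.eventually_nhds_iff_ball.1 (hG.and (hodd.and hbd))
  have hrect : ∀ z ζ : ℂ, dist z z₀ < r → ‖ζ‖ < r → (z, ζ) ∈ Metric.ball (z₀, (0 : ℂ)) r := by
    intro z ζ h1 h2
    rw [Metric.mem_ball, Prod.dist_eq]
    exact max_lt h1 (by simpa using h2)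
  have hdz : ∀ᶠ z in 𝓝 z₀, DifferentiableAt ℂ d z ∧ ‖d z‖ < r ^ 2 ∧ (z ≠ z₀ → d z ≠ 0) ∧
      dist z z₀ < r := by
    refine ((Complex.analyticAt_iff_eventually_differentiableAt.1 hd).and
      ((hd.continuousAt.norm.eventually (gt_mem_nhds ?_)).and
        ((eventually_nhdsWithin_iff.1 hd1).and (Metric.ball_mem_nhds z₀ hr))))
    simp only [hd0, norm_zero]
    positivity
  obtain ⟨s, hs, hball'⟩ := Metric.eventually_nhds_iff_ball.1 hdz
  set wz : ℂ → ℂ := fun z => (d z) ^ (1 / 2 : ℂ) with hwz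
  have hw2 : ∀ z, wz z ^ 2 = d z := fun z => cpow_half_sq _
  have hsmall : ∀ z ∈ Metric.ball z₀ s, ∀ ζ : ℂ, ζ ^ 2 = d z → ‖ζ‖ < r := by
    intro z hz ζ hζ
    have := (hball' z hz).2.1
    rw [← hζ, norm_pow] at this
    exact lt_of_pow_lt_pow_left₀ 2 hr.le this
  -- Since `G` is odd in the second variable, `G (z, ζ) / ζ` does not depend on the choice of the
  -- square root `ζ` of `d z`, so it is a function of `z` alone.
  have hpm : ∀ z ∈ Metric.ball z₀ s, z ≠ z₀ → ∀ ζ : ℂ, ζ ^ 2 = d z →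
      G (z, ζ) / ζ = G (z, wz z) / wz z := by
    intro z hz hne ζ hζ
    have : ζ ^ 2 = wz z ^ 2 := by rw [hζ, hw2]
    rcases sq_eq_sq_iff_eq_or_eq_neg.1 this with rfl | rfl
    · rfl
    · rw [(hball _ (hrect z (wz z) (hball' z hz).2.2.2 (hsmall z hz _ (hw2 z)))).2.1]
      rw [neg_div_neg_eq]
  set f : ℂ → ℂ := fun z => G (z, wz z) / wz z with hf
  have hdiff : DifferentiableOn ℂ f (Metric.ball z₀ s \ {z₀}) := by
    rintro z₁ ⟨hz₁, hne⟩
    have hne' : z₁ ≠ z₀ := hne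
    have hd₁ : d z₁ ≠ 0 := (hball' z₁ hz₁).2.2.1 hne'
    -- A branch of $\sqrt d$ holomorphic near `z₁`: after dividing by `d z₁` the principal root is
    -- taken near 1, away from the cut.
    set b : ℂ → ℂ := fun z => wz z₁ * (d z / d z₁) ^ (1 / 2 : ℂ) with hb
    have hb2 : ∀ z, b z ^ 2 = d z := by
      intro z
      rw [hb]
      simp only
      rw [mul_pow, hw2]
      refine (congrArg (d z₁ * ·) (cpow_half_sq _)).trans ?_
      field_simp
    have hbd : DifferentiableAt ℂ b z₁ := by
      refine ((((hball' z₁ hz₁).1.div_const _).cpow_const ?_).const_mul _)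
      rw [div_self hd₁]
      exact Complex.one_mem_slitPlane
    have hbne : b z₁ ≠ 0 := fun h => hd₁ (by rw [← hb2, h]; simp)
    have hGb : DifferentiableAt ℂ (fun z => G (z, b z)) z₁ :=
      DifferentiableAt.comp (g := G) z₁
        (hball _ (hrect z₁ (b z₁) (hball' z₁ hz₁).2.2.2 (hsmall z₁ hz₁ _ (hb2 z₁)))).1
        (differentiableAt_id.prodMk hbd)
    have h2 : DifferentiableAt ℂ (fun z => G (z, b z) / b z) z₁ := hGb.div hbd hbne
    refine (h2.congr_of_eventuallyEq ?_).differentiableWithinAt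
    filter_upwards [Metric.isOpen_ball.mem_nhds hz₁, isOpen_ne.mem_nhds hne'] with z h3 h4
    exact (hpm z h3 h4 _ (hb2 z)).symm
  -- By the Schwarz lemma in `ζ`, where `G (z, 0) = 0` by oddness, `‖G (z, ζ)‖` is at most `M / r *
  -- ‖ζ‖`, uniformly in `z`. The factor 2 in the bound is slack.
  have hbound : BddAbove (Norm.norm ∘ f '' (Metric.ball z₀ s \ {z₀})) := by
    refine ⟨2 * M / r, ?_⟩
    rintro _ ⟨z, ⟨hz, hne⟩, rfl⟩
    have hz0 : G (z, 0) = 0 := by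
      have := (hball _ (hrect z 0 (hball' z hz).2.2.2 (by simpa using hr))).2.1
      simp only [neg_zero] at this
      exact self_eq_neg.1 this
    have hwr := hsmall z hz _ (hw2 z)
    have hS := Complex.dist_le_div_mul_dist_of_mapsTo_ball (f := fun ζ => G (z, ζ)) (c := 0)
      (R₁ := r) (R₂ := M) (z := wz z) ?_ ?_ (by simpa using hwr)
    · simp only [hz0, dist_zero_right] at hS
      have hwpos : 0 < ‖wz z‖ := by
        rw [norm_pos_iff]
        intro h
        refine (hball' z hz).2.2.1 hne ?_
        rw [← hw2, h]; simp
      simp only [Function.comp_apply, hf, norm_div]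
      rw [div_le_iff₀ hwpos]
      refine hS.trans (mul_le_mul_of_nonneg_right ?_ hwpos.le)
      gcongr
      have : 0 ≤ M := by positivity
      linarith
    · intro ζ hζ
      refine (DifferentiableAt.comp (g := G) ζ (hball _ (hrect z ζ (hball' z hz).2.2.2 ?_)).1
        ((differentiableAt_const z).prodMk differentiableAt_id)).differentiableWithinAt
      simpa using hζ
    · intro ζ hζ
      have := (hball _ (hrect z ζ (hball' z hz).2.2.2 (by simpa using hζ))).2.2
      simpa [hz0] using this.le
  -- Riemann's removable singularity theorem extends the quotient across `z₀`. No information on the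
  -- order of vanishing of `d` enters.
  have hrem := Complex.differentiableOn_update_limUnder_of_bddAbove
    (Metric.ball_mem_nhds z₀ hs) hdiff hbound
  refine ⟨_, hrem.analyticAt (Metric.ball_mem_nhds z₀ hs), ?_⟩
  have hev : ∀ᶠ w : ℂ × ℂ in 𝓝 (z₀, (0 : ℂ)), w.1 ∈ Metric.ball z₀ s :=
    continuousAt_fst.eventually (Metric.ball_mem_nhds z₀ hs)
  filter_upwards [hev, hodd] with w hw hwo hsq
  by_cases hz : w.1 = z₀
  · have h2 : w.2 = 0 := by
      rw [hz, hd0] at hsq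
      exact pow_eq_zero_iff (two_ne_zero) |>.1 hsq
    have : G w = 0 := by
      rw [h2, neg_zero, ← h2] at hwo
      exact self_eq_neg.1 hwo
    rw [this, h2, zero_mul]
  · have hne : w.2 ≠ 0 := by
      intro h
      refine (hball' w.1 hw).2.2.1 hz ?_
      rw [← hsq, h]; simp
    rw [Function.update_of_ne hz, hf]
    simp only
    rw [← hpm w.1 hw hz w.2 hsq]
    field_simp

/-- A holomorphic function of `(z, w)` which is even in `w` is a holomorphic function
of `z` on the curve `w² = d(z)`. -/
theorem exists_even_quotient {G : ℂ × ℂ → ℂ} {d : ℂ → ℂ} {z₀ : ℂ}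
    (hG : ∀ᶠ w in 𝓝 (z₀, (0 : ℂ)), DifferentiableAt ℂ G w)
    (heven : ∀ᶠ w in 𝓝 (z₀, (0 : ℂ)), G (w.1, -w.2) = G w)
    (hd : AnalyticAt ℂ d z₀) (hd0 : d z₀ = 0) (hd1 : ∀ᶠ z in 𝓝[≠] z₀, d z ≠ 0) :
    ∃ ψ : ℂ → ℂ, AnalyticAt ℂ ψ z₀ ∧
      ∀ᶠ w in 𝓝 (z₀, (0 : ℂ)), w.2 ^ 2 = d w.1 → G w = ψ w.1 := by
  -- `w * G` is odd; dividing it by `w` recovers `G` away from `z₀`, and at `z₀` by continuity.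
  obtain ⟨ψ, hψ, h⟩ := exists_odd_quotient (G := fun w => w.2 * G w)
    (hG.mono fun w hw => differentiableAt_snd.mul hw)
    (heven.mono fun w hw => by simp only; rw [hw]; ring) hd hd0 hd1
  refine ⟨ψ, hψ, ?_⟩
  set wz : ℂ → ℂ := fun z => (d z) ^ (1 / 2 : ℂ) with hwz
  have hw2 : ∀ z, wz z ^ 2 = d z := fun z => cpow_half_sq _
  have htw : Tendsto wz (𝓝 z₀) (𝓝 0) := tendsto_cpow_half hd.continuousAt hd0
  have htz : Tendsto (fun z => (z, wz z)) (𝓝[≠] z₀) (𝓝 (z₀, (0 : ℂ))) :=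
    (tendsto_id.prodMk_nhds htw).mono_left nhdsWithin_le_nhds
  have hz₀ : G (z₀, 0) = ψ z₀ := by
    refine tendsto_nhds_unique (f := fun z => G (z, wz z)) (l := 𝓝[≠] z₀)
      (hG.self_of_nhds.continuousAt.tendsto.comp htz) ?_
    refine (hψ.continuousAt.tendsto.mono_left nhdsWithin_le_nhds).congr' ?_
    filter_upwards [htz.eventually h, hd1] with z hz hz1
    have hne : wz z ≠ 0 := fun h' => hz1 (by rw [← hw2, h']; simp)
    exact (mul_left_cancel₀ hne (hz (hw2 z))).symm
  have hd1' : ∀ᶠ w : ℂ × ℂ in 𝓝 (z₀, (0 : ℂ)), w.1 ≠ z₀ → d w.1 ≠ 0 :=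
    (continuousAt_fst (p := (z₀, (0 : ℂ)))).eventually (eventually_nhdsWithin_iff.1 hd1)
  filter_upwards [h, hd1'] with w hw hw1 hsq
  by_cases hz : w.1 = z₀
  · have h2 : w.2 = 0 := by
      rw [hz, hd0] at hsq
      exact pow_eq_zero_iff (two_ne_zero) |>.1 hsq
    have : w = (z₀, 0) := Prod.ext hz h2
    rw [this, hz₀]
  · have hne : w.2 ≠ 0 := by
      intro h
      refine hw1 hz ?_
      rw [← hsq, h]; simp
    exact mul_left_cancel₀ hne (hw hsq)

/-! ### Local form of the four-fold cover -/

section Curve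

set_option linter.unusedSectionVars false

variable {X : Type u} [TopologicalSpace X] [ChartedSpace ℂ X] [IsManifold 𝓘(ℂ, ℂ) ω X]

/-- A holomorphic function on a chart, as a function on the plane. -/
theorem analyticAt_comp_chart_symm {x₀ : X} {f : X → ℂ} (hf : ManifoldHolAt 𝓘(ℂ, ℂ) f x₀) :
    AnalyticAt ℂ (fun z => f ((chartAt ℂ x₀).symm z)) (chartAt ℂ x₀ x₀) := by
  rw [Complex.analyticAt_iff_eventually_differentiableAt]
  have h0 := mem_chart_source ℂ x₀
  have ht := (chartAt ℂ x₀).open_target.mem_nhds ((chartAt ℂ x₀).map_source h0)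
  have hc := (chartAt ℂ x₀).continuousAt_symm ((chartAt ℂ x₀).map_source h0)
  rw [ContinuousAt, (chartAt ℂ x₀).left_inv h0] at hc
  filter_upwards [ht, hc.eventually hf] with z hz hfz
  exact mdifferentiableAt_iff_differentiableAt.1 (hfz.comp z
    (mdifferentiableAt_atlas_symm (I := 𝓘(ℂ, ℂ)) (chart_mem_atlas ℂ x₀) hz))

theorem tendsto_chart (x₀ : X) : Tendsto (chartAt ℂ x₀) (𝓝 x₀) (𝓝 (chartAt ℂ x₀ x₀)) :=
  (chartAt ℂ x₀).continuousAt (mem_chart_source ℂ x₀)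

theorem tendsto_chart_symm (x₀ : X) :
    Tendsto (chartAt ℂ x₀).symm (𝓝 (chartAt ℂ x₀ x₀)) (𝓝 x₀) := by
  have h0 := mem_chart_source ℂ x₀
  have hc := (chartAt ℂ x₀).continuousAt_symm ((chartAt ℂ x₀).map_source h0)
  rwa [ContinuousAt, (chartAt ℂ x₀).left_inv h0] at hc

theorem eventually_mem_chart (x₀ : X) : ∀ᶠ x in 𝓝 x₀, x ∈ (chartAt ℂ x₀).source :=
  (chartAt ℂ x₀).open_source.mem_nhds (mem_chart_source ℂ x₀)

/-- The left-hand side is the derivative of the quartic at `r₄`. It is nonzero exactly when `r₄` is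
a simple root, which is what the implicit function theorem requires. -/
theorem exists_simple_quadratic {A B C r₁ r₂ r₃ r₄ : ℂ}
    (h : ∀ t : ℂ, t ^ 4 + A * t ^ 2 + B * t + C = (t - r₁) * (t - r₂) * (t - r₃) * (t - r₄)) :
    4 * r₄ ^ 3 + 2 * A * r₄ + B = (r₄ - r₁) * (r₄ - r₂) * (r₄ - r₃) := by
  obtain ⟨h1, rfl, rfl, rfl⟩ := quartic_factor_iff.1 h
  linear_combination 3 * r₄ ^ 2 * h1

/-- A depressed quartic with two distinct roots `p`, `q` is `((t - u)² - w²)(t - p)(t - q)`. -/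
theorem quartic_factor_of_two_roots {A B C p q u w : ℂ} (hne : p - q ≠ 0)
    (hp : p ^ 4 + A * p ^ 2 + B * p + C = 0) (hq : q ^ 4 + A * q ^ 2 + B * q + C = 0)
    (hu : p + q = -(2 * u)) (hw : w ^ 2 = u ^ 2 - (A + 4 * u ^ 2 - p * q)) (t : ℂ) :
    t ^ 4 + A * t ^ 2 + B * t + C = (t - (u + w)) * (t - (u - w)) * (t - p) * (t - q) := by
  obtain rfl : p = -(2 * u) - q := by linear_combination hu
  refine quartic_factor_iff.2 ⟨by ring, ?_, ?_, ?_⟩ t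
  · linear_combination hw
  · refine mul_left_cancel₀ hne ?_
    linear_combination hp - hq + ((-(2 * u) - q) - q) * (2 * u) * hw
  · refine mul_left_cancel₀ hne ?_
    linear_combination (-(2 * u) - q) * hq - q * hp +
      ((-(2 * u) - q) - q) * (-(2 * u) - q) * q * hw

namespace HitchinBase

variable (a : HitchinBase X)

theorem Fac.swap₁₂ {a : HitchinBase X} {x₀ x : X} {r₁ r₂ r₃ r₄ : ℂ} (h : a.Fac x₀ x r₁ r₂ r₃ r₄) :
    a.Fac x₀ x r₂ r₁ r₃ r₄ := fun t => by rw [h t]; ring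

theorem Fac.swap₃₄ {a : HitchinBase X} {x₀ x : X} {r₁ r₂ r₃ r₄ : ℂ} (h : a.Fac x₀ x r₁ r₂ r₃ r₄) :
    a.Fac x₀ x r₁ r₂ r₄ r₃ := fun t => by rw [h t]; ring

theorem Fac.symm {a : HitchinBase X} {x₀ x : X} {r₁ r₂ r₃ r₄ : ℂ} (h : a.Fac x₀ x r₁ r₂ r₃ r₄) :
    a.Fac x₀ x r₃ r₄ r₁ r₂ := fun t => by rw [h t]; ring

theorem Fac.swap₂₃ {a : HitchinBase X} {x₀ x : X} {r₁ r₂ r₃ r₄ : ℂ} (h : a.Fac x₀ x r₁ r₂ r₃ r₄) :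
    a.Fac x₀ x r₁ r₃ r₂ r₄ := fun t => by rw [h t]; ring

theorem Fac.root {a : HitchinBase X} {x₀ x : X} {r₁ r₂ r₃ r₄ t : ℂ} (h : a.Fac x₀ x r₁ r₂ r₃ r₄)
    (ht : a.poly x (coordVec x₀ x) t = 0) : t = r₁ ∨ t = r₂ ∨ t = r₃ ∨ t = r₄ := by
  rw [h t] at ht
  simp only [mul_eq_zero, sub_eq_zero] at ht
  tauto

/-- The coefficients, in a chart, are holomorphic. -/
theorem analyticAt_c₂ (x₀ : X) :
    AnalyticAt ℂ (fun z => a.c₂ x₀ ((chartAt ℂ x₀).symm z)) (chartAt ℂ x₀ x₀) :=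
  analyticAt_comp_chart_symm ((eventually_mem_chart x₀).mono fun _ => a.mdifferentiableAt_c₂)
theorem analyticAt_c₃ (x₀ : X) :
    AnalyticAt ℂ (fun z => a.c₃ x₀ ((chartAt ℂ x₀).symm z)) (chartAt ℂ x₀ x₀) :=
  analyticAt_comp_chart_symm ((eventually_mem_chart x₀).mono fun _ => a.mdifferentiableAt_c₃)
theorem analyticAt_c₄ (x₀ : X) :
    AnalyticAt ℂ (fun z => a.c₄ x₀ ((chartAt ℂ x₀).symm z)) (chartAt ℂ x₀ x₀) :=
  analyticAt_comp_chart_symm ((eventually_mem_chart x₀).mono fun _ => a.mdifferentiableAt_c₄)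

/-- A simple root extends to a holomorphic family of roots. -/
theorem exists_root_function {x₀ : X} {r₁ r₂ r₃ r₄ : ℂ} (h : a.Fac x₀ x₀ r₁ r₂ r₃ r₄)
    (h₁ : r₄ ≠ r₁) (h₂ : r₄ ≠ r₂) (h₃ : r₄ ≠ r₃) :
    ∃ ρ : ℂ → ℂ, AnalyticAt ℂ ρ (chartAt ℂ x₀ x₀) ∧ ρ (chartAt ℂ x₀ x₀) = r₄ ∧
      ∀ᶠ y : X × ℂ in 𝓝 (x₀, r₄),
        a.poly y.1 (coordVec x₀ y.1) y.2 = 0 ↔ ρ (chartAt ℂ x₀ y.1) = y.2 := by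
  have h0 := mem_chart_source ℂ x₀
  obtain ⟨ρ, hρ, hρ0, hev⟩ := exists_analyticAt_root (r := r₄) (a.analyticAt_c₂ x₀)
    (a.analyticAt_c₃ x₀) (a.analyticAt_c₄ x₀)
    (by
      rw [(chartAt ℂ x₀).left_inv h0]
      have := a.fac_iff.1 h r₄
      rw [this]; ring)
    (by
      rw [(chartAt ℂ x₀).left_inv h0, exists_simple_quadratic (a.fac_iff.1 h)]
      exact mul_ne_zero (mul_ne_zero (sub_ne_zero.2 h₁) (sub_ne_zero.2 h₂)) (sub_ne_zero.2 h₃))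
  refine ⟨ρ, hρ, hρ0, ?_⟩
  have ht : Tendsto (fun y : X × ℂ => (chartAt ℂ x₀ y.1, y.2)) (𝓝 (x₀, r₄))
      (𝓝 (chartAt ℂ x₀ x₀, r₄)) :=
    ((tendsto_chart x₀).comp (continuousAt_fst (p := (x₀, r₄)))).prodMk_nhds
      (continuousAt_snd (p := (x₀, r₄)))
  have hs : ∀ᶠ y : X × ℂ in 𝓝 (x₀, r₄), y.1 ∈ (chartAt ℂ x₀).source :=
    (continuousAt_fst (p := (x₀, r₄))).eventually (eventually_mem_chart x₀)
  filter_upwards [ht.eventually hev, hs] with y hy hys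
  simp only [(chartAt ℂ x₀).left_inv hys] at hy
  exact hy

/-- The local structure of the four-fold cover near two simple roots `r₃`, `r₄`. -/
theorem exists_local_factorization {x₀ : X} {r₁ r₂ r₃ r₄ : ℂ} (h : a.Fac x₀ x₀ r₁ r₂ r₃ r₄)
    (h₁₃ : r₁ ≠ r₃) (h₁₄ : r₁ ≠ r₄) (h₂₃ : r₂ ≠ r₃) (h₂₄ : r₂ ≠ r₄) (h₃₄ : r₃ ≠ r₄) :
    ∃ ρ₃ ρ₄ u d : ℂ → ℂ, AnalyticAt ℂ ρ₃ (chartAt ℂ x₀ x₀) ∧ AnalyticAt ℂ ρ₄ (chartAt ℂ x₀ x₀) ∧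
      AnalyticAt ℂ u (chartAt ℂ x₀ x₀) ∧ AnalyticAt ℂ d (chartAt ℂ x₀ x₀) ∧
      ρ₃ (chartAt ℂ x₀ x₀) = r₃ ∧ ρ₄ (chartAt ℂ x₀ x₀) = r₄ ∧
      u (chartAt ℂ x₀ x₀) = (r₁ + r₂) / 2 ∧ d (chartAt ℂ x₀ x₀) = ((r₁ - r₂) / 2) ^ 2 ∧
      ∀ᶠ x in 𝓝 x₀, ∀ w : ℂ, w ^ 2 = d (chartAt ℂ x₀ x) →
        a.Fac x₀ x (u (chartAt ℂ x₀ x) + w) (u (chartAt ℂ x₀ x) - w) (ρ₃ (chartAt ℂ x₀ x))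
          (ρ₄ (chartAt ℂ x₀ x)) := by
  obtain ⟨ρ₄, hρ₄, hρ₄0, hev₄⟩ := a.exists_root_function h h₁₄.symm h₂₄.symm h₃₄.symm
  obtain ⟨ρ₃, hρ₃, hρ₃0, hev₃⟩ := a.exists_root_function h.swap₃₄ h₁₃.symm h₂₃.symm h₃₄
  have h0 := mem_chart_source ℂ x₀
  set z₀ := chartAt ℂ x₀ x₀
  -- The four roots sum to zero, so `u` is the mean of the other two; `d` is the square of half
  -- their difference. Both are holomorphic even when the individual roots are not.
  set u : ℂ → ℂ := fun z => -(ρ₃ z + ρ₄ z) / 2 with hu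
  set d : ℂ → ℂ := fun z => u z ^ 2 - (a.c₂ x₀ ((chartAt ℂ x₀).symm z) + 4 * u z ^ 2 - ρ₃ z * ρ₄ z)
    with hd
  have huA : AnalyticAt ℂ u z₀ := ((hρ₃.add hρ₄).neg).div_const
  obtain ⟨e1, e2, e3, e4⟩ := quartic_factor_iff.1 (a.fac_iff.1 h)
  have hu0 : u z₀ = (r₁ + r₂) / 2 := by
    simp only [hu, hρ₃0, hρ₄0]
    linear_combination (-1 / 2 : ℂ) * e1
  refine ⟨ρ₃, ρ₄, u, d, hρ₃, hρ₄, huA, ?_, hρ₃0, hρ₄0, hu0, ?_, ?_⟩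
  · exact (huA.pow 2).sub (((a.analyticAt_c₂ x₀).add (analyticAt_const.mul (huA.pow 2))).sub
      (hρ₃.mul hρ₄))
  · simp only [hd, hu0, hρ₃0, hρ₄0, z₀]
    rw [(chartAt ℂ x₀).left_inv h0, e2]
    linear_combination (-(r₁ + r₂)) * e1
  · have t₃ : Tendsto (fun x => (x, ρ₃ (chartAt ℂ x₀ x))) (𝓝 x₀) (𝓝 (x₀, r₃)) := by
      rw [← hρ₃0]
      exact tendsto_id.prodMk_nhds (hρ₃.continuousAt.tendsto.comp (tendsto_chart x₀))
    have t₄ : Tendsto (fun x => (x, ρ₄ (chartAt ℂ x₀ x))) (𝓝 x₀) (𝓝 (x₀, r₄)) := by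
      rw [← hρ₄0]
      exact tendsto_id.prodMk_nhds (hρ₄.continuousAt.tendsto.comp (tendsto_chart x₀))
    have hne : ∀ᶠ x in 𝓝 x₀, ρ₃ (chartAt ℂ x₀ x) - ρ₄ (chartAt ℂ x₀ x) ≠ 0 := by
      refine ((hρ₃.sub hρ₄).continuousAt.tendsto.comp (tendsto_chart x₀)).eventually
        (isOpen_ne.mem_nhds ?_)
      simpa [z₀, hρ₃0, hρ₄0, sub_eq_zero] using h₃₄
    filter_upwards [t₃.eventually hev₃, t₄.eventually hev₄, hne, eventually_mem_chart x₀]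
      with x h3 h4 hne hx w hw
    have h3' := h3.2 rfl
    have h4' := h4.2 rfl
    have hz := (chartAt ℂ x₀).left_inv hx
    refine quartic_factor_of_two_roots hne h3' h4' ?_ ?_
    · simp only [hu]; ring
    · rw [hw]; simp only [hd, hz]; rfl

end HitchinBase
end Curve

/-! ### Consequences of genericity -/

section Curve

set_option linter.unusedSectionVars false

variable {X : Type u} [TopologicalSpace X] [ChartedSpace ℂ X] [IsManifold 𝓘(ℂ, ℂ) ω X]

namespace HitchinBase

variable {a : HitchinBase X}

/-- Evaluation on the coordinate vector is injective on covectors at `x` and sends the fibre of $S$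
into the set of roots, so the count of points bounds the number of distinct roots from below. -/
theorem IsGeneric.three_le (ha : a.IsGeneric) {x₀ x : X} (hx : x ∈ (chartAt ℂ x₀).source)
    {r₁ r₂ r₃ r₄ : ℂ} (h : a.Fac x₀ x r₁ r₂ r₃ r₄) :
    3 ≤ ({r₁, r₂, r₃, r₄} : Set ℂ).encard := by
  refine (ha.ramification x).trans ?_
  have hinj : Set.InjOn (fun η : Cot X x => η (coordVec x₀ x))
      {η : Cot X x | (⟨x, η⟩ : TotK X) ∈ a.zeroLocus} := by
    intro η _ η' _ h
    have := ext_crd (p := (⟨x, η⟩ : TotK X)) (p' := ⟨x, η'⟩) hx rfl h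
    exact eq_of_heq (TotalSpace.mk.inj this).2
  rw [← hinj.encard_image]
  refine Set.encard_le_encard ?_
  rintro _ ⟨η, hη, rfl⟩
  have := h.root (hη (coordVec x₀ x))
  simpa using this

/-- Three distinct values among four roots leave room for only one coincidence. -/
theorem IsGeneric.distinct (ha : a.IsGeneric) {x₀ x : X} (hx : x ∈ (chartAt ℂ x₀).source)
    {r r₃ r₄ : ℂ} (h : a.Fac x₀ x r r r₃ r₄) : r ≠ r₃ ∧ r ≠ r₄ ∧ r₃ ≠ r₄ := by
  have h3 := ha.three_le hx h
  have key : ∀ s t : ℂ, ¬ (3 ≤ ({s, t} : Set ℂ).encard) := by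
    intro s t h
    have := h.trans (Set.encard_insert_le _ _)
    rw [Set.encard_singleton] at this
    exact absurd this (by decide)
  refine ⟨?_, ?_, ?_⟩
  · rintro rfl
    exact key r r₄ (by simpa using h3)
  · rintro rfl
    refine key r r₃ ?_
    have : ({r, r, r₃, r} : Set ℂ) = {r, r₃} := by
      ext; simp only [Set.mem_insert_iff, Set.mem_singleton_iff]; tauto
    rwa [this] at h3
  · rintro rfl
    exact key r r₃ (by simpa using h3)

/-- Smoothness of the spectral curve makes double roots isolated. -/
theorem IsGeneric.eventually_ne_zero (ha : a.IsGeneric) {x₀ : X} {ρ₃ ρ₄ u d : ℂ → ℂ}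
    (hρ₃ : AnalyticAt ℂ ρ₃ (chartAt ℂ x₀ x₀)) (hρ₄ : AnalyticAt ℂ ρ₄ (chartAt ℂ x₀ x₀))
    (hu : AnalyticAt ℂ u (chartAt ℂ x₀ x₀)) (hd : AnalyticAt ℂ d (chartAt ℂ x₀ x₀))
    (hd0 : d (chartAt ℂ x₀ x₀) = 0)
    (hev : ∀ᶠ x in 𝓝 x₀, ∀ w : ℂ, w ^ 2 = d (chartAt ℂ x₀ x) →
        a.Fac x₀ x (u (chartAt ℂ x₀ x) + w) (u (chartAt ℂ x₀ x) - w) (ρ₃ (chartAt ℂ x₀ x))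
          (ρ₄ (chartAt ℂ x₀ x))) :
    ∀ᶠ z in 𝓝[≠] (chartAt ℂ x₀ x₀), d z ≠ 0 := by
  rcases hd.eventually_eq_zero_or_eventually_ne_zero with h | h
  swap
  · exact h
  exfalso
  have h0 := mem_chart_source ℂ x₀
  set z₀ := chartAt ℂ x₀ x₀
  set p : TotK X := pt x₀ x₀ (u z₀)
  have hp1 : p.proj = x₀ := proj_pt h0 _
  have hp2 : crd x₀ p = u z₀ := crd_pt h0 _
  have hfac := hev.self_of_nhds 0 (by rw [hd0]; simp)
  have hpz : p ∈ a.zeroLocus := by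
    rw [a.mem_zeroLocus_iff (x₀ := x₀) (by rwa [hp1]), hp2, hp1, hfac]
    simp [z₀]
  refine ha.smooth p hpz ?_
  rw [hp1]
  -- If `d` vanished identically near the point, the equation of $S$ would be `H`. It contains the
  -- square of $\eta-u$, so its differential is zero along $\eta=u$, against smoothness.
  set H : ℂ × ℂ → ℂ := fun y => (y.2 - u y.1) ^ 2 * ((y.2 - ρ₃ y.1) * (y.2 - ρ₄ y.1)) with hH
  have hcp : chartCrd x₀ p = (z₀, u z₀) := Prod.ext (by simp [chartCrd, hp1, z₀]) hp2
  have d1 : ∀ f : ℂ → ℂ, AnalyticAt ℂ f z₀ →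
      DifferentiableAt ℂ (fun y : ℂ × ℂ => y.2 - f y.1) (z₀, u z₀) := fun f hf =>
    differentiableAt_snd.sub (DifferentiableAt.comp (g := f) (z₀, u z₀)
      hf.differentiableAt differentiableAt_fst)
  have hHd : HasFDerivAt H (0 : ℂ × ℂ →L[ℂ] ℂ) (chartCrd x₀ p) := by
    rw [hcp]
    have e1 := (d1 u hu).hasFDerivAt.pow 2
    have e2 := ((d1 ρ₃ hρ₃).mul (d1 ρ₄ hρ₄)).hasFDerivAt
    have := e1.mul e2
    convert! this using 1
    ext <;> simp
  have hloc : a.localEq x₀ =ᶠ[𝓝 p] H ∘ chartCrd x₀ := by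
    have hpc : ContinuousAt (fun p : TotK X => p.proj) p := (mdifferentiableAt_proj p).continuousAt
    have hd' := (tendsto_chart x₀).eventually h
    have : ∀ᶠ x in 𝓝 p.proj, d (chartAt ℂ x₀ x) = 0 ∧ ∀ w : ℂ, w ^ 2 = d (chartAt ℂ x₀ x) →
        a.Fac x₀ x (u (chartAt ℂ x₀ x) + w) (u (chartAt ℂ x₀ x) - w) (ρ₃ (chartAt ℂ x₀ x))
          (ρ₄ (chartAt ℂ x₀ x)) := by
      rw [hp1]; exact hd'.and hev
    filter_upwards [hpc.eventually this] with p' hp'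
    have := hp'.2 0 (by rw [hp'.1]; simp) (crd x₀ p')
    refine this.trans ?_
    simp only [hH, Function.comp_apply, chartCrd]
    ring
  have hm := (mdifferentiableAt_chartCrd (x₀ := x₀) (p := p) (by rwa [hp1])).hasMFDerivAt
  have hcomp := (hHd.hasMFDerivAt.comp p hm).congr_of_eventuallyEq hloc
  rw [hcomp.mfderiv]
  exact ContinuousLinearMap.zero_comp _

/-- Comparison of two charts. -/
theorem Fac.change_chart {x₀ x₁ x : X} (h₀ : x ∈ (chartAt ℂ x₀).source)
    {s₁ s₂ s₃ s₄ : a.S} (h₁ : a.proj s₁ = x) (h₂ : a.proj s₂ = x) (h₃ : a.proj s₃ = x)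
    (h₄ : a.proj s₄ = x) (h : a.Fac x₀ x (a.sc x₀ s₁) (a.sc x₀ s₂) (a.sc x₀ s₃) (a.sc x₀ s₄)) :
    a.Fac x₁ x (a.sc x₁ s₁) (a.sc x₁ s₂) (a.sc x₁ s₃) (a.sc x₁ s₄) := by
  obtain ⟨⟨⟨y₁, η₁⟩, _⟩, rfl⟩ : {s // s = s₁} := ⟨s₁, rfl⟩
  obtain ⟨⟨⟨y₂, η₂⟩, _⟩, rfl⟩ : {s // s = s₂} := ⟨s₂, rfl⟩
  obtain ⟨⟨⟨y₃, η₃⟩, _⟩, rfl⟩ : {s // s = s₃} := ⟨s₃, rfl⟩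
  obtain ⟨⟨⟨y₄, η₄⟩, _⟩, rfl⟩ : {s // s = s₄} := ⟨s₄, rfl⟩
  change y₁ = x at h₁
  change y₂ = x at h₂
  change y₃ = x at h₃
  change y₄ = x at h₄
  subst h₁
  subst h₂
  subst h₃
  subst h₄
  intro t
  exact h.poly_eq h₀ rfl rfl rfl rfl _ t

variable [T2Space X]

/-- Two roots, counted with multiplicity, form a point of `(S ×_X S)_0`. -/
theorem IsGeneric.mem_offDiagonal (ha : a.IsGeneric) {x₀ : X} {s₁ s₂ : a.S}
    (h₁ : a.proj s₁ = x₀) (h₂ : a.proj s₂ = x₀) {r₃ r₄ : ℂ}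
    (h : a.Fac x₀ x₀ (a.sc x₀ s₁) (a.sc x₀ s₂) r₃ r₄) : (s₁, s₂) ∈ a.offDiagonal := by
  by_cases hne : s₁ = s₂
  swap
  · exact subset_closure ⟨h₁.trans h₂.symm, hne⟩
  subst hne
  have h0 := mem_chart_source ℂ x₀
  obtain ⟨h13, h14, h34⟩ := ha.distinct h0 h
  obtain ⟨ρ₃, ρ₄, u, d, hρ₃, hρ₄, hu, hd, -, -, hu0, hd0, hev⟩ :=
    a.exists_local_factorization h h13 h14 h13 h14 h34
  have hd0' : d (chartAt ℂ x₀ x₀) = 0 := by rw [hd0]; ring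
  have hne := ha.eventually_ne_zero hρ₃ hρ₄ hu hd hd0' hev
  set z₀ := chartAt ℂ x₀ x₀
  have hu0' : u z₀ = a.sc x₀ s₁ := by rw [hu0]; ring
  set wz : ℂ → ℂ := fun z => (d z) ^ (1 / 2 : ℂ) with hwz
  have hw2 : ∀ z, wz z ^ 2 = d z := fun z => cpow_half_sq _
  have htw : Tendsto wz (𝓝 z₀) (𝓝 0) := tendsto_cpow_half hd.continuousAt hd0'
  have hn : 𝓝 ((s₁, s₁) : a.S × a.S) = comap (fun p : a.S × a.S =>
      ((a.proj p.1, a.sc x₀ p.1), (a.proj p.2, a.sc x₀ p.2)))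
      (𝓝 ((x₀, u z₀), (x₀, u z₀))) := by
    rw [nhds_prod_eq, a.nhds_S (x₀ := x₀) (by rwa [h₁]), h₁, hu0', Filter.prod_comap_comap_eq,
      ← nhds_prod_eq]
  rw [offDiagonal, mem_closure_iff_frequently, hn, frequently_comap]
  -- A double root is the limit of the pairs $u\pm\sqrt d$, which are distinct for $z\ne z_0$ near
  -- $z_0$ since $d$ has an isolated zero there.
  have htz : Tendsto (fun z => (((chartAt ℂ x₀).symm z, u z + wz z),
      ((chartAt ℂ x₀).symm z, u z - wz z))) (𝓝[≠] z₀) (𝓝 ((x₀, u z₀), (x₀, u z₀))) := by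
    have t1 := tendsto_chart_symm x₀
    have t2 : Tendsto (fun z => u z + wz z) (𝓝 z₀) (𝓝 (u z₀)) := by
      simpa using hu.continuousAt.tendsto.add htw
    have t3 : Tendsto (fun z => u z - wz z) (𝓝 z₀) (𝓝 (u z₀)) := by
      simpa using hu.continuousAt.tendsto.sub htw
    exact ((t1.prodMk_nhds t2).prodMk_nhds (t1.prodMk_nhds t3)).mono_left nhdsWithin_le_nhds
  refine htz.frequently (Eventually.frequently ?_)
  have hev' := ((tendsto_chart_symm x₀).eventually (hev.and (eventually_mem_chart x₀))).filter_mono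
    (nhdsWithin_le_nhds (s := {z₀}ᶜ))
  have htgt : ∀ᶠ z in 𝓝[≠] z₀, z ∈ (chartAt ℂ x₀).target := nhdsWithin_le_nhds
    ((chartAt ℂ x₀).open_target.mem_nhds ((chartAt ℂ x₀).map_source h0))
  filter_upwards [hev', htgt, hne] with z hz ht hdz
  obtain ⟨hz1, hz2⟩ := hz
  rw [(chartAt ℂ x₀).right_inv ht] at hz1
  have hf := hz1 (wz z) (hw2 z)
  obtain ⟨t₁, e1, e2⟩ := a.exists_S hz2 (r := u z + wz z) (by rw [hf]; ring)
  obtain ⟨t₂, e3, e4⟩ := a.exists_S hz2 (r := u z - wz z) (by rw [hf]; ring)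
  refine ⟨(t₁, t₂), by simp only [e1, e2, e3, e4], e1.trans e3.symm, ?_⟩
  intro h
  have h : t₁ = t₂ := h
  have : wz z = 0 := by
    have := e2.symm.trans (h ▸ e4)
    linear_combination (1 / 2 : ℂ) * this
  exact hdz (by rw [← hw2, this]; simp)

theorem IsGeneric.exists_SS (ha : a.IsGeneric) {x₀ x : X} (hx : x ∈ (chartAt ℂ x₀).source)
    {r₁ r₂ r₃ r₄ : ℂ} (h : a.Fac x₀ x r₁ r₂ r₃ r₄) :
    ∃ q : a.SS, a.base q = x ∧ a.e₁ x₀ q = r₁ ∧ a.e₂ x₀ q = r₂ := by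
  obtain ⟨s₁, p1, rfl⟩ := a.exists_S hx (r := r₁) (by rw [h]; ring)
  obtain ⟨s₂, p2, rfl⟩ := a.exists_S hx (r := r₂) (by rw [h]; ring)
  obtain ⟨s₃, p3, rfl⟩ := a.exists_S hx (r := r₃) (by rw [h]; ring)
  obtain ⟨s₄, p4, rfl⟩ := a.exists_S hx (r := r₄) (by rw [h]; ring)
  exact ⟨⟨(s₁, s₂), ha.mem_offDiagonal p1 p2 (h.change_chart (x₁ := x) hx p1 p2 p3 p4)⟩, p1, rfl,
    rfl⟩

end HitchinBase
end Curve

/-! ### Holomorphic functions on $(S\times_\Sigma S)_0$ in the coordinates $(z,\eta_1,\eta_2)$ -/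

section Curve

set_option linter.unusedSectionVars false

variable {X : Type u} [TopologicalSpace X] [ChartedSpace ℂ X] [IsManifold 𝓘(ℂ, ℂ) ω X]

namespace HitchinBase

variable (a : HitchinBase X)

theorem continuous_τ : Continuous a.τ :=
  (a.continuous_p₂.prodMk a.continuous_p₁).subtype_mk _

theorem e₁_τ (x₀ : X) (q : a.SS) : a.e₁ x₀ (a.τ q) = a.e₂ x₀ q := rfl
theorem e₂_τ (x₀ : X) (q : a.SS) : a.e₂ x₀ (a.τ q) = a.e₁ x₀ q := rfl

theorem holAt_comp_τ {f : a.SS → ℂ} {q : a.SS} (hf : HolSpace.HolAt f q) :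
    HolSpace.HolAt (fun q' => f (a.τ q')) (a.τ q) := by
  obtain ⟨F, hF, h⟩ := hf
  refine ⟨fun p => F (p.2, p.1), ?_, ?_⟩
  · have : ContinuousAt (fun p : TotK X × TotK X => (p.2, p.1)) (q.1.2.1, q.1.1.1) := by fun_prop
    filter_upwards [this.eventually hF] with p hp
    exact hp.comp p (mdifferentiableAt_snd.prodMk mdifferentiableAt_fst)
  · exact (a.continuous_τ.continuousAt (x := a.τ q)).eventually h

theorem holAt_comp_p₁ {f : a.S → ℂ} {q : a.SS} (hf : HolSpace.HolAt f (a.p₁ q)) :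
    HolSpace.HolAt (fun q' => f (a.p₁ q')) q := by
  obtain ⟨F, hF, h⟩ := hf
  refine ⟨fun p => F p.1, ?_, a.continuous_p₁.continuousAt.eventually h⟩
  filter_upwards [(continuousAt_fst (p := (q.1.1.1, q.1.2.1))).eventually hF] with p hp
  exact hp.comp p mdifferentiableAt_fst

theorem holAt_comp_p₂ {f : a.S → ℂ} {q : a.SS} (hf : HolSpace.HolAt f (a.p₂ q)) :
    HolSpace.HolAt (fun q' => f (a.p₂ q')) q := by
  obtain ⟨F, hF, h⟩ := hf
  refine ⟨fun p => F p.2, ?_, a.continuous_p₂.continuousAt.eventually h⟩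
  filter_upwards [(continuousAt_snd (p := (q.1.1.1, q.1.2.1))).eventually hF] with p hp
  exact hp.comp p mdifferentiableAt_snd

theorem holAt_comp_proj {f : X → ℂ} {s : a.S} (hf : HolSpace.HolAt f (a.proj s)) :
    HolSpace.HolAt (fun s' => f (a.proj s')) s := by
  refine ⟨fun p => f p.proj, ?_, Eventually.of_forall fun _ => rfl⟩
  filter_upwards [(mdifferentiableAt_proj s.1).continuousAt.eventually hf] with p hp
  exact hp.comp p (mdifferentiableAt_proj p)

theorem holAt_comp_base {f : X → ℂ} {q : a.SS} (hf : HolSpace.HolAt f (a.base q)) :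
    HolSpace.HolAt (fun q' => f (a.base q')) q :=
  a.holAt_comp_p₁ (a.holAt_comp_proj hf)

/-- The coordinates on `(S ×_X S)_0` in a chart of `X`. -/
def cc (x₀ : X) (q : a.SS) : ℂ × ℂ × ℂ := (chartAt ℂ x₀ (a.base q), a.e₁ x₀ q, a.e₂ x₀ q)

section T2
variable [T2Space X]

theorem base_τ (q : a.SS) : a.base (a.τ q) = a.base q := a.proj_p₂ q

-- The coordinates extend holomorphically to pairs of covectors, the base coordinate being taken
-- from the first factor. So a holomorphic function of the three coordinates is locally a
-- restriction from the ambient fourfold.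
variable {a} in
theorem holAt_of_cc {x₀ : X} {q : a.SS} (hq : a.base q ∈ (chartAt ℂ x₀).source) {f : a.SS → ℂ}
    {G : ℂ × ℂ × ℂ → ℂ} (hG : ∀ᶠ w in 𝓝 (a.cc x₀ q), DifferentiableAt ℂ G w)
    (h : ∀ᶠ q' in 𝓝 q, f q' = G (a.cc x₀ q')) : HolSpace.HolAt f q := by
  let K : TotK X × TotK X → ℂ × ℂ × ℂ := fun p =>
    ((chartCrd x₀ p.1).1, (chartCrd x₀ p.1).2, (chartCrd x₀ p.2).2)
  have hK : ∀ p : TotK X × TotK X, p.1.proj ∈ (chartAt ℂ x₀).source →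
      p.2.proj ∈ (chartAt ℂ x₀).source →
      MDifferentiableAt (modelK.prod modelK) 𝓘(ℂ, ℂ × ℂ × ℂ) K p := by
    intro p h1 h2
    have k1 : MDifferentiableAt (modelK.prod modelK) 𝓘(ℂ, ℂ × ℂ)
        (fun p : TotK X × TotK X => chartCrd x₀ p.1) p :=
      (mdifferentiableAt_chartCrd h1).comp p mdifferentiableAt_fst
    have k2 : MDifferentiableAt (modelK.prod modelK) 𝓘(ℂ, ℂ × ℂ)
        (fun p : TotK X × TotK X => chartCrd x₀ p.2) p :=
      (mdifferentiableAt_chartCrd h2).comp p mdifferentiableAt_snd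
    have f1 : MDifferentiableAt (modelK.prod modelK) 𝓘(ℂ, ℂ)
        (fun p : TotK X × TotK X => (chartCrd x₀ p.1).1) p :=
      (differentiableAt_fst (𝕜 := ℂ) (E := ℂ) (F := ℂ)).comp_mdifferentiableAt k1
    have f2 : MDifferentiableAt (modelK.prod modelK) 𝓘(ℂ, ℂ)
        (fun p : TotK X × TotK X => (chartCrd x₀ p.1).2) p :=
      (differentiableAt_snd (𝕜 := ℂ) (E := ℂ) (F := ℂ)).comp_mdifferentiableAt k1
    have f3 : MDifferentiableAt (modelK.prod modelK) 𝓘(ℂ, ℂ)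
        (fun p : TotK X × TotK X => (chartCrd x₀ p.2).2) p :=
      (differentiableAt_snd (𝕜 := ℂ) (E := ℂ) (F := ℂ)).comp_mdifferentiableAt k2
    exact f1.prodMk_space (f2.prodMk_space f3)
  have hq2 : q.1.2.1.proj ∈ (chartAt ℂ x₀).source := by
    have := a.proj_p₂ q
    change q.1.2.1.proj = _ at this
    rwa [this]
  refine ⟨fun p => G (K p), ?_, h⟩
  have e1 : ∀ᶠ p : TotK X × TotK X in 𝓝 (q.1.1.1, q.1.2.1), p.1.proj ∈ (chartAt ℂ x₀).source :=
    (ContinuousAt.comp (f := Prod.fst) (x := (q.1.1.1, q.1.2.1))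
      (mdifferentiableAt_proj q.1.1.1).continuousAt continuousAt_fst).eventually
        ((chartAt ℂ x₀).open_source.mem_nhds hq)
  have e2 : ∀ᶠ p : TotK X × TotK X in 𝓝 (q.1.1.1, q.1.2.1), p.2.proj ∈ (chartAt ℂ x₀).source :=
    (ContinuousAt.comp (f := Prod.snd) (x := (q.1.1.1, q.1.2.1))
      (mdifferentiableAt_proj q.1.2.1).continuousAt continuousAt_snd).eventually
        ((chartAt ℂ x₀).open_source.mem_nhds hq2)
  have e3 := (hK (q.1.1.1, q.1.2.1) hq hq2).continuousAt.eventually hG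
  filter_upwards [e1, e2, e3] with p h1 h2 h3
  exact h3.comp_mdifferentiableAt (hK p h1 h2)

variable {a} in
theorem exists_cc {x₀ : X} {q : a.SS} (hq : a.base q ∈ (chartAt ℂ x₀).source) {f : a.SS → ℂ}
    (hf : HolSpace.HolAt f q) : ∃ G : ℂ × ℂ × ℂ → ℂ,
      (∀ᶠ w in 𝓝 (a.cc x₀ q), DifferentiableAt ℂ G w) ∧ ∀ᶠ q' in 𝓝 q, f q' = G (a.cc x₀ q') := by
  obtain ⟨F, hF, h⟩ := hf
  -- Both covectors are placed over the same base coordinate: the image is the fibre product inside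
  -- the ambient fourfold, which locally contains the curve.
  let K : ℂ × ℂ × ℂ → TotK X × TotK X := fun w => (chartPt x₀ (w.1, w.2.1), chartPt x₀ (w.1, w.2.2))
  have hK : ∀ w : ℂ × ℂ × ℂ, w.1 ∈ (chartAt ℂ x₀).target →
      MDifferentiableAt 𝓘(ℂ, ℂ × ℂ × ℂ) (modelK.prod modelK) K w := by
    intro w hw
    have k1 : MDifferentiableAt 𝓘(ℂ, ℂ × ℂ × ℂ) 𝓘(ℂ, ℂ × ℂ)
        (fun w : ℂ × ℂ × ℂ => (w.1, w.2.1)) w :=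
      (by fun_prop : DifferentiableAt ℂ (fun w : ℂ × ℂ × ℂ => (w.1, w.2.1)) w).mdifferentiableAt
    have k2 : MDifferentiableAt 𝓘(ℂ, ℂ × ℂ × ℂ) 𝓘(ℂ, ℂ × ℂ)
        (fun w : ℂ × ℂ × ℂ => (w.1, w.2.2)) w :=
      (by fun_prop : DifferentiableAt ℂ (fun w : ℂ × ℂ × ℂ => (w.1, w.2.2)) w).mdifferentiableAt
    exact ((mdifferentiableAt_chartPt (x₀ := x₀) (w := (w.1, w.2.1)) hw).comp w k1).prodMk
      ((mdifferentiableAt_chartPt (x₀ := x₀) (w := (w.1, w.2.2)) hw).comp w k2)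
  have hKcc : ∀ q' : a.SS, a.base q' ∈ (chartAt ℂ x₀).source →
      K (a.cc x₀ q') = (q'.1.1.1, q'.1.2.1) := by
    intro q' hq'
    have h2 : q'.1.2.1.proj = q'.1.1.1.proj := a.proj_p₂ q'
    refine Prod.ext (chartPt_chartCrd (p := q'.1.1.1) hq') ?_
    have := chartPt_chartCrd (x₀ := x₀) (p := q'.1.2.1) (by rw [h2]; exact hq')
    rw [chartCrd, h2] at this
    exact this
  refine ⟨fun w => F (K w), ?_, ?_⟩
  · have htgt : ∀ᶠ w : ℂ × ℂ × ℂ in 𝓝 (a.cc x₀ q), w.1 ∈ (chartAt ℂ x₀).target :=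
      (continuousAt_fst (p := a.cc x₀ q)).eventually
        ((chartAt ℂ x₀).open_target.mem_nhds ((chartAt ℂ x₀).map_source hq))
    have hc := (hK (a.cc x₀ q) ((chartAt ℂ x₀).map_source hq)).continuousAt
    rw [ContinuousAt, hKcc q hq] at hc
    filter_upwards [htgt, hc.eventually hF] with w h1 h2
    exact mdifferentiableAt_iff_differentiableAt.1 (h2.comp w (hK w h1))
  · filter_upwards [h, a.continuous_base.continuousAt.eventually
      ((chartAt ℂ x₀).open_source.mem_nhds hq)] with q' h1 h2
    rw [h1, hKcc q' h2]

end T2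

/-! ### The six-fold cover -/

theorem πτ_eq_iff {q q' : a.SS} : a.πτ q = a.πτ q' ↔ q' = q ∨ q' = a.τ q :=
  quot_mk_eq_iff (i := a.τ) (fun _ _ => Iff.rfl) (fun _ => rfl)

theorem πτ_τ (q : a.SS) : a.πτ (a.τ q) = a.πτ q := a.πτ_eq_iff.2 (Or.inr rfl)

theorem nhds_πτ (q : a.SS) : 𝓝 (a.πτ q) = map a.πτ (𝓝 q) :=
  nhds_quot_mk (i := a.τ) (fun _ _ => Iff.rfl) (fun _ => rfl) a.continuous_τ q

theorem surjective_πτ : Function.Surjective a.πτ := Quot.mk_surjective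

theorem continuous_πτ : Continuous a.πτ := continuous_quot_mk

theorem holAt_πτ_of_eq (f : a.S₆ → ℂ) (q q' : a.SS) (h : a.πτ q = a.πτ q')
    (hf : HolSpace.HolAt (fun q => f (a.πτ q)) q) : HolSpace.HolAt (fun q => f (a.πτ q)) q' := by
  rcases a.πτ_eq_iff.1 h with rfl | rfl
  · exact hf
  · have := a.holAt_comp_τ hf
    simpa only [πτ_τ] using this

theorem holAt_S₆_iff {f : a.S₆ → ℂ} {q : a.SS} :
    HolSpace.HolAt f (a.πτ q) ↔ HolSpace.HolAt (fun q => f (a.πτ q)) q :=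
  ⟨fun h => h q rfl, fun h q' hq' => a.holAt_πτ_of_eq f q q' hq'.symm h⟩

instance : LawfulHol a.S₆ :=
  lawfulHol_of_quotient a.πτ a.surjective_πτ a.nhds_πτ (fun _ _ => Iff.rfl) a.holAt_πτ_of_eq

end HitchinBase
end Curve

/-! ### Complementary pairs of roots and the involution $\sigma$ -/

section Curve

set_option linter.unusedSectionVars false

variable {X : Type u} [TopologicalSpace X] [ChartedSpace ℂ X] [IsManifold 𝓘(ℂ, ℂ) ω X]

theorem eq_or_eq_of_add_mul {p q c d : ℂ} (hs : p + q = c + d) (hm : p * q = c * d) :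
    (c = p ∧ d = q) ∨ (c = q ∧ d = p) := by
  have : (c - p) * (c - q) = 0 := by linear_combination hm - c * hs
  rcases mul_eq_zero.1 this with h | h
  · left
    exact ⟨sub_eq_zero.1 h, by linear_combination -hs - h⟩
  · right
    exact ⟨sub_eq_zero.1 h, by linear_combination -hs - h⟩

namespace HitchinBase

variable {a : HitchinBase X}

theorem Fac.add_eq {x₀ x : X} {r₁ r₂ r₃ r₄ : ℂ} (h : a.Fac x₀ x r₁ r₂ r₃ r₄) :
    r₁ + r₂ + r₃ + r₄ = 0 := (quartic_factor_iff.1 (a.fac_iff.1 h)).1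

/-- Two roots and the coefficients of the quartic determine the sum and the product of the other
two. -/
theorem Fac.unique {x₀ x : X} {r₁ r₂ r₃ r₄ s₃ s₄ : ℂ} (h : a.Fac x₀ x r₁ r₂ r₃ r₄)
    (h' : a.Fac x₀ x r₁ r₂ s₃ s₄) : (s₃ = r₃ ∧ s₄ = r₄) ∨ (s₃ = r₄ ∧ s₄ = r₃) := by
  obtain ⟨e1, e2, -, -⟩ := quartic_factor_iff.1 (a.fac_iff.1 h)
  obtain ⟨f1, f2, -, -⟩ := quartic_factor_iff.1 (a.fac_iff.1 h')
  refine eq_or_eq_of_add_mul (by linear_combination e1 - f1) ?_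
  linear_combination f2 - e2 - (r₁ + r₂) * (e1 - f1)

/-- A third root completes two roots. -/
theorem Fac.of_root {x₀ x : X} {r₁ r₂ r₃ r₄ t : ℂ} (h : a.Fac x₀ x r₁ r₂ r₃ r₄)
    (ht : a.poly x (coordVec x₀ x) t = 0) (h₁ : t ≠ r₁) (h₂ : t ≠ r₂) :
    a.Fac x₀ x r₁ r₂ (-r₁ - r₂ - t) t := by
  have e := h.add_eq
  rcases h.root ht with rfl | rfl | rfl | rfl
  · exact absurd rfl h₁
  · exact absurd rfl h₂
  · have : -r₁ - r₂ - t = r₄ := by linear_combination -e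
    rw [this]
    exact h.swap₃₄
  · have : -r₁ - r₂ - t = r₃ := by linear_combination -e
    rw [this]
    exact h

section T2
variable [T2Space X]

variable (a) in
/-- The points `{η₁, η₂}` and `{η₃, η₄}` of `(S ×_X S)_0` are complementary. -/
def Compl (q q' : a.SS) : Prop :=
  a.base q' = a.base q ∧ a.Fac (a.base q) (a.base q) (a.e₁ (a.base q) q) (a.e₂ (a.base q) q)
    (a.e₁ (a.base q) q') (a.e₂ (a.base q) q')

/-- `Compl` is defined in the chart centred at the base point; the factorization may be tested in
any chart around that point. -/
theorem compl_iff {x₀ : X} {q q' : a.SS} (hq : a.base q ∈ (chartAt ℂ x₀).source) :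
    a.Compl q q' ↔ a.base q' = a.base q ∧
      a.Fac x₀ (a.base q) (a.e₁ x₀ q) (a.e₂ x₀ q) (a.e₁ x₀ q') (a.e₂ x₀ q') := by
  refine and_congr_right fun h => ?_
  constructor
  · exact Fac.change_chart (mem_chart_source ℂ _) rfl (a.proj_p₂ q) h ((a.proj_p₂ q').trans h)
  · exact Fac.change_chart hq rfl (a.proj_p₂ q) h ((a.proj_p₂ q').trans h)

theorem Compl.symm {q q' : a.SS} (h : a.Compl q q') : a.Compl q' q := by
  refine (compl_iff (x₀ := a.base q) ?_).2 ⟨h.1.symm, ?_⟩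
  · rw [h.1]; exact mem_chart_source ℂ _
  · rw [h.1]; exact h.2.symm

theorem Compl.τ_left {q q' : a.SS} (h : a.Compl q q') : a.Compl (a.τ q) q' := by
  refine (compl_iff (x₀ := a.base q) ?_).2 ⟨?_, ?_⟩
  · rw [base_τ]; exact mem_chart_source ℂ _
  · rw [base_τ]; exact h.1
  · rw [base_τ]; exact h.2.swap₁₂

theorem Compl.τ_right {q q' : a.SS} (h : a.Compl q q') : a.Compl q (a.τ q') := h.symm.τ_left.symm

theorem Compl.unique {q q' q'' : a.SS} (h : a.Compl q q') (h' : a.Compl q q'') :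
    a.πτ q' = a.πτ q'' := by
  have hs : a.base q' ∈ (chartAt ℂ (a.base q)).source := by
    rw [h.1]; exact mem_chart_source ℂ _
  have hb : a.base q' = a.base q'' := h.1.trans h'.1.symm
  rw [πτ_eq_iff]
  rcases h.2.unique h'.2 with ⟨e1, e2⟩ | ⟨e1, e2⟩
  · exact Or.inl (SS_ext hs hb e1.symm e2.symm).symm
  · exact Or.inr (SS_ext (q := a.τ q') (q' := q'') (by rwa [base_τ]) (by rw [base_τ, hb]) e1.symm
      e2.symm).symm

theorem IsGeneric.exists_compl_of_fac (ha : a.IsGeneric) {x₀ : X} {q : a.SS}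
    (hq : a.base q ∈ (chartAt ℂ x₀).source) {r₃ r₄ : ℂ}
    (h : a.Fac x₀ (a.base q) (a.e₁ x₀ q) (a.e₂ x₀ q) r₃ r₄) :
    ∃ q', a.Compl q q' ∧ a.base q' = a.base q ∧ a.e₁ x₀ q' = r₃ ∧ a.e₂ x₀ q' = r₄ := by
  obtain ⟨q', h1, rfl, rfl⟩ := ha.exists_SS hq h.symm
  exact ⟨q', (compl_iff hq).2 ⟨h1, h⟩, h1, rfl, rfl⟩

theorem IsGeneric.exists_compl (ha : a.IsGeneric) (q : a.SS) : ∃ q', a.Compl q q' := by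
  obtain ⟨r₃, r₄, h⟩ := a.exists_fac (mem_chart_source ℂ (a.base q))
  obtain ⟨q', h, -⟩ := ha.exists_compl_of_fac (mem_chart_source ℂ (a.base q)) h
  exact ⟨q', h⟩

theorem sigmaRel_iff {y y' : a.S₆} :
    a.sigmaRel y y' ↔ ∃ q q', a.πτ q = y ∧ a.πτ q' = y' ∧ a.Compl q q' := by
  constructor
  · rintro ⟨q, q', hy, hy', x, η₁, η₂, η₃, η₄, h1, h2, h3, h4, hp⟩
    refine ⟨q, q', hy, hy', ?_⟩
    have hb : a.base q = x := congrArg TotalSpace.proj h1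
    refine (compl_iff (x₀ := x) (by rw [hb]; exact mem_chart_source ℂ x)).2
      ⟨(congrArg TotalSpace.proj h3 : a.base q' = x).trans hb.symm, ?_⟩
    rw [hb]
    intro t
    have k1 : a.e₁ x q = η₁ (coordVec x x) := congrArg (crd x) h1
    have k2 : a.e₂ x q = η₂ (coordVec x x) := congrArg (crd x) h2
    have k3 : a.e₁ x q' = η₃ (coordVec x x) := congrArg (crd x) h3
    have k4 : a.e₂ x q' = η₄ (coordVec x x) := congrArg (crd x) h4
    rw [k1, k2, k3, k4]
    exact hp _ t
  · rintro ⟨q, q', hy, hy', hb, hf⟩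
    refine ⟨q, q', hy, hy', a.base q, ?_⟩
    have key : ∀ (x : X) (p : TotK X), p.proj = x →
        ∃ η : Cot X x, p = ⟨x, η⟩ ∧ η (coordVec x x) = crd x p := by
      rintro x ⟨y, η⟩ rfl
      exact ⟨η, rfl, rfl⟩
    obtain ⟨η₁, h1, k1⟩ := key (a.base q) q.1.1.1 rfl
    obtain ⟨η₂, h2, k2⟩ := key (a.base q) q.1.2.1 (a.proj_p₂ q)
    obtain ⟨η₃, h3, k3⟩ := key (a.base q) q'.1.1.1 hb
    obtain ⟨η₄, h4, k4⟩ := key (a.base q) q'.1.2.1 ((a.proj_p₂ q').trans hb)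
    exact ⟨η₁, η₂, η₃, η₄, h1, h2, h3, h4,
      fun v t => hf.poly_eq (mem_chart_source ℂ _) k1 k2 k3 k4 v t⟩

variable (a) in
/-- The involution `σ` as a map. -/
def sig (y : a.S₆) : a.S₆ := @Classical.epsilon _ ⟨y⟩ (fun y' => a.sigmaRel y y')

theorem Compl.sigmaRel_unique {q q' : a.SS} (h : a.Compl q q') {y : a.S₆}
    (hy : a.sigmaRel (a.πτ q) y) : y = a.πτ q' := by
  obtain ⟨q₁, q₁', h1, rfl, h2⟩ := sigmaRel_iff.1 hy
  rcases a.πτ_eq_iff.1 h1 with rfl | rfl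
  · exact h2.unique h
  · exact h2.τ_left.unique h

theorem Compl.sig_eq {q q' : a.SS} (h : a.Compl q q') : a.sig (a.πτ q) = a.πτ q' :=
  h.sigmaRel_unique (@Classical.epsilon_spec _ (fun y' => a.sigmaRel (a.πτ q) y')
    ⟨_, sigmaRel_iff.2 ⟨q, q', rfl, rfl, h⟩⟩)

/-- Complements exist and are unique up to order, so the relation is the graph of a map and the
results on quotients by an involution apply. -/
theorem IsGeneric.sigmaRel_iff_sig (ha : a.IsGeneric) (y y' : a.S₆) :
    a.sigmaRel y y' ↔ y' = a.sig y := by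
  obtain ⟨q, rfl⟩ := a.surjective_πτ y
  obtain ⟨q', h⟩ := ha.exists_compl q
  rw [h.sig_eq]
  exact ⟨fun hy => h.sigmaRel_unique hy, fun hy => sigmaRel_iff.2 ⟨q, q', rfl, hy.symm, h⟩⟩

theorem IsGeneric.sig_sig (ha : a.IsGeneric) (y : a.S₆) : a.sig (a.sig y) = y := by
  obtain ⟨q, rfl⟩ := a.surjective_πτ y
  obtain ⟨q', h⟩ := ha.exists_compl q
  rw [h.sig_eq, h.symm.sig_eq]

/-- A pair equal to its own complement would make the quartic a perfect square, with at most two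
distinct roots, whereas each fibre has at least three points. -/
theorem IsGeneric.sig_ne (ha : a.IsGeneric) (y : a.S₆) : a.sig y ≠ y := by
  obtain ⟨q, rfl⟩ := a.surjective_πτ y
  obtain ⟨q', h⟩ := ha.exists_compl q
  rw [h.sig_eq]
  intro he
  have hself : a.Compl q q := by
    rcases a.πτ_eq_iff.1 he with rfl | rfl
    · exact h
    · exact h.τ_right
  have h3 := hself.2
  have := ha.three_le (mem_chart_source ℂ _) h3
  have hle : ({a.e₁ (a.base q) q, a.e₂ (a.base q) q, a.e₁ (a.base q) q, a.e₂ (a.base q) q} :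
      Set ℂ) = {a.e₁ (a.base q) q, a.e₂ (a.base q) q} := by
    ext; simp only [Set.mem_insert_iff, Set.mem_singleton_iff]; tauto
  rw [hle] at this
  have := this.trans (Set.encard_insert_le _ _)
  rw [Set.encard_singleton] at this
  exact absurd this (by decide)

/-- Local lifts of `σ` to `(S ×_X S)_0`: simple complementary root. -/
theorem exists_local_complement_of_simple {q₀ : a.SS} {r₃ r₄ : ℂ}
    (h : a.Fac (a.base q₀) (a.base q₀) (a.e₁ (a.base q₀) q₀) (a.e₂ (a.base q₀) q₀) r₃ r₄)
    (h₁ : r₄ ≠ a.e₁ (a.base q₀) q₀) (h₂ : r₄ ≠ a.e₂ (a.base q₀) q₀) (h₃ : r₄ ≠ r₃) :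
    ∃ C₃ C₄ : a.SS → ℂ, ContinuousAt C₃ q₀ ∧ ContinuousAt C₄ q₀ ∧ C₃ q₀ = r₃ ∧ C₄ q₀ = r₄ ∧
      (∀ᶠ q in 𝓝 q₀, a.Fac (a.base q₀) (a.base q) (a.e₁ (a.base q₀) q) (a.e₂ (a.base q₀) q)
        (C₃ q) (C₄ q)) ∧
      ∀ G : ℂ × ℂ × ℂ → ℂ,
        (∀ᶠ w in 𝓝 (chartAt ℂ (a.base q₀) (a.base q₀), r₃, r₄), DifferentiableAt ℂ G w) →
        HolSpace.HolAt (fun q => G (chartAt ℂ (a.base q₀) (a.base q), C₃ q, C₄ q)) q₀ := by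
  set x₀ := a.base q₀
  have hx₀ : a.base q₀ ∈ (chartAt ℂ x₀).source := mem_chart_source ℂ _
  obtain ⟨ρ, hρ, hρ0, hev⟩ := a.exists_root_function h h₁ h₂ h₃
  have hb : Tendsto a.base (𝓝 q₀) (𝓝 x₀) := a.continuous_base.continuousAt
  have hρc : ContinuousAt (fun q => ρ (chartAt ℂ x₀ (a.base q))) q₀ :=
    hρ.continuousAt.tendsto.comp ((tendsto_chart x₀).comp hb)
  have c1 : ContinuousAt (a.e₁ x₀) q₀ := a.continuousAt_e₁ hx₀
  have c2 : ContinuousAt (a.e₂ x₀) q₀ := a.continuousAt_e₂ hx₀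
  have e3 : -a.e₁ x₀ q₀ - a.e₂ x₀ q₀ - r₄ = r₃ := by linear_combination -h.add_eq
  have hρ0' : ρ (chartAt ℂ x₀ (a.base q₀)) = r₄ := hρ0
  -- The simple root `r₄` continues as the holomorphic function `ρ` of the base point; the remaining
  -- root is minus the sum of the other three.
  refine ⟨fun q => -a.e₁ x₀ q - a.e₂ x₀ q - ρ (chartAt ℂ x₀ (a.base q)),
    fun q => ρ (chartAt ℂ x₀ (a.base q)), (c1.neg.sub c2).sub hρc, hρc, ?_, hρ0', ?_, ?_⟩
  · simp only [hρ0']; exact e3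
  · have t : Tendsto (fun q => (a.base q, ρ (chartAt ℂ x₀ (a.base q)))) (𝓝 q₀) (𝓝 (x₀, r₄)) := by
      rw [← hρ0']; exact hb.prodMk_nhds hρc
    have n1 : ∀ᶠ q in 𝓝 q₀, ρ (chartAt ℂ x₀ (a.base q)) - a.e₁ x₀ q ≠ 0 :=
      (hρc.sub c1).eventually_ne (sub_ne_zero.2 (by beta_reduce; rwa [hρ0']))
    have n2 : ∀ᶠ q in 𝓝 q₀, ρ (chartAt ℂ x₀ (a.base q)) - a.e₂ x₀ q ≠ 0 :=
      (hρc.sub c2).eventually_ne (sub_ne_zero.2 (by beta_reduce; rwa [hρ0']))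
    filter_upwards [t.eventually hev, n1, n2, hb.eventually (eventually_mem_chart x₀)]
      with q h1 h2 h3 h4
    obtain ⟨c, d, hf⟩ := a.exists_fac h4
    exact hf.of_root (h1.2 rfl) (sub_ne_zero.1 h2) (sub_ne_zero.1 h3)
  · intro G hG
    refine holAt_of_cc (x₀ := x₀) hx₀ (G := fun w => G (w.1, -w.2.1 - w.2.2 - ρ w.1, ρ w.1)) ?_
      (Eventually.of_forall fun q => rfl)
    have hρd : ∀ᶠ w : ℂ × ℂ × ℂ in 𝓝 (a.cc x₀ q₀), DifferentiableAt ℂ ρ w.1 :=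
      (continuousAt_fst (p := a.cc x₀ q₀)).eventually
        (Complex.analyticAt_iff_eventually_differentiableAt.1 hρ)
    have hcont : Tendsto (fun w : ℂ × ℂ × ℂ => (w.1, -w.2.1 - w.2.2 - ρ w.1, ρ w.1))
        (𝓝 (a.cc x₀ q₀)) (𝓝 (chartAt ℂ x₀ x₀, r₃, r₄)) := by
      have k1 : ContinuousAt (fun w : ℂ × ℂ × ℂ => ρ w.1) (a.cc x₀ q₀) :=
        ContinuousAt.comp (g := ρ) hρ.continuousAt continuousAt_fst
      have k2 : ContinuousAt (fun w : ℂ × ℂ × ℂ => (w.1, -w.2.1 - w.2.2 - ρ w.1, ρ w.1))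
        (a.cc x₀ q₀) := by fun_prop
      have k3 : (fun w : ℂ × ℂ × ℂ => (w.1, -w.2.1 - w.2.2 - ρ w.1, ρ w.1)) (a.cc x₀ q₀) =
          (chartAt ℂ x₀ x₀, r₃, r₄) := by
        simp only [cc, hρ0', e3]
        rfl
      rw [← k3]
      exact k2
    filter_upwards [hρd, hcont.eventually hG] with w h1 h2
    have h1' : DifferentiableAt ℂ (fun w : ℂ × ℂ × ℂ => ρ w.1) w :=
      DifferentiableAt.comp (g := ρ) w h1 differentiableAt_fst
    exact DifferentiableAt.comp (g := G) w h2 (by fun_prop)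

/-- Local lifts of `σ` to `(S ×_X S)_0`: double complementary root. -/
theorem IsGeneric.exists_local_complement_of_double (ha : a.IsGeneric) {q₀ : a.SS} {r : ℂ}
    (h : a.Fac (a.base q₀) (a.base q₀) (a.e₁ (a.base q₀) q₀) (a.e₂ (a.base q₀) q₀) r r) :
    ∃ C₃ C₄ : a.SS → ℂ, ContinuousAt C₃ q₀ ∧ ContinuousAt C₄ q₀ ∧ C₃ q₀ = r ∧ C₄ q₀ = r ∧
      (∀ᶠ q in 𝓝 q₀, a.Fac (a.base q₀) (a.base q) (a.e₁ (a.base q₀) q) (a.e₂ (a.base q₀) q)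
        (C₃ q) (C₄ q)) ∧
      ∀ G : ℂ × ℂ × ℂ → ℂ, (∀ w, G (w.1, w.2.2, w.2.1) = G w) →
        (∀ᶠ w in 𝓝 (chartAt ℂ (a.base q₀) (a.base q₀), r, r), DifferentiableAt ℂ G w) →
        HolSpace.HolAt (fun q => G (chartAt ℂ (a.base q₀) (a.base q), C₃ q, C₄ q)) q₀ := by
  set x₀ := a.base q₀
  have hx₀ : a.base q₀ ∈ (chartAt ℂ x₀).source := mem_chart_source ℂ _
  obtain ⟨h13, h14, h34⟩ := ha.distinct hx₀ h.symm
  obtain ⟨ρ₁, ρ₂, u, d, hρ₁, hρ₂, hu, hd, hρ₁0, hρ₂0, hu0, hd0, hev⟩ :=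
    a.exists_local_factorization h.symm h13 h14 h13 h14 h34
  have hd0' : d (chartAt ℂ x₀ x₀) = 0 := by rw [hd0]; ring
  have hu0' : u (chartAt ℂ x₀ x₀) = r := by rw [hu0]; ring
  have hne := ha.eventually_ne_zero hρ₁ hρ₂ hu hd hd0' hev
  have hb : Tendsto a.base (𝓝 q₀) (𝓝 x₀) := a.continuous_base.continuousAt
  have hz : Tendsto (fun q => chartAt ℂ x₀ (a.base q)) (𝓝 q₀) (𝓝 (chartAt ℂ x₀ x₀)) :=
    (tendsto_chart x₀).comp hb
  set z₀ := chartAt ℂ x₀ x₀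
  set wz : ℂ → ℂ := fun z => (d z) ^ (1 / 2 : ℂ) with hwz
  have hw2 : ∀ z, wz z ^ 2 = d z := fun z => cpow_half_sq _
  have htw : Tendsto wz (𝓝 z₀) (𝓝 0) := tendsto_cpow_half hd.continuousAt hd0'
  have hw0 : wz z₀ = 0 := by
    have := hw2 z₀
    rw [hd0'] at this
    exact pow_eq_zero_iff two_ne_zero |>.1 this
  have tu : Tendsto (fun q => u (chartAt ℂ x₀ (a.base q))) (𝓝 q₀) (𝓝 r) := by
    rw [← hu0']; exact hu.continuousAt.tendsto.comp hz
  have tw : Tendsto (fun q => wz (chartAt ℂ x₀ (a.base q))) (𝓝 q₀) (𝓝 0) := htw.comp hz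
  have tp : Tendsto (fun q => u (chartAt ℂ x₀ (a.base q)) + wz (chartAt ℂ x₀ (a.base q)))
    (𝓝 q₀) (𝓝 r) := by simpa using tu.add tw
  have tm : Tendsto (fun q => u (chartAt ℂ x₀ (a.base q)) - wz (chartAt ℂ x₀ (a.base q)))
    (𝓝 q₀) (𝓝 r) := by simpa using tu.sub tw
  have t1 : Tendsto (fun q => ρ₁ (chartAt ℂ x₀ (a.base q))) (𝓝 q₀) (𝓝 (a.e₁ x₀ q₀)) := by
    rw [← hρ₁0]; exact hρ₁.continuousAt.tendsto.comp hz
  have t2 : Tendsto (fun q => ρ₂ (chartAt ℂ x₀ (a.base q))) (𝓝 q₀) (𝓝 (a.e₂ x₀ q₀)) := by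
    rw [← hρ₂0]; exact hρ₂.continuousAt.tendsto.comp hz
  have c1 : Tendsto (a.e₁ x₀) (𝓝 q₀) (𝓝 (a.e₁ x₀ q₀)) := a.continuousAt_e₁ hx₀
  have c2 : Tendsto (a.e₂ x₀) (𝓝 q₀) (𝓝 (a.e₂ x₀ q₀)) := a.continuousAt_e₂ hx₀
  have p0 : u (chartAt ℂ x₀ (a.base q₀)) + wz (chartAt ℂ x₀ (a.base q₀)) = r := by
    change u z₀ + wz z₀ = r
    rw [hu0', hw0, add_zero]
  have m0 : u (chartAt ℂ x₀ (a.base q₀)) - wz (chartAt ℂ x₀ (a.base q₀)) = r := by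
    change u z₀ - wz z₀ = r
    rw [hu0', hw0, sub_zero]
  -- The two colliding roots are $u\pm\sqrt d$ with the principal square root. Each may be
  -- discontinuous away from `q₀`; only symmetric functions of the two are claimed to be
  -- holomorphic.
  refine ⟨fun q => u (chartAt ℂ x₀ (a.base q)) + wz (chartAt ℂ x₀ (a.base q)),
    fun q => u (chartAt ℂ x₀ (a.base q)) - wz (chartAt ℂ x₀ (a.base q)),
    by rw [ContinuousAt, p0]; exact tp, by rw [ContinuousAt, m0]; exact tm, p0, m0, ?_, ?_⟩
  · have key : ∀ {f g : a.SS → ℂ} {s t : ℂ}, Tendsto f (𝓝 q₀) (𝓝 s) → Tendsto g (𝓝 q₀) (𝓝 t) →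
        s ≠ t → ∀ᶠ q in 𝓝 q₀, f q ≠ g q := fun hf hg hst =>
      ((hf.sub hg).eventually_ne (sub_ne_zero.2 hst)).mono fun _ => sub_ne_zero.1
    filter_upwards [hb.eventually hev, hb.eventually (eventually_mem_chart x₀),
      -- Near `q₀` the roots carried by `q` stay away from all but one of the four roots of the
      -- local factorization, which identifies them with `ρ₁` and `ρ₂`.
      key c1 tp h13.symm, key c1 tm h13.symm, key c1 t2 h34,
      key c2 tp h14.symm, key c2 tm h14.symm, key c2 t1 h34.symm]
      with q hq hs n1 n2 n3 n4 n5 n6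
    have hf := hq _ (hw2 _)
    have r1 : a.e₁ x₀ q = ρ₁ (chartAt ℂ x₀ (a.base q)) := by
      rcases hf.root (a.poly_sc x₀ (a.p₁ q)) with h | h | h | h
      · exact absurd h n1
      · exact absurd h n2
      · exact h
      · exact absurd h n3
    have r2 : a.e₂ x₀ q = ρ₂ (chartAt ℂ x₀ (a.base q)) := by
      have := a.poly_sc x₀ (a.p₂ q)
      rw [proj_p₂] at this
      rcases hf.root this with h | h | h | h
      · exact absurd h n4
      · exact absurd h n5
      · exact absurd h n6
      · exact h
    rw [r1, r2]
    exact hf.symm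
  · intro G hsymm hG
    have hu' : ∀ᶠ w : ℂ × ℂ in 𝓝 (z₀, (0 : ℂ)), DifferentiableAt ℂ u w.1 :=
      (continuousAt_fst (p := (z₀, (0 : ℂ)))).eventually
        (Complex.analyticAt_iff_eventually_differentiableAt.1 hu)
    have huc : ContinuousAt (fun w : ℂ × ℂ => u w.1) (z₀, 0) :=
      ContinuousAt.comp (g := u) hu.continuousAt continuousAt_fst
    have hK : Tendsto (fun w : ℂ × ℂ => (w.1, u w.1 + w.2, u w.1 - w.2)) (𝓝 (z₀, (0 : ℂ)))
        (𝓝 (z₀, r, r)) := by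
      have : ContinuousAt (fun w : ℂ × ℂ => (w.1, u w.1 + w.2, u w.1 - w.2)) (z₀, (0 : ℂ)) := by
        fun_prop
      simpa [ContinuousAt, hu0'] using this
    have hGd : ∀ᶠ w : ℂ × ℂ in 𝓝 (z₀, (0 : ℂ)),
        DifferentiableAt ℂ (fun w : ℂ × ℂ => G (w.1, u w.1 + w.2, u w.1 - w.2)) w := by
      filter_upwards [hu', hK.eventually hG] with w h1 h2
      have h1' : DifferentiableAt ℂ (fun w : ℂ × ℂ => u w.1) w :=
        DifferentiableAt.comp (g := u) w h1 differentiableAt_fst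
      exact DifferentiableAt.comp (g := G) w h2 (by fun_prop)
    -- Exchanging the two roots is `w ↦ -w`, so symmetry of `G` means evenness in `w`, and on
    -- $w^2=d(z)$ the function depends holomorphically on $z$ alone.
    obtain ⟨ψ, hψ, hψe⟩ := exists_even_quotient hGd (Eventually.of_forall fun w => by
      have := hsymm (w.1, u w.1 + w.2, u w.1 - w.2)
      simp only at this ⊢
      rw [← this, sub_neg_eq_add, sub_eq_add_neg]) hd hd0' hne
    refine holAt_of_cc (x₀ := x₀) hx₀ (G := fun w => ψ w.1) ?_ ?_
    · filter_upwards [(continuousAt_fst (p := a.cc x₀ q₀)).eventually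
        (Complex.analyticAt_iff_eventually_differentiableAt.1 hψ)] with w hw
      exact DifferentiableAt.comp (g := ψ) w hw differentiableAt_fst
    · filter_upwards [(hz.prodMk_nhds tw).eventually hψe] with q hq
      exact hq (hw2 _)

end T2

end HitchinBase
end Curve

theorem mult_eq {Z : Type u} {Y : Type v} [TopologicalSpace Z] {pr : Z → Y} {x : Z} {n : ℕ}
    (h₁ : ∃ U ∈ 𝓝 x, ∀ y : Y, (U ∩ pr ⁻¹' {y}).encard ≤ n)
    (h₂ : ∀ U ∈ 𝓝 x, ∃ y : Y, n ≤ (U ∩ pr ⁻¹' {y}).encard) : mult pr x = n := by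
  refine le_antisymm (Nat.sInf_le h₁) (le_csInf ⟨n, h₁⟩ ?_)
  rintro m ⟨U, hU, hm⟩
  obtain ⟨y, hy⟩ := h₂ U hU
  exact_mod_cast hy.trans (hm y)

/-! ### Holomorphy of $\sigma$, and the multiplicities of the coverings -/

section Curve

set_option linter.unusedSectionVars false

variable {X : Type u} [TopologicalSpace X] [ChartedSpace ℂ X] [IsManifold 𝓘(ℂ, ℂ) ω X]

namespace HitchinBase

variable {a : HitchinBase X} [T2Space X]

/-- The functions `C₃`, `C₄` are the coordinates of a local choice `lam` of complement, and $\sigma$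
is `lam` followed by `πτ`. It need only be continuous at `q₀`: holomorphy is tested on functions,
through the hypothesis on `G`. -/
theorem IsGeneric.sig_spec_of_local (ha : a.IsGeneric) {q₀ q₀' : a.SS} {C₃ C₄ : a.SS → ℂ}
    (hC₃ : ContinuousAt C₃ q₀) (hC₄ : ContinuousAt C₄ q₀) (hb : a.base q₀' = a.base q₀)
    (h₃ : C₃ q₀ = a.e₁ (a.base q₀) q₀') (h₄ : C₄ q₀ = a.e₂ (a.base q₀) q₀')
    (hf : ∀ᶠ q in 𝓝 q₀, a.Fac (a.base q₀) (a.base q) (a.e₁ (a.base q₀) q) (a.e₂ (a.base q₀) q)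
        (C₃ q) (C₄ q))
    (hG : ∀ G : ℂ × ℂ × ℂ → ℂ, (C₃ q₀ = C₄ q₀ → ∀ w, G (w.1, w.2.2, w.2.1) = G w) →
        (∀ᶠ w in 𝓝 (chartAt ℂ (a.base q₀) (a.base q₀), C₃ q₀, C₄ q₀), DifferentiableAt ℂ G w) →
        HolSpace.HolAt (fun q => G (chartAt ℂ (a.base q₀) (a.base q), C₃ q, C₄ q)) q₀) :
    Tendsto (fun q => a.sig (a.πτ q)) (𝓝 q₀) (𝓝 (a.πτ q₀')) ∧
      ∀ f : a.S₆ → ℂ, HolSpace.HolAt f (a.πτ q₀') →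
        HolSpace.HolAt (fun q => f (a.sig (a.πτ q))) q₀ := by
  set x₀ := a.base q₀
  have hbq : Tendsto a.base (𝓝 q₀) (𝓝 x₀) := a.continuous_base.continuousAt
  have hx₀' : a.base q₀' ∈ (chartAt ℂ x₀).source := by rw [hb]; exact mem_chart_source ℂ _
  have hex : ∀ᶠ q in 𝓝 q₀, ∃ q', a.Compl q q' ∧ a.base q' = a.base q ∧ a.e₁ x₀ q' = C₃ q ∧
      a.e₂ x₀ q' = C₄ q := by
    filter_upwards [hf, hbq.eventually (eventually_mem_chart x₀)] with q h1 h2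
    exact ha.exists_compl_of_fac h2 h1
  have : Nonempty a.SS := ⟨q₀⟩
  obtain ⟨lam, hlam⟩ := hex.choice
  have hlt : Tendsto lam (𝓝 q₀) (𝓝 q₀') := by
    refine a.tendsto_SS hx₀' ?_ ?_ ?_
    · rw [hb]
      exact hbq.congr' (hlam.mono fun q h => h.2.1.symm)
    · rw [← h₃]
      exact hC₃.tendsto.congr' (hlam.mono fun q h => h.2.2.1.symm)
    · rw [← h₄]
      exact hC₄.tendsto.congr' (hlam.mono fun q h => h.2.2.2.symm)
  have hsig : ∀ᶠ q in 𝓝 q₀, a.πτ (lam q) = a.sig (a.πτ q) :=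
    hlam.mono fun q h => h.1.sig_eq.symm
  refine ⟨((a.continuous_πτ.tendsto q₀').comp hlt).congr' hsig, fun f hfh => ?_⟩
  obtain ⟨G, hGd, hGe⟩ := exists_cc hx₀' (a.holAt_S₆_iff.1 hfh)
  have hcc : a.cc x₀ q₀' = (chartAt ℂ x₀ x₀, C₃ q₀, C₄ q₀) := by rw [cc, hb, h₃, h₄]
  obtain ⟨G', hG's, hG'd, hG'e⟩ : ∃ G' : ℂ × ℂ × ℂ → ℂ,
      (C₃ q₀ = C₄ q₀ → ∀ w, G' (w.1, w.2.2, w.2.1) = G' w) ∧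
      (∀ᶠ w in 𝓝 (a.cc x₀ q₀'), DifferentiableAt ℂ G' w) ∧
      ∀ᶠ q' in 𝓝 q₀', f (a.πτ q') = G' (a.cc x₀ q') := by
    by_cases hd : C₃ q₀ = C₄ q₀
    · have hswap : Tendsto (fun w : ℂ × ℂ × ℂ => (w.1, w.2.2, w.2.1)) (𝓝 (a.cc x₀ q₀'))
          (𝓝 (a.cc x₀ q₀')) := by
        have h1 : ContinuousAt (fun w : ℂ × ℂ × ℂ => (w.1, w.2.2, w.2.1)) (a.cc x₀ q₀') := by
          fun_prop
        have h2 : ((a.cc x₀ q₀').1, (a.cc x₀ q₀').2.2, (a.cc x₀ q₀').2.1) = a.cc x₀ q₀' := by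
          rw [hcc, hd]
        rw [ContinuousAt, h2] at h1
        exact h1
      have hτ : a.τ q₀' = q₀' := SS_ext (x₀ := x₀) (by rwa [base_τ]) (a.base_τ _)
        (by rw [e₁_τ, ← h₃, ← h₄, hd]) (by rw [e₂_τ, ← h₃, ← h₄, hd])
      have hτt : Tendsto a.τ (𝓝 q₀') (𝓝 q₀') := by
        have := a.continuous_τ.tendsto q₀'
        rwa [hτ] at this
      -- At a double root, `G` is averaged over the exchange of the roots. This does not change its
      -- restriction, since a function pulled back from $\hat S_6$ is $\tau$-invariant and `q₀'` is
      -- fixed by `τ`.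
      refine ⟨fun w => (G w + G (w.1, w.2.2, w.2.1)) / 2, fun _ w => by simp only; ring, ?_, ?_⟩
      · filter_upwards [hGd, hswap.eventually hGd] with w k1 k2
        have k3 : DifferentiableAt ℂ (fun w : ℂ × ℂ × ℂ => G (w.1, w.2.2, w.2.1)) w :=
          DifferentiableAt.comp (g := G)
            (f := fun w : ℂ × ℂ × ℂ => (w.1, w.2.2, w.2.1)) w k2 (by fun_prop)
        simp only [div_eq_mul_inv]
        exact (k1.add k3).mul_const _
      · filter_upwards [hGe, hτt.eventually hGe] with q k1 k2
        rw [πτ_τ] at k2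
        have k3 : a.cc x₀ (a.τ q) = ((a.cc x₀ q).1, (a.cc x₀ q).2.2, (a.cc x₀ q).2.1) := by
          simp only [cc, base_τ, e₁_τ, e₂_τ]
        rw [k3] at k2
        rw [← k1, ← k2]
        ring
    · exact ⟨G, fun h => absurd h hd, hGd, hGe⟩
  rw [hcc] at hG'd
  refine LawfulHol.congr (hG G' hG's hG'd) ?_
  filter_upwards [hlt.eventually hG'e, hlam, hsig] with q k1 k2 k3
  rw [← k3, k1, cc, k2.2.1, k2.2.2.1, k2.2.2.2]

theorem IsGeneric.sig_spec (ha : a.IsGeneric) (q₀ : a.SS) : ∃ q₀', a.Compl q₀ q₀' ∧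
    Tendsto (fun q => a.sig (a.πτ q)) (𝓝 q₀) (𝓝 (a.πτ q₀')) ∧
      ∀ f : a.S₆ → ℂ, HolSpace.HolAt f (a.πτ q₀') →
        HolSpace.HolAt (fun q => f (a.sig (a.πτ q))) q₀ := by
  have hx₀ : a.base q₀ ∈ (chartAt ℂ (a.base q₀)).source := mem_chart_source ℂ _
  have simple : ∀ {r₃ r₄ : ℂ},
      a.Fac (a.base q₀) (a.base q₀) (a.e₁ (a.base q₀) q₀) (a.e₂ (a.base q₀) q₀) r₃ r₄ →
      r₄ ≠ a.e₁ (a.base q₀) q₀ → r₄ ≠ a.e₂ (a.base q₀) q₀ → r₄ ≠ r₃ →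
      ∃ q₀', a.Compl q₀ q₀' ∧
        Tendsto (fun q => a.sig (a.πτ q)) (𝓝 q₀) (𝓝 (a.πτ q₀')) ∧
        ∀ f : a.S₆ → ℂ, HolSpace.HolAt f (a.πτ q₀') →
          HolSpace.HolAt (fun q => f (a.sig (a.πτ q))) q₀ := by
    intro r₃ r₄ h h1 h2 h3
    obtain ⟨q₀', hc, hb, e1, e2⟩ := ha.exists_compl_of_fac hx₀ h
    obtain ⟨C₃, C₄, c3, c4, k3, k4, hf, hG⟩ := exists_local_complement_of_simple h h1 h2 h3
    exact ⟨q₀', hc, ha.sig_spec_of_local c3 c4 hb (k3.trans e1.symm) (k4.trans e2.symm) hf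
      fun G _ hd => hG G (by rwa [k3, k4] at hd)⟩
  obtain ⟨r₃, r₄, h⟩ := a.exists_fac hx₀
  by_cases h34 : r₃ = r₄
  · subst h34
    obtain ⟨q₀', hc, hb, e1, e2⟩ := ha.exists_compl_of_fac hx₀ h
    obtain ⟨C₃, C₄, c3, c4, k3, k4, hf, hG⟩ := ha.exists_local_complement_of_double h
    exact ⟨q₀', hc, ha.sig_spec_of_local c3 c4 hb (k3.trans e1.symm) (k4.trans e2.symm) hf
      fun G hs hd => hG G (hs (k3.trans k4.symm)) (by rwa [k3, k4] at hd)⟩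
  -- The complementary roots are distinct and at most one coincidence occurs among all four, so one
  -- of them is a simple root of the quartic.
  · by_cases h41 : r₄ = a.e₁ (a.base q₀) q₀
    · subst h41
      obtain ⟨n1, n2, n3⟩ := ha.distinct hx₀ h.swap₃₄.swap₂₃
      exact simple h.swap₃₄ n2.symm n3.symm h34
    · by_cases h42 : r₄ = a.e₂ (a.base q₀) q₀
      · subst h42
        obtain ⟨n1, n2, n3⟩ := ha.distinct hx₀ h.swap₃₄.swap₁₂.swap₂₃
        exact simple h.swap₃₄ n3.symm n2.symm h34
      · exact simple h h41 h42 (Ne.symm h34)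

theorem IsGeneric.continuous_sig (ha : a.IsGeneric) : Continuous a.sig := by
  refine continuous_iff_continuousAt.2 fun y => ?_
  obtain ⟨q, rfl⟩ := a.surjective_πτ y
  obtain ⟨q', hc, ht, -⟩ := ha.sig_spec q
  rw [ContinuousAt, nhds_πτ, hc.sig_eq]
  exact ht

theorem IsGeneric.holAt_comp_sig (ha : a.IsGeneric) {f : a.S₆ → ℂ} {y : a.S₆}
    (hf : HolSpace.HolAt f (a.sig y)) : HolSpace.HolAt (fun y => f (a.sig y)) y := by
  obtain ⟨q, rfl⟩ := a.surjective_πτ y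
  obtain ⟨q', hc, -, hh⟩ := ha.sig_spec q
  rw [hc.sig_eq] at hf
  exact a.holAt_S₆_iff.2 (hh f hf)

/-! ### The quotient by `σ` -/

theorem IsGeneric.πσ_eq_iff (ha : a.IsGeneric) {y y' : a.S₆} :
    a.πσ y = a.πσ y' ↔ y' = y ∨ y' = a.sig y :=
  quot_mk_eq_iff (i := a.sig) ha.sigmaRel_iff_sig ha.sig_sig

theorem IsGeneric.nhds_πσ (ha : a.IsGeneric) (y : a.S₆) : 𝓝 (a.πσ y) = map a.πσ (𝓝 y) :=
  nhds_quot_mk (i := a.sig) ha.sigmaRel_iff_sig ha.sig_sig ha.continuous_sig y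

theorem surjective_πσ : Function.Surjective a.πσ := Quot.mk_surjective

theorem continuous_πσ : Continuous a.πσ := continuous_quot_mk

theorem IsGeneric.πσ_sig (ha : a.IsGeneric) (y : a.S₆) : a.πσ (a.sig y) = a.πσ y :=
  (ha.πσ_eq_iff.2 (Or.inr rfl)).symm

theorem IsGeneric.holAt_πσ_of_eq (ha : a.IsGeneric) (f : a.S₆σ → ℂ) (y y' : a.S₆)
    (h : a.πσ y = a.πσ y') (hf : HolSpace.HolAt (fun y => f (a.πσ y)) y) :
    HolSpace.HolAt (fun y => f (a.πσ y)) y' := by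
  rcases ha.πσ_eq_iff.1 h with rfl | rfl
  · exact hf
  · rw [← ha.sig_sig y] at hf
    have := ha.holAt_comp_sig hf
    simpa only [ha.πσ_sig] using this

theorem IsGeneric.holAt_S₆σ_iff (ha : a.IsGeneric) {f : a.S₆σ → ℂ} {y : a.S₆} :
    HolSpace.HolAt f (a.πσ y) ↔ HolSpace.HolAt (fun y => f (a.πσ y)) y :=
  ⟨fun h => h y rfl, fun h y' hy' => ha.holAt_πσ_of_eq f y y' hy'.symm h⟩

theorem IsGeneric.lawfulHol_S₆σ (ha : a.IsGeneric) : LawfulHol a.S₆σ :=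
  lawfulHol_of_quotient a.πσ surjective_πσ ha.nhds_πσ (fun _ _ => Iff.rfl) ha.holAt_πσ_of_eq

variable (a) in
/-- The sum and the product of a pair of roots in a chart. -/
def symm₂ (x₀ : X) : a.S₆ → ℂ × ℂ :=
  Quot.lift (fun q => (a.e₁ x₀ q + a.e₂ x₀ q, a.e₁ x₀ q * a.e₂ x₀ q)) (by
    rintro q _ rfl
    rw [e₁_τ, e₂_τ, add_comm, mul_comm])

/-- Since $\sigma$ has no fixed point, a neighbourhood of `y` disjoint from its image under $\sigma$
meets each fibre at most once. The separation is made in $\mathbb C^2$ by the sum and product of the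
roots, so no Hausdorff property of $\hat S_6$ is needed. -/
theorem IsGeneric.mult_πσ (ha : a.IsGeneric) (y : a.S₆) : mult a.πσ y = 1 := by
  refine mult_eq ?_ ?_
  · obtain ⟨q, rfl⟩ := a.surjective_πτ y
    obtain ⟨q', hc⟩ := ha.exists_compl q
    set x₀ := a.base q
    have hx : a.base q ∈ (chartAt ℂ x₀).source := mem_chart_source ℂ _
    have hx' : a.base q' ∈ (chartAt ℂ x₀).source := by rw [hc.1]; exact hx
    have hcont : ∀ q : a.SS, a.base q ∈ (chartAt ℂ x₀).source →
        ContinuousAt (a.symm₂ x₀) (a.πτ q) := by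
      intro q hq
      rw [ContinuousAt, nhds_πτ]
      have c1 := a.continuousAt_e₁ hq
      have c2 := a.continuousAt_e₂ hq
      exact (c1.add c2).prodMk (c1.mul c2)
    have hne : a.symm₂ x₀ (a.πτ q) ≠ a.symm₂ x₀ (a.πτ q') := by
      intro he
      have h1 : a.e₁ x₀ q + a.e₂ x₀ q = a.e₁ x₀ q' + a.e₂ x₀ q' := congrArg Prod.fst he
      have h2 : a.e₁ x₀ q * a.e₂ x₀ q = a.e₁ x₀ q' * a.e₂ x₀ q' := congrArg Prod.snd he
      refine ha.sig_ne (a.πτ q) ?_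
      rw [hc.sig_eq, eq_comm, πτ_eq_iff]
      rcases eq_or_eq_of_add_mul h1 h2 with ⟨k1, k2⟩ | ⟨k1, k2⟩
      · exact Or.inl (SS_ext hx' hc.1 k1 k2)
      · exact Or.inr (SS_ext (q := q') (q' := a.τ q) hx' (by rw [base_τ, hc.1]) k1 k2)
    obtain ⟨A, B, hA, hB, hAB⟩ := t2_separation_nhds hne
    have hs : Tendsto a.sig (𝓝 (a.πτ q)) (𝓝 (a.πτ q')) := by
      rw [← hc.sig_eq]
      exact ha.continuous_sig.continuousAt
    refine ⟨_, ((hcont q hx).eventually hA).and (((hcont q' hx').tendsto.comp hs).eventually hB),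
      fun z => ?_⟩
    rw [Nat.cast_one, Set.encard_le_one_iff]
    rintro y₁ y₂ ⟨⟨k1, l1⟩, rfl⟩ ⟨⟨k2, l2⟩, e2⟩
    rcases ha.πσ_eq_iff.1 (Eq.symm e2) with h | h
    · exact h.symm
    · refine absurd l1 (Set.disjoint_left.1 hAB ?_)
      rwa [Function.comp_apply, ← h]
  · intro U hU
    refine ⟨a.πσ y, ?_⟩
    rw [Nat.cast_one, Set.one_le_encard_iff_nonempty]
    exact ⟨y, mem_of_mem_nhds hU, rfl⟩

/-- Near a simple root the curve is the graph of a function on the base. -/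
theorem mult_proj_of_simple {x₀ : X} {s : a.S} (hs : a.proj s = x₀)
    {r₂ r₃ r₄ : ℂ} (h : a.Fac x₀ x₀ (a.sc x₀ s) r₂ r₃ r₄) (h₂ : a.sc x₀ s ≠ r₂)
    (h₃ : a.sc x₀ s ≠ r₃) (h₄ : a.sc x₀ s ≠ r₄) : mult a.proj s = 1 := by
  refine mult_eq ?_ ?_
  · have h' : a.Fac x₀ x₀ r₂ r₃ r₄ (a.sc x₀ s) := fun t => by rw [h t]; ring
    obtain ⟨ρ, -, -, hev⟩ := a.exists_root_function h' h₂ h₃ h₄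
    have hsx : a.proj s ∈ (chartAt ℂ x₀).source := by rw [hs]; exact mem_chart_source ℂ _
    have ht : Tendsto (fun s => (a.proj s, a.sc x₀ s)) (𝓝 s) (𝓝 (x₀, a.sc x₀ s)) := by
      rw [← hs]
      exact a.continuous_proj.continuousAt.prodMk (a.continuousAt_sc (by rw [hs] at hsx ⊢; exact hsx))
    refine ⟨_, (ht.eventually hev).and (a.continuous_proj.continuousAt.eventually
      ((chartAt ℂ x₀).open_source.mem_nhds hsx)), fun x => ?_⟩
    rw [Nat.cast_one, Set.encard_le_one_iff]
    rintro s₁ s₂ ⟨⟨k1, l1⟩, rfl⟩ ⟨⟨k2, l2⟩, e2⟩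
    have e2 : a.proj s₂ = a.proj s₁ := e2
    refine S_ext l1 e2.symm ?_
    have m1 := k1.1 (a.poly_sc x₀ s₁)
    have m2 := k2.1 (a.poly_sc x₀ s₂)
    simp only at m1 m2
    rw [← m1, ← m2, e2]
  · intro U hU
    refine ⟨a.proj s, ?_⟩
    rw [Nat.cast_one, Set.one_le_encard_iff_nonempty]
    exact ⟨s, mem_of_mem_nhds hU, rfl⟩

/-- Near a double root all points are of the form $u\pm\sqrt d$, so there are at most two in a
fibre. There are exactly two in some nearby fibre because `(s, s)` is a limit of off-diagonal pairs.
-/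
theorem IsGeneric.mult_proj_of_double (ha : a.IsGeneric) {x₀ : X} {s : a.S} (hs : a.proj s = x₀)
    {r₃ r₄ : ℂ} (h : a.Fac x₀ x₀ (a.sc x₀ s) (a.sc x₀ s) r₃ r₄) : mult a.proj s = 2 := by
  have hsx : a.proj s ∈ (chartAt ℂ x₀).source := by rw [hs]; exact mem_chart_source ℂ _
  refine mult_eq ?_ ?_
  · obtain ⟨h13, h14, h34⟩ := ha.distinct (mem_chart_source ℂ _) h
    obtain ⟨ρ₃, ρ₄, u, d, hρ₃, hρ₄, hu, hd, e3, e4, -, -, hev⟩ :=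
      a.exists_local_factorization h h13 h14 h13 h14 h34
    have hb : Tendsto a.proj (𝓝 s) (𝓝 x₀) := by
      rw [← hs]; exact a.continuous_proj.continuousAt
    have hz := (tendsto_chart x₀).comp hb
    have t3 : ContinuousAt (fun s => a.sc x₀ s - ρ₃ (chartAt ℂ x₀ (a.proj s))) s := by
      refine (a.continuousAt_sc hsx).sub ?_
      rw [ContinuousAt, hs]
      exact hρ₃.continuousAt.tendsto.comp hz
    have t4 : ContinuousAt (fun s => a.sc x₀ s - ρ₄ (chartAt ℂ x₀ (a.proj s))) s := by
      refine (a.continuousAt_sc hsx).sub ?_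
      rw [ContinuousAt, hs]
      exact hρ₄.continuousAt.tendsto.comp hz
    have n3 := t3.eventually_ne (y := 0) (by rw [hs, e3]; exact sub_ne_zero.2 h13)
    have n4 := t4.eventually_ne (y := 0) (by rw [hs, e4]; exact sub_ne_zero.2 h14)
    refine ⟨_, ((hb.eventually hev).and (a.continuous_proj.continuousAt.eventually
      ((chartAt ℂ x₀).open_source.mem_nhds hsx))).and (n3.and n4), fun x => ?_⟩
    have key : ∀ w : ℂ, w ^ 2 = d (chartAt ℂ x₀ x) →
        ({u (chartAt ℂ x₀ x) + w, u (chartAt ℂ x₀ x) - w} : Set ℂ).encard ≤ (2 : ℕ) := by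
      intro w _
      refine (Set.encard_insert_le _ _).trans ?_
      rw [Set.encard_singleton]
      norm_num
    refine le_trans ?_ (key _ (cpow_half_sq _))
    refine Set.encard_le_encard_of_injOn (f := a.sc x₀) ?_ ?_
    · rintro s₁ ⟨⟨⟨k1, l1⟩, n3, n4⟩, rfl⟩
      rcases (k1 _ (cpow_half_sq _)).root (a.poly_sc x₀ s₁) with h | h | h | h
      · exact Or.inl h
      · exact Or.inr h
      · exact absurd (sub_eq_zero.2 h) n3
      · exact absurd (sub_eq_zero.2 h) n4
    · rintro s₁ ⟨⟨⟨-, l1⟩, -⟩, rfl⟩ s₂ ⟨-, e2⟩ he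
      exact S_ext l1 (Eq.symm e2) he
  · intro U hU
    have hm := ha.mem_offDiagonal hs hs h
    obtain ⟨⟨s₁, s₂⟩, ⟨hU1, hU2⟩, h1, h2⟩ := mem_closure_iff_nhds.1 hm (U ×ˢ U) (prod_mem_nhds hU hU)
    refine ⟨a.proj s₁, ?_⟩
    have : ({s₁, s₂} : Set a.S).encard ≤ (U ∩ a.proj ⁻¹' {a.proj s₁}).encard := by
      refine Set.encard_le_encard ?_
      rintro t (rfl | rfl)
      · exact ⟨hU1, rfl⟩
      · exact ⟨hU2, Eq.symm h1⟩
    rwa [Set.encard_pair h2] at this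

end HitchinBase
end Curve

/-! ### Frames of line bundles -/

set_option linter.unusedSectionVars false

section Lines

variable {M : Type*} {N : Type*} [AddCommGroup M] [Module ℂ M] [AddCommGroup N] [Module ℂ N]
  {m : M} {n : N}

theorem tmul_ne_zero (hm : m ≠ 0) (hn : n ≠ 0) : m ⊗ₜ[ℂ] n ≠ 0 := by
  obtain ⟨l, hl⟩ := Module.Projective.exists_dual_ne_zero ℂ hm
  obtain ⟨l', hl'⟩ := Module.Projective.exists_dual_ne_zero ℂ hn
  intro h
  have h2 := congrArg (fun t => TensorProduct.lid ℂ ℂ (TensorProduct.map l l' t)) h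
  simp [hl, hl'] at h2

theorem exists_eq_smul_tmul (hm : ∀ a : M, ∃ c : ℂ, a = c • m) (hn : ∀ a : N, ∃ c : ℂ, a = c • n)
    (t : M ⊗[ℂ] N) : ∃ c : ℂ, t = c • (m ⊗ₜ[ℂ] n) := by
  induction t with
  | zero => exact ⟨0, (zero_smul ℂ _).symm⟩
  | tmul a b =>
    obtain ⟨c, rfl⟩ := hm a
    obtain ⟨d, rfl⟩ := hn b
    exact ⟨c * d, by rw [TensorProduct.smul_tmul_smul]⟩
  | add a b ha hb =>
    obtain ⟨c, hc⟩ := ha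
    obtain ⟨d, hd⟩ := hb
    exact ⟨c + d, by rw [add_smul, ← hc, ← hd]⟩

theorem exists_dual_eq_one (hm : m ≠ 0) : ∃ l : Module.Dual ℂ M, l m = 1 := by
  obtain ⟨l, hl⟩ := Module.Projective.exists_dual_ne_zero ℂ hm
  exact ⟨(l m)⁻¹ • l, by simp [hl]⟩

theorem dual_eq_smul (hm : ∀ a : M, ∃ c : ℂ, a = c • m) {l : Module.Dual ℂ M} (hl : l m = 1)
    (k : Module.Dual ℂ M) : k = k m • l := by
  ext a
  obtain ⟨c, rfl⟩ := hm a
  simp [hl, mul_comm]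

end Lines

namespace Family

variable {Y : Type u} [TopologicalSpace Y] [HolSpace Y] [LawfulHol Y] {E : Family.{u, v} Y}
  {U V : Set Y} {e e' s : ∀ y, E.Fiber y} {x : Y}

theorem IsFrameOn.mono (he : E.IsFrameOn U e) (h : V ⊆ U) : E.IsFrameOn V e :=
  fun x hx => he x (h hx)

theorem IsFrameOn.ne_zero (he : E.IsFrameOn U e) (hx : x ∈ U) : e x ≠ 0 := (he x hx).1.1

theorem IsFrameOn.span (he : E.IsFrameOn U e) (hx : x ∈ U) (a : E.Fiber x) :
    ∃ c : ℂ, a = c • e x := (he x hx).1.2 a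

theorem smul_left_inj {c d : ℂ} {a : E.Fiber x} (ha : a ≠ 0) (h : c • a = d • a) : c = d :=
  smul_left_injective ℂ ha h

theorem IsFrameOn.holAt_iff (he : E.IsFrameOn U e) (hU : IsOpen U) (hx : x ∈ U) {f : Y → ℂ}
    (h : ∀ᶠ y in 𝓝 x, s y = f y • e y) : E.HolAt s x ↔ HolSpace.HolAt f x := by
  rw [(he x hx).2 s]
  constructor
  · rintro ⟨g, hg, hs⟩
    refine LawfulHol.congr hg ?_
    filter_upwards [h, hs, hU.mem_nhds hx] with y h1 h2 h3
    exact smul_left_inj (he.ne_zero h3) (h2.symm.trans h1)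
  · exact fun hf => ⟨f, hf, h⟩

theorem IsFrameOn.holAt_self (he : E.IsFrameOn U e) (hU : IsOpen U) (hx : x ∈ U) : E.HolAt e x :=
  (he.holAt_iff hU hx (f := fun _ => 1) (Eventually.of_forall fun _ => (one_smul ℂ _).symm)).2
    (LawfulHol.const 1 x)

/-- The coefficient of a holomorphic section with respect to a frame. -/
theorem IsFrameOn.exists_coeff (he : E.IsFrameOn U e) (hU : IsOpen U) (s : ∀ y, E.Fiber y) :
    ∃ f : Y → ℂ, (∀ y ∈ U, s y = f y • e y) ∧ ∀ y ∈ U, E.HolAt s y ↔ HolSpace.HolAt f y := by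
  have : ∀ y, ∃ c : ℂ, y ∈ U → s y = c • e y := fun y => by
    by_cases hy : y ∈ U
    · obtain ⟨c, hc⟩ := he.span hy (s y)
      exact ⟨c, fun _ => hc⟩
    · exact ⟨0, fun h => absurd h hy⟩
  choose f hf using this
  exact ⟨f, hf, fun _ hy => he.holAt_iff hU hy (eventually_of_mem (hU.mem_nhds hy) hf)⟩

/-- Two frames differ by a nowhere zero holomorphic function. -/
theorem IsFrameOn.exists_change (he : E.IsFrameOn U e) (he' : E.IsFrameOn U e') (hU : IsOpen U) :
    ∃ g : Y → ℂ, ∀ y ∈ U, e' y = g y • e y ∧ HolSpace.HolAt g y ∧ g y ≠ 0 := by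
  obtain ⟨g, h1, h2⟩ := he.exists_coeff hU e'
  refine ⟨g, fun y hy => ⟨h1 y hy, (h2 y hy).1 (he'.holAt_self hU hy), fun h0 => ?_⟩⟩
  exact he'.ne_zero hy (by rw [h1 y hy, h0, zero_smul])

/-- A nowhere zero holomorphic multiple of a frame is a frame. -/
theorem IsFrameOn.of_change (he : E.IsFrameOn U e)
    (h : ∀ x ∈ U, ∃ g : Y → ℂ, HolSpace.HolAt g x ∧ g x ≠ 0 ∧ ∀ᶠ y in 𝓝 x, e' y = g y • e y) :
    E.IsFrameOn U e' := by
  intro x hx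
  obtain ⟨g, hg, h0, hge⟩ := h x hx
  have hx' : e' x = g x • e x := hge.self_of_nhds
  refine ⟨⟨?_, fun a => ?_⟩, fun s => ?_⟩
  · rw [hx']
    exact smul_ne_zero h0 (he.ne_zero hx)
  · obtain ⟨c, rfl⟩ := he.span hx a
    exact ⟨c / g x, by rw [hx', smul_smul, div_mul_cancel₀ _ h0]⟩
  · rw [(he x hx).2 s]
    have hn : ∀ᶠ y in 𝓝 x, g y ≠ 0 := (LawfulHol.continuousAt hg).eventually_ne h0
    constructor
    · rintro ⟨f, hf, hs⟩
      refine ⟨_, LawfulHol.mul hf (LawfulHol.inv hg h0), ?_⟩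
      filter_upwards [hs, hge, hn] with y h1 h2 h3
      rw [h1, h2, smul_smul, mul_assoc, inv_mul_cancel₀ h3, mul_one]
    · rintro ⟨f, hf, hs⟩
      refine ⟨_, LawfulHol.mul hf hg, ?_⟩
      filter_upwards [hs, hge] with y h1 h2
      rw [h1, h2, smul_smul]

theorem isFrameOn_trivial (U : Set Y) : (trivial Y).IsFrameOn U (fun _ => (1 : ℂ)) := by
  refine fun x _ => ⟨⟨one_ne_zero (α := ℂ), fun a => ⟨a, (mul_one (M := ℂ) a).symm⟩⟩, fun s => ⟨fun h => ?_, ?_⟩⟩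
  · exact ⟨s, h, Eventually.of_forall fun y => (mul_one (M := ℂ) _).symm⟩
  · rintro ⟨f, hf, h⟩
    exact LawfulHol.congr hf (h.mono fun y hy => ((mul_one (M := ℂ) _).symm.trans hy.symm))

theorem isLineBundle_trivial : (trivial Y).IsLineBundle := fun _ =>
  ⟨Set.univ, isOpen_univ, Set.mem_univ _, _, isFrameOn_trivial _⟩

theorem IsLineBundle.congr (hE : E.IsLineBundle) {s t : ∀ y, E.Fiber y} (hs : E.HolAt s x)
    (h : ∀ᶠ y in 𝓝 x, s y = t y) : E.HolAt t x := by
  obtain ⟨U, -, hx, e, he⟩ := hE x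
  obtain ⟨f, hf, hsf⟩ := ((he x hx).2 s).1 hs
  refine ((he x hx).2 t).2 ⟨f, hf, ?_⟩
  filter_upwards [hsf, h] with y h1 h2
  rw [← h2, h1]

theorem IsLineBundle.smul (hE : E.IsLineBundle) {f : Y → ℂ} (hf : HolSpace.HolAt f x)
    (hs : E.HolAt s x) : E.HolAt (fun y => f y • s y) x := by
  obtain ⟨U, -, hx, e, he⟩ := hE x
  obtain ⟨g, hg, hsg⟩ := ((he x hx).2 s).1 hs
  refine ((he x hx).2 _).2 ⟨_, LawfulHol.mul hf hg, ?_⟩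
  filter_upwards [hsg] with y h1
  rw [h1, smul_smul]

section Pullback

variable {Z : Type w} [TopologicalSpace Z] [HolSpace Z] [LawfulHol Z] {φ : Z → Y}

/-- The definition lets a section be presented in any frame nearby. Two frames differ by a
holomorphic factor, whose pull-back is again holomorphic, so one frame decides; tensor products and
duals are handled alike. -/
theorem IsFrameOn.pullback (he : E.IsFrameOn U e) (hU : IsOpen U) (hφ : Continuous φ)
    (hol : ∀ {f : Y → ℂ} {z : Z}, HolSpace.HolAt f (φ z) → HolSpace.HolAt (fun z => f (φ z)) z) :
    (pullback φ E).IsFrameOn (φ ⁻¹' U) (fun z => e (φ z)) := by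
  refine fun z hz => ⟨⟨he.ne_zero hz, he.span hz⟩, fun s => ⟨?_, ?_⟩⟩
  · rintro ⟨V, hV, hzV, e', he', f, hf, hs⟩
    obtain ⟨g, hg⟩ := (he.mono Set.inter_subset_left).exists_change
      (he'.mono Set.inter_subset_right) (hU.inter hV)
    refine ⟨_, LawfulHol.mul hf (hol (hg (φ z) ⟨hz, hzV⟩).2.1), ?_⟩
    filter_upwards [hs, (hφ.isOpen_preimage _ (hU.inter hV)).mem_nhds ⟨hz, hzV⟩] with z' h1 h2
    rw [h1, (hg (φ z') h2).1, smul_smul]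
    rfl
  · rintro ⟨f, hf, hs⟩
    exact ⟨U, hU, hz, e, he, f, hf, hs⟩

end Pullback

section Tensor

variable {F : Family.{u, w} Y} {e₂ : ∀ y, F.Fiber y}

theorem IsFrameOn.tensor (he : E.IsFrameOn U e) (he₂ : F.IsFrameOn U e₂) (hU : IsOpen U) :
    (E.tensor F).IsFrameOn U (fun y => e y ⊗ₜ[ℂ] e₂ y) := by
  refine fun x hx => ⟨⟨tmul_ne_zero (he.ne_zero hx) (he₂.ne_zero hx),
    exists_eq_smul_tmul (he.span hx) (he₂.span hx)⟩, fun s => ⟨?_, ?_⟩⟩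
  · rintro ⟨V, hV, hxV, e', e₂', he', he₂', f, hf, hs⟩
    obtain ⟨g, hg⟩ := (he.mono Set.inter_subset_left).exists_change
      (he'.mono Set.inter_subset_right) (hU.inter hV)
    obtain ⟨g₂, hg₂⟩ := (he₂.mono Set.inter_subset_left).exists_change
      (he₂'.mono Set.inter_subset_right) (hU.inter hV)
    refine ⟨_, LawfulHol.mul hf (LawfulHol.mul (hg x ⟨hx, hxV⟩).2.1 (hg₂ x ⟨hx, hxV⟩).2.1), ?_⟩
    filter_upwards [hs, (hU.inter hV).mem_nhds ⟨hx, hxV⟩] with y h1 h2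
    rw [h1, (hg y h2).1, (hg₂ y h2).1, TensorProduct.smul_tmul_smul, smul_smul]
    rfl
  · rintro ⟨f, hf, hs⟩
    exact ⟨U, hU, hx, e, e₂, he, he₂, f, hf, hs⟩

theorem IsFrameOn.exists_dual (he : E.IsFrameOn U e) (hU : IsOpen U) :
    ∃ l : ∀ y, Module.Dual ℂ (E.Fiber y), E.dual.IsFrameOn U l ∧ ∀ y ∈ U, l y (e y) = 1 := by
  have : ∀ y, ∃ l : Module.Dual ℂ (E.Fiber y), y ∈ U → l (e y) = 1 := fun y => by
    by_cases hy : y ∈ U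
    · obtain ⟨l, hl⟩ := exists_dual_eq_one (he.ne_zero hy)
      exact ⟨l, fun _ => hl⟩
    · exact ⟨0, fun h => absurd h hy⟩
  choose l hl using this
  have key : ∀ y ∈ U, ∀ m : Module.Dual ℂ (E.Fiber y), m = m (e y) • l y := fun y hy m =>
    dual_eq_smul (he.span hy) (hl y hy) m
  refine ⟨l, fun x hx => ⟨⟨fun h => ?_, fun m => ⟨_, key x hx m⟩⟩, fun s => ⟨?_, ?_⟩⟩, hl⟩
  · have := hl x hx
    rw [show l x = 0 from h] at this
    simp at this
  · rintro ⟨V, hV, hxV, e', he', hs⟩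
    obtain ⟨g, hg⟩ := (he'.mono Set.inter_subset_right).exists_change
      (he.mono Set.inter_subset_left) (hU.inter hV)
    refine ⟨_, LawfulHol.mul (hg x ⟨hx, hxV⟩).2.1 hs, ?_⟩
    filter_upwards [(hU.inter hV).mem_nhds ⟨hx, hxV⟩] with y h2
    have h3 : ∀ m : Module.Dual ℂ (E.Fiber y), m = (g y * m (e' y)) • l y := fun m => by
      rw [← smul_eq_mul, ← map_smul, ← (hg y h2).1]
      exact key y h2.1 m
    exact h3 (s y)
  · rintro ⟨f, hf, hs⟩
    refine ⟨U, hU, hx, e, he, LawfulHol.congr hf ?_⟩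
    filter_upwards [hs, hU.mem_nhds hx] with y h1 h2
    have h3 : ∀ m : Module.Dual ℂ (E.Fiber y), m = f y • l y → f y = m (e y) := by
      rintro m rfl
      simp [hl y h2]
    exact h3 (s y) h1

end Tensor

end Family

/-! ### Sheaves of anti-invariant sections and their generators -/

section AntiInvariant

set_option linter.unusedSectionVars false

variable {Z : Type u} {Y : Type w} [TopologicalSpace Z] [HolSpace Z] [LawfulHol Z]
  [TopologicalSpace Y] [HolSpace Y] [LawfulHol Y]
  {pr : Z → Y} {τ : Z → Z} {E : Family.{u, v} Z} {θ : ∀ z, E.Fiber z →ₗ[ℂ] E.Fiber (τ z)}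

variable (pr τ E θ) in
/-- Anti-invariant holomorphic sections over the preimage of `V`. -/
def IsAntiOn (V : Set Y) (s : ∀ z, E.Fiber z) : Prop :=
  (∀ z, pr z ∈ V → E.HolAt s z) ∧ ∀ z, pr z ∈ V → s (τ z) = -θ z (s z)

variable (pr τ E θ) in
/-- `σ` freely generates the sheaf of anti-invariant sections over `W`. -/
structure IsAntiFrameOn (W : Set Y) (σ : ∀ z, E.Fiber z) : Prop where
  anti : IsAntiOn pr τ E θ W σ
  gen : ∀ y ∈ W, ∀ V : Set Y, IsOpen V → y ∈ V → ∀ s, IsAntiOn pr τ E θ V s →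
    ∃ k : Y → ℂ, HolSpace.HolAt k y ∧ ∀ᶠ z in comap pr (𝓝 y), s z = k (pr z) • σ z
  uniq : ∀ y ∈ W, ∀ k k' : Y → ℂ, HolSpace.HolAt k y → HolSpace.HolAt k' y →
    (∀ᶠ z in comap pr (𝓝 y), k (pr z) • σ z = k' (pr z) • σ z) → k y = k' y

theorem IsAntiOn.mono {V V' : Set Y} {s : ∀ z, E.Fiber z} (h : IsAntiOn pr τ E θ V s)
    (hV : V' ⊆ V) : IsAntiOn pr τ E θ V' s :=
  ⟨fun z hz => h.1 z (hV hz), fun z hz => h.2 z (hV hz)⟩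

theorem IsAntiFrameOn.mono {W W' : Set Y} {σ : ∀ z, E.Fiber z} (h : IsAntiFrameOn pr τ E θ W σ)
    (hW : W' ⊆ W) : IsAntiFrameOn pr τ E θ W' σ :=
  ⟨h.anti.mono hW, fun y hy => h.gen y (hW hy), fun y hy => h.uniq y (hW hy)⟩

/-- An anti-invariant section as a section of the sheaf of anti-invariant sections. -/
def IsAntiOn.toAntiSec {U : Opens Y} {s : ∀ z, E.Fiber z} (h : IsAntiOn pr τ E θ U s) :
    AntiSec pr τ E θ U :=
  ⟨fun z => s z.1, ⟨s, h.1, fun _ => rfl⟩, fun z hz _ => h.2 z hz⟩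

theorem AntiSec.exists_isAntiOn (hτ : ∀ z, pr (τ z) = pr z) {U : Opens Y}
    (A : AntiSec pr τ E θ U) :
    ∃ s, IsAntiOn pr τ E θ U s ∧ ∀ z : {z : Z // pr z ∈ U}, A.1 z = s z.1 := by
  obtain ⟨A, ⟨t, ht, hAt⟩, hA⟩ := A
  refine ⟨t, ⟨ht, fun z hz => ?_⟩, hAt⟩
  have hz' : pr (τ z) ∈ U := by rw [hτ]; exact hz
  rw [← hAt ⟨τ z, hz'⟩, ← hAt ⟨z, hz⟩]
  exact hA z hz hz'

variable {N : Family.{w, v'} Y}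

/-- The linearity and the compatibility with restrictions of an identification of the sections of
`N` with the anti-invariant sections. -/
structure IsAntiIso (φ : ∀ U : Opens Y, N.Sec U ≃ AntiSec pr τ E θ U) : Prop where
  smul : ∀ (U : Opens Y) (f : Y → ℂ), (∀ y ∈ U, HolSpace.HolAt f y) →
      ∀ s t : N.Sec U, (∀ y : U, t.1 y = f y • s.1 y) →
        ∀ z, (φ U t).1 z = f (pr z.1) • (φ U s).1 z
  res : ∀ (U V : Opens Y) (h : U ≤ V) (s : N.Sec V) (t : N.Sec U),
      (∀ y : U, t.1 y = s.1 ⟨y.1, h y.2⟩) →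
        ∀ z : {z : Z // pr z ∈ U}, (φ U t).1 z = (φ V s).1 ⟨z.1, h z.2⟩

/-- The section `n` of `N` corresponds to the anti-invariant section `s`, over `W`. -/
def Corresponds (φ : ∀ U : Opens Y, N.Sec U ≃ AntiSec pr τ E θ U) (W : Set Y)
    (n : ∀ y, N.Fiber y) (s : ∀ z, E.Fiber z) : Prop :=
  ∀ U : Opens Y, (U : Set Y) ⊆ W → ∀ r : N.Sec U, (∀ y : U, r.1 y = n y) →
    ∀ z : {z : Z // pr z ∈ U}, (φ U r).1 z = s z.1

/-- A section which is holomorphic on an open set. -/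
def Family.toSec {U : Opens Y} (n : ∀ y, N.Fiber y) (h : ∀ y ∈ U, N.HolAt n y) : N.Sec U :=
  ⟨fun y => n y, n, h, fun _ => rfl⟩

section Iso

variable {φ : ∀ U : Opens Y, N.Sec U ≃ AntiSec pr τ E θ U}

theorem IsAntiIso.exists_anti (hφ : IsAntiIso φ) (hτ : ∀ z, pr (τ z) = pr z) {W : Set Y}
    (hW : IsOpen W) {n : ∀ y, N.Fiber y} (hn : ∀ y ∈ W, N.HolAt n y) :
    ∃ s, IsAntiOn pr τ E θ W s ∧ Corresponds φ W n s := by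
  obtain ⟨s, hs, h⟩ := (φ ⟨W, hW⟩ (Family.toSec n hn)).exists_isAntiOn hτ
  refine ⟨s, hs, fun U hU r hr z => ?_⟩
  rw [hφ.res U ⟨W, hW⟩ hU (Family.toSec n hn) r hr z, h]

theorem IsAntiIso.exists_section (hφ : IsAntiIso φ) {W : Set Y}
    (hW : IsOpen W) {s : ∀ z, E.Fiber z} (hs : IsAntiOn pr τ E θ W s) :
    ∃ n, (∀ y ∈ W, N.HolAt n y) ∧ Corresponds φ W n s := by
  have hs' : IsAntiOn pr τ E θ (⟨W, hW⟩ : Opens Y) s := hs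
  obtain ⟨n, hn, h⟩ := ((φ ⟨W, hW⟩).symm hs'.toAntiSec).2
  refine ⟨n, hn, fun U hU r hr z => ?_⟩
  rw [hφ.res U ⟨W, hW⟩ hU ((φ ⟨W, hW⟩).symm hs'.toAntiSec) r (fun y => (hr y).trans (h ⟨y.1, hU y.2⟩).symm) z,
    Equiv.apply_symm_apply]
  rfl

/-- The identification is linear over holomorphic functions, compatible with restriction and
injective, so a relation between anti-invariant sections near a fibre transfers to the sections of
`N`. -/
theorem IsAntiIso.eq_smul (hφ : IsAntiIso φ) (hN : N.IsLineBundle) {W : Set Y} (hW : IsOpen W)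
    {n n' : ∀ y, N.Fiber y} {s s' : ∀ z, E.Fiber z} (hn : ∀ y ∈ W, N.HolAt n y)
    (hn' : ∀ y ∈ W, N.HolAt n' y) (h : Corresponds φ W n s) (h' : Corresponds φ W n' s')
    {y : Y} (hy : y ∈ W) {k : Y → ℂ} (hk : HolSpace.HolAt k y)
    (hks : ∀ᶠ z in comap pr (𝓝 y), s z = k (pr z) • s' z) : n y = k y • n' y := by
  rw [eventually_comap] at hks
  obtain ⟨U, hU, hUo, hyU⟩ := eventually_nhds_iff.1
    ((LawfulHol.eventually hk).and (hks.and (hW.mem_nhds hy)))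
  let U' : Opens Y := ⟨U, hUo⟩
  have hkn : ∀ y ∈ U', N.HolAt (fun y => k y • n' y) y := fun y hy =>
    hN.smul (hU y hy).1 (hn' y (hU y hy).2.2)
  have e : Family.toSec n (fun y hy => hn y (hU y hy).2.2) = Family.toSec (U := U') _ hkn := by
    refine (φ U').injective (Subtype.ext (funext fun z => ?_))
    rw [h U' (fun y hy => (hU y hy).2.2) _ (fun _ => rfl) z,
      hφ.smul U' k (fun y hy => (hU y hy).1)
        (Family.toSec n' fun y hy => hn' y (hU y hy).2.2) _ (fun _ => rfl) z,
      h' U' (fun y hy => (hU y hy).2.2) _ (fun _ => rfl) z]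
    exact (hU _ z.2).2.1 z.1 rfl
  exact congrFun (congrArg Subtype.val e) ⟨y, hyU⟩

/-- A generator of the anti-invariant sections corresponds to a frame. -/
theorem IsAntiIso.exists_frame (hφ : IsAntiIso φ) (hτ : ∀ z, pr (τ z) = pr z)
    (hN : N.IsLineBundle) {W : Set Y} (hW : IsOpen W) {σ : ∀ z, E.Fiber z}
    (hσ : IsAntiFrameOn pr τ E θ W σ) :
    ∃ n, N.IsFrameOn W n ∧ (∀ y ∈ W, N.HolAt n y) ∧ Corresponds φ W n σ := by
  obtain ⟨n, hn, hnσ⟩ := hφ.exists_section hW hσ.anti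
  refine ⟨n, fun x hx => ?_, hn, hnσ⟩
  obtain ⟨U, hU, hxU, e, he⟩ := hN x
  have hUW := hU.inter hW
  have he' : ∀ y ∈ U ∩ W, N.HolAt e y := fun y hy => he.holAt_self hU hy.1
  obtain ⟨s, hs, hes⟩ := hφ.exists_anti hτ hUW he'
  -- A local frame `e` of `N` corresponds to some multiple `k • σ` of the generator, hence `e = k •
  -- n`. As `e` does not vanish, neither does `k`, and `n` is a frame too.
  obtain ⟨k, hk, hkσ⟩ := hσ.gen x hx (U ∩ W) hUW ⟨hxU, hx⟩ s hs
  have hev : ∀ᶠ y in 𝓝 x, e y = k y • n y := by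
    filter_upwards [LawfulHol.eventually hk, hUW.mem_nhds ⟨hxU, hx⟩,
      eventually_eventually_nhds.2 (eventually_comap.1 hkσ)] with y h1 h2 h3
    exact hφ.eq_smul hN hUW he' (fun y hy => hn y hy.2) hes
      (fun V hV => hnσ V (hV.trans Set.inter_subset_right)) h2 h1 (eventually_comap.2 h3)
  have hk0 : k x ≠ 0 := fun h0 => he.ne_zero hxU (by rw [hev.self_of_nhds, h0, zero_smul])
  refine Family.IsFrameOn.of_change (U := {x}) (he.mono (by simpa using hxU)) ?_ x rfl
  rintro _ rfl
  refine ⟨_, LawfulHol.inv hk hk0, inv_ne_zero hk0, ?_⟩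
  filter_upwards [hev, (LawfulHol.continuousAt hk).eventually_ne hk0] with y h1 h2
  rw [h1, smul_smul, inv_mul_cancel₀ h2, one_smul]

end Iso

/-! ### Anti-invariant sections of an invariant line bundle -/

/-- An invariant frame reduces the anti-invariant sections of a line bundle to those of the
trivial bundle. -/
theorem IsAntiFrameOn.smul_frame (hpr : Continuous pr) (hτ : ∀ z, pr (τ z) = pr z)
    (hE : E.IsLineBundle) {W : Set Y} (hW : IsOpen W) {t : Z → ℂ}
    (ht : IsAntiFrameOn pr τ (Family.trivial Z) (fun _ => (LinearMap.id : ℂ →ₗ[ℂ] ℂ)) W t)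
    {ε : ∀ z, E.Fiber z} (hε : E.IsFrameOn (pr ⁻¹' W) ε)
    (hinv : ∀ z, pr z ∈ W → ε (τ z) = θ z (ε z)) :
    IsAntiFrameOn pr τ E θ W (fun z => t z • ε z) := by
  have hWo := hW.preimage hpr
  refine ⟨⟨fun z hz => hE.smul (ht.anti.1 z hz) (hε.holAt_self hWo hz), fun z hz => ?_⟩, ?_, ?_⟩
  · have h : t (τ z) = -t z := ht.anti.2 z hz
    simp only [h, hinv z hz, map_smul, neg_smul]
  · intro y hy V hV hyV s hs
    obtain ⟨f, hf, hfh⟩ := hε.exists_coeff hWo s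
    -- Because the frame is invariant, the anti-invariance of the section passes to its coefficient.
    have hfa : IsAntiOn pr τ (Family.trivial Z) (fun _ => (LinearMap.id : ℂ →ₗ[ℂ] ℂ)) (V ∩ W) f := by
      refine ⟨fun z hz => (hfh z hz.2).1 (hs.1 z hz.1), fun z hz => ?_⟩
      have hz' : τ z ∈ pr ⁻¹' W := by rw [Set.mem_preimage, hτ]; exact hz.2
      have h1 := hs.2 z hz.1
      rw [hf _ hz', hf z hz.2, map_smul, ← hinv z hz.2, ← neg_smul] at h1
      exact Family.smul_left_inj (hε.ne_zero hz') h1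
    obtain ⟨k, hk, hkt⟩ := ht.gen y hy (V ∩ W) (hV.inter hW) ⟨hyV, hy⟩ f hfa
    refine ⟨k, hk, ?_⟩
    filter_upwards [hkt, tendsto_comap.eventually (hW.mem_nhds hy)] with z h1 h2
    have h1 : f z = k (pr z) * t z := h1
    rw [hf z h2, h1, mul_smul]
  · intro y hy k k' hk hk' h
    refine ht.uniq y hy k k' hk hk' ?_
    filter_upwards [h, tendsto_comap.eventually (hW.mem_nhds hy)] with z h1 h2
    rw [smul_smul, smul_smul] at h1
    exact Family.smul_left_inj (hε.ne_zero h2) h1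

end AntiInvariant

/-! ### Gluing local generators into a line bundle -/

section Existence

set_option linter.unusedSectionVars false

variable {Z : Type u} {Y : Type w} [TopologicalSpace Z] [HolSpace Z] [LawfulHol Z]
  [TopologicalSpace Y] [HolSpace Y] [LawfulHol Y]
  {pr : Z → Y} {τ : Z → Z} {E : Family.{u, v} Z} {θ : ∀ z, E.Fiber z →ₗ[ℂ] E.Fiber (τ z)}
  {W : Y → Set Y} {σ : ∀ _ : Y, ∀ z, E.Fiber z}

/-- The family with fibres `ℂ` whose sections are given, locally, by holomorphic multiples of the
functions `κ x`. -/
def glued (κ : Y → Y → ℂ) : Family.{w, v'} Y where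
  Fiber _ := ULift.{v'} ℂ
  HolAt s x := ∃ f : Y → ℂ, HolSpace.HolAt f x ∧ ∀ᶠ y in 𝓝 x, (s y).down = f y * κ x y

/-- Here `κ x y` records only the value at `y` of the factor expressing the generator at `x` by the
generator at `y`. No overall choice of holomorphic transition functions is needed. -/
theorem exists_transition (hW : ∀ x, IsOpen (W x)) (hx : ∀ x, x ∈ W x)
    (hσ : ∀ x, IsAntiFrameOn pr τ E θ (W x) (σ x)) :
    ∃ κ : Y → Y → ℂ, ∀ x, ∀ y ∈ W x, ∃ k : Y → ℂ, HolSpace.HolAt k y ∧ k y = κ x y ∧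
      ∀ᶠ z in comap pr (𝓝 y), σ x z = k (pr z) • σ y z := by
  have : ∀ x y, ∃ c : ℂ, y ∈ W x → ∃ k : Y → ℂ, HolSpace.HolAt k y ∧ k y = c ∧
      ∀ᶠ z in comap pr (𝓝 y), σ x z = k (pr z) • σ y z := by
    intro x y
    by_cases hy : y ∈ W x
    · obtain ⟨k, hk, h⟩ := (hσ y).gen y (hx y) (W x) (hW x) hy (σ x) (hσ x).anti
      exact ⟨k y, fun _ => ⟨k, hk, rfl, h⟩⟩
    · exact ⟨0, fun h => absurd h hy⟩
  choose κ hκ using this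
  exact ⟨κ, fun x y => hκ x y⟩

section Transition

variable {κ : Y → Y → ℂ} (hW : ∀ x, IsOpen (W x)) (hx : ∀ x, x ∈ W x)
    (hσ : ∀ x, IsAntiFrameOn pr τ E θ (W x) (σ x))
    (hκ : ∀ x, ∀ y ∈ W x, ∃ k : Y → ℂ, HolSpace.HolAt k y ∧ k y = κ x y ∧
      ∀ᶠ z in comap pr (𝓝 y), σ x z = k (pr z) • σ y z)

include hx hσ hκ in
/-- If `S = k σ_x` near `x`, then `S = κ σ_y` near each `y` near `x`, with `κ = k κ_x` at `y`. -/
theorem eventually_transition (hW : ∀ x, IsOpen (W x)) {S : ∀ z, E.Fiber z} {x : Y} {k : Y → ℂ}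
    (hk : HolSpace.HolAt k x) (hS : ∀ᶠ z in comap pr (𝓝 x), S z = k (pr z) • σ x z) :
    ∀ᶠ y in 𝓝 x, ∀ m : Y → ℂ, HolSpace.HolAt m y →
      (∀ᶠ z in comap pr (𝓝 y), S z = m (pr z) • σ y z) → m y = k y * κ x y := by
  filter_upwards [LawfulHol.eventually hk, (hW x).mem_nhds (hx x),
    eventually_eventually_nhds.2 (eventually_comap.1 hS)] with y h1 h2 h3 m hm hmS
  obtain ⟨l, hl, hly, hlσ⟩ := hκ x y h2
  rw [← hly]
  refine (hσ y).uniq y (hx y) m _ hm (LawfulHol.mul h1 hl) ?_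
  filter_upwards [hmS, eventually_comap.2 h3, hlσ] with z k1 k2 k3
  rw [← k1, k2, k3, smul_smul]

-- This is the cocycle relation: for fixed `x` and `x'`, the two gluing functions have a holomorphic
-- ratio. It is nonzero at `x'` because the generators are multiples of each other and coefficients
-- are unique.
include hW hx hσ hκ in
theorem eventually_transition_mul {x x' : Y} (h : x' ∈ W x) : ∃ k : Y → ℂ, HolSpace.HolAt k x' ∧
    k x' ≠ 0 ∧ ∀ᶠ y in 𝓝 x', κ x y = k y * κ x' y := by
  obtain ⟨k, hk, hkx, hkσ⟩ := hκ x x' h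
  refine ⟨k, hk, fun h0 => ?_, ?_⟩
  · obtain ⟨m, hm, hmσ⟩ := (hσ x).gen x' h (W x') (hW x') (hx x') (σ x') (hσ x').anti
    have := (hσ x').uniq x' (hx x') _ _ (LawfulHol.mul hm hk) (LawfulHol.const 1 x') (by
      filter_upwards [hmσ, hkσ] with z h1 h2
      rw [mul_smul, ← h2, ← h1, one_smul])
    simp [h0] at this
  · filter_upwards [eventually_transition hx hσ hκ hW hk hkσ, (hW x).mem_nhds h] with y h1 h2
    obtain ⟨m, hm, hmy, hmσ⟩ := hκ x y h2
    rw [← h1 m hm hmσ, hmy]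

include hW hx hσ hκ in
theorem transition_self (x : Y) : κ x x = 1 := by
  obtain ⟨m, hm, hmy, hmσ⟩ := hκ x x (hx x)
  rw [← hmy]
  refine (hσ x).uniq x (hx x) m (fun _ => 1) hm (LawfulHol.const 1 x) ?_
  filter_upwards [hmσ] with z h1
  rw [← h1, one_smul]

include hW hx hσ hκ in
theorem isFrameOn_glued (x : Y) :
    (glued.{w, v'} κ).IsFrameOn (W x) (fun y => ULift.up (κ x y)) := by
  intro x' h
  obtain ⟨k, hk, hk0, hkκ⟩ := eventually_transition_mul hW hx hσ hκ h
  have h0 : κ x x' ≠ 0 := by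
    rw [hkκ.self_of_nhds, transition_self hW hx hσ hκ, mul_one]
    exact hk0
  refine ⟨⟨fun hh => h0 (congrArg ULift.down hh), fun a => ⟨a.down / κ x x', ?_⟩⟩, fun s => ⟨?_, ?_⟩⟩
  · refine ULift.ext _ _ ?_
    exact (div_mul_cancel₀ _ h0).symm
  · rintro ⟨f, hf, hs⟩
    refine ⟨_, LawfulHol.mul hf (LawfulHol.inv hk hk0), ?_⟩
    filter_upwards [hs, hkκ, (LawfulHol.continuousAt hk).eventually_ne hk0] with y h1 h2 h3
    refine ULift.ext _ _ ?_
    change (s y).down = f y * (k y)⁻¹ * κ x y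
    rw [h1, h2, mul_assoc, inv_mul_cancel_left₀ h3]
  · rintro ⟨f, hf, hs⟩
    refine ⟨_, LawfulHol.mul hf hk, ?_⟩
    filter_upwards [hs, hkκ] with y h1 h2
    have h3 : (s y).down = f y * κ x y := congrArg ULift.down h1
    rw [h3, h2, mul_assoc]

variable (pr σ) in
/-- The section of `E` given by a section of the glued bundle. -/
def gluedSection {κ : Y → Y → ℂ} (s : ∀ y, (glued.{w, v'} κ).Fiber y) (z : Z) : E.Fiber z :=
  (s (pr z)).down • σ (pr z) z

-- Over each point `y` the glued section uses the generator attached to `y` itself. The factor `κ x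
-- y` converts it to the single generator at `x`, where holomorphy can be seen.
include hW hx hσ hκ in
theorem gluedSection_eq {s : ∀ y, (glued.{w, v'} κ).Fiber y} {x : Y} {f : Y → ℂ}
    (hs : ∀ᶠ y in 𝓝 x, (s y).down = f y * κ x y) :
    ∀ᶠ z in comap pr (𝓝 x), gluedSection pr σ s z = f (pr z) • σ x z := by
  filter_upwards [tendsto_comap.eventually (hs.and ((hW x).mem_nhds (hx x)))] with z hz
  obtain ⟨k, hk, hky, hkσ⟩ := hκ x (pr z) hz.2
  rw [gluedSection, hz.1, mul_smul, ← hky, ← ((eventually_comap.1 hkσ).self_of_nhds z rfl)]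

include hW hx hσ hκ in
theorem isAntiOn_gluedSection (hpr : Continuous pr) (hτ : ∀ z, pr (τ z) = pr z)
    (hol : ∀ {f : Y → ℂ} {z : Z}, HolSpace.HolAt f (pr z) → HolSpace.HolAt (fun z => f (pr z)) z)
    (hE : E.IsLineBundle) {V : Set Y} {s : ∀ y, (glued.{w, v'} κ).Fiber y}
    (hs : ∀ y ∈ V, (glued κ).HolAt s y) : IsAntiOn pr τ E θ V (gluedSection pr σ s) := by
  constructor
  · intro z hz
    obtain ⟨f, hf, hfs⟩ := hs _ hz
    refine hE.congr (hE.smul (hol hf) ((hσ (pr z)).anti.1 z (hx _))) ?_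
    have := gluedSection_eq hW hx hσ hκ hfs
    filter_upwards [hpr.continuousAt.tendsto.le_comap this] with z' hz'
    exact hz'.symm
  · intro z hz
    rw [gluedSection, gluedSection]
    have h2 := (hσ (pr z)).anti.2 z (hx _)
    have h3 : ∀ y, y = pr z → (s y).down • σ y (τ z) = -θ z ((s (pr z)).down • σ (pr z) z) := by
      rintro y rfl
      rw [h2, map_smul, smul_neg]
    exact h3 _ (hτ z)

include hW hx hσ hκ in
theorem gluedSection_injective {V : Set Y} (hV : IsOpen V)
    {s t : ∀ y, (glued.{w, v'} κ).Fiber y}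
    (hs : ∀ y ∈ V, (glued κ).HolAt s y) (ht : ∀ y ∈ V, (glued κ).HolAt t y)
    (h : ∀ z, pr z ∈ V → gluedSection pr σ s z = gluedSection pr σ t z) : ∀ y ∈ V, s y = t y := by
  intro y hy
  obtain ⟨f, hf, hfs⟩ := hs y hy
  obtain ⟨g, hg, hgt⟩ := ht y hy
  refine ULift.ext _ _ ?_
  rw [hfs.self_of_nhds, hgt.self_of_nhds]
  congr 1
  refine (hσ y).uniq y (hx y) f g hf hg ?_
  filter_upwards [gluedSection_eq hW hx hσ hκ hfs, gluedSection_eq hW hx hσ hκ hgt,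
    tendsto_comap.eventually (hV.mem_nhds hy)] with z h1 h2 h3
  rw [← h1, ← h2, h z h3]

include hW hx hσ hκ in
theorem exists_gluedSection {V : Set Y} (hV : IsOpen V) {S : ∀ z, E.Fiber z}
    (hS : IsAntiOn pr τ E θ V S) : ∃ s : ∀ y, (glued.{w, v'} κ).Fiber y,
      (∀ y ∈ V, (glued κ).HolAt s y) ∧ ∀ z, pr z ∈ V → gluedSection pr σ s z = S z := by
  have : ∀ y, ∃ c : ULift.{v'} ℂ, y ∈ V → ∃ k : Y → ℂ, HolSpace.HolAt k y ∧ k y = c.down ∧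
      ∀ᶠ z in comap pr (𝓝 y), S z = k (pr z) • σ y z := by
    intro y
    by_cases hy : y ∈ V
    · obtain ⟨k, hk, h⟩ := (hσ y).gen y (hx y) V hV hy S hS
      exact ⟨⟨k y⟩, fun _ => ⟨k, hk, rfl, h⟩⟩
    · exact ⟨0, fun h => absurd h hy⟩
  choose s hs using this
  refine ⟨s, fun y hy => ?_, fun z hz => ?_⟩
  · obtain ⟨k, hk, hky, hkS⟩ := hs y hy
    refine ⟨k, hk, ?_⟩
    filter_upwards [eventually_transition hx hσ hκ hW hk hkS, hV.mem_nhds hy] with y' h1 h2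
    obtain ⟨m, hm, hmy, hmS⟩ := hs y' h2
    rw [← h1 m hm hmS, hmy]
  · obtain ⟨k, hk, hky, hkS⟩ := hs _ hz
    rw [(eventually_comap.1 hkS).self_of_nhds z rfl, hky]
    rfl

end Transition

/-- The anti-invariant part of the direct image of a line bundle is a line bundle if it is locally
free of rank one. -/
theorem exists_isAntiInvariantPart (hpr : Continuous pr) (hτ : ∀ z, pr (τ z) = pr z)
    (hol : ∀ {f : Y → ℂ} {z : Z}, HolSpace.HolAt f (pr z) → HolSpace.HolAt (fun z => f (pr z)) z)
    (hE : E.IsLineBundle)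
    (h : ∀ x, ∃ (W : Set Y) (σ : ∀ z, E.Fiber z), IsOpen W ∧ x ∈ W ∧ IsAntiFrameOn pr τ E θ W σ) :
    ∃ N : Family.{w, v'} Y, N.IsLineBundle ∧ IsAntiInvariantPart pr τ E θ N := by
  choose W σ hW hx hσ using h
  obtain ⟨κ, hκ⟩ := exists_transition hW hx hσ
  have hN : (glued.{w, v'} κ).IsLineBundle :=
    fun x => ⟨W x, hW x, hx x, _, isFrameOn_glued hW hx hσ hκ x⟩
  have hsec : ∀ (U : Opens Y) (r : (glued.{w, v'} κ).Sec U), IsAntiOn pr τ E θ U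
      (gluedSection pr σ r.2.choose) := fun U r =>
    isAntiOn_gluedSection hW hx hσ hκ hpr hτ hol hE r.2.choose_spec.1
  let φ : ∀ U : Opens Y, (glued.{w, v'} κ).Sec U → AntiSec pr τ E θ U := fun U r =>
    (hsec U r).toAntiSec
  -- The value depends only on the section over `U`, not on the extension chosen to define it; this
  -- gives linearity and compatibility with restrictions.
  have hφ : ∀ (U : Opens Y) (r : (glued.{w, v'} κ).Sec U) (z : {z : Z // pr z ∈ U}),
      (φ U r).1 z = (r.1 ⟨pr z.1, z.2⟩).down • σ (pr z.1) z.1 := fun U r z => by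
    change (r.2.choose (pr z.1)).down • σ (pr z.1) z.1 = _
    rw [r.2.choose_spec.2 ⟨pr z.1, z.2⟩]
  have hbij : ∀ U, Function.Bijective (φ U) := by
    refine fun U => ⟨fun r s hrs => ?_, fun A => ?_⟩
    · refine Subtype.ext (funext fun y => ?_)
      rw [r.2.choose_spec.2, s.2.choose_spec.2]
      refine gluedSection_injective hW hx hσ hκ U.2 r.2.choose_spec.1 s.2.choose_spec.1
        (fun z hz => ?_) y y.2
      exact congrFun (congrArg Subtype.val hrs) ⟨z, hz⟩
    · obtain ⟨S, hS, hA⟩ := A.exists_isAntiOn hτ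
      obtain ⟨s, hs, h⟩ := exists_gluedSection hW hx hσ hκ U.2 hS
      refine ⟨Family.toSec s hs, Subtype.ext (funext fun z => ?_)⟩
      rw [hφ, hA, ← h z.1 z.2]
      rfl
  refine ⟨glued κ, hN, fun U => Equiv.ofBijective _ (hbij U), ?_, ?_, ?_⟩
  · intro U r s t hr z
    simp only [Equiv.ofBijective_apply, hφ, hr]
    exact add_smul _ _ _
  · intro U f hf s t ht z
    simp only [Equiv.ofBijective_apply, hφ, ht]
    exact mul_smul _ _ _
  · intro U V hUV s t ht z
    simp only [Equiv.ofBijective_apply, hφ, ht]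

end Existence

/-! ### Norms -/

set_option linter.unusedSectionVars false

section PiTensor

variable {ι : Type*} [Finite ι] {M : ι → Type*} [∀ i, AddCommGroup (M i)] [∀ i, Module ℂ (M i)]

theorem tprod_smul_finprod (g : ι → ℂ) (m : ∀ i, M i) :
    PiTensorProduct.tprod ℂ (fun i => g i • m i) =
      (∏ᶠ i, g i) • PiTensorProduct.tprod ℂ m := by
  have := Fintype.ofFinite ι
  rw [MultilinearMap.map_smul_univ, finprod_eq_prod_of_fintype]

/-- A tensor product of lines is a line, generated by the product of the generators. -/
theorem exists_piTensor_equiv {m : ∀ i, M i} (h0 : ∀ i, m i ≠ 0)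
    (hm : ∀ i, ∀ a : M i, ∃ c : ℂ, a = c • m i) :
    ∃ φ : PiTensorProduct ℂ M ≃ₗ[ℂ] ℂ, φ (PiTensorProduct.tprod ℂ m) = 1 := by
  classical
  have := Fintype.ofFinite ι
  have : ∀ i, ∃ φ : M i ≃ₗ[ℂ] ℂ, φ (m i) = 1 := fun i => by
    have hb : Function.Bijective (LinearMap.toSpanSingleton ℂ (M i) (m i)) := by
      refine ⟨smul_left_injective ℂ (h0 i), fun a => ?_⟩
      obtain ⟨c, hc⟩ := hm i a
      exact ⟨c, hc.symm⟩
    refine ⟨(LinearEquiv.ofBijective _ hb).symm, ?_⟩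
    rw [LinearEquiv.symm_apply_eq]
    simp
  choose φ hφ using this
  refine ⟨(PiTensorProduct.congr φ).trans (PiTensorProduct.constantBaseRingEquiv ι ℂ).toLinearEquiv, ?_⟩
  simp [PiTensorProduct.congr_tprod, hφ]

end PiTensor

section NormCriterion

variable {Z : Type u} {Y : Type w} [TopologicalSpace Z] [HolSpace Z] [LawfulHol Z]
  [TopologicalSpace Y] [HolSpace Y] [LawfulHol Y] {pr : Z → Y} {E : Family.{u, v} Z}

/-- The points of the fibre of `pr`, repeated according to multiplicity. -/
abbrev FiberIndex (pr : Z → Y) (y : Y) : Type u := Σ x : {x : Z // pr x = y}, Fin (mult pr x.1)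

/-- The norm of a section. -/
def normSection (pr : Z → Y) (e : ∀ z, E.Fiber z) (y : Y) : (norm pr E).Fiber y :=
  PiTensorProduct.tprod ℂ (fun i : FiberIndex pr y => e i.1.1)

theorem normSection_congr {e e' : ∀ z, E.Fiber z} {y : Y} (h : ∀ z, pr z = y → e z = e' z) :
    normSection pr e y = normSection pr e' y :=
  congrArg (PiTensorProduct.tprod ℂ) (funext fun i => h _ i.1.2)

theorem normSection_smul [∀ y, Finite (FiberIndex pr y)] (g : Z → ℂ) (e : ∀ z, E.Fiber z) (y : Y) :
    normSection pr (fun z => g z • e z) y =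
      (∏ᶠ i : FiberIndex pr y, g i.1.1) • normSection pr e y :=
  tprod_smul_finprod _ _

theorem exists_norm_equiv [∀ y, Finite (FiberIndex pr y)] {V : Set Y} {e : ∀ z, E.Fiber z}
    (he : E.IsFrameOn (pr ⁻¹' V) e) {y : Y} (hy : y ∈ V) :
    ∃ φ : (norm pr E).Fiber y ≃ₗ[ℂ] ℂ, φ (normSection pr e y) = 1 := by
  have h : ∀ i : FiberIndex pr y, i.1.1 ∈ pr ⁻¹' V := fun i => by
    rw [Set.mem_preimage, i.1.2]
    exact hy
  exact exists_piTensor_equiv (m := fun i : FiberIndex pr y => e i.1.1)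
    (fun i => he.ne_zero (h i)) (fun i => he.span (h i))

/-- The norm of a line bundle is trivial if it is trivialized, compatibly, over the members of an
open cover. -/
theorem norm_iso_trivial [∀ y, Finite (FiberIndex pr y)] (hpr : Continuous pr)
    (hprod : ∀ V : Set Y, IsOpen V → ∀ g : Z → ℂ, (∀ z ∈ pr ⁻¹' V, HolSpace.HolAt g z) →
      ∀ y ∈ V, HolSpace.HolAt (fun y => ∏ᶠ i : FiberIndex pr y, g i.1.1) y)
    {ι : Type*} {V : ι → Set Y} (hV : ∀ i, IsOpen (V i)) (hc : ∀ y, ∃ i, y ∈ V i)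
    {e : ι → ∀ z, E.Fiber z} (he : ∀ i, E.IsFrameOn (pr ⁻¹' V i) (e i)) {c : ι → Y → ℂ}
    (hol : ∀ i, ∀ y ∈ V i, HolSpace.HolAt (c i) y) (h0 : ∀ i, ∀ y ∈ V i, c i y ≠ 0)
    (hcompat : ∀ i j, ∀ y ∈ V i, y ∈ V j →
      c j y • normSection pr (e i) y = c i y • normSection pr (e j) y) :
    (norm pr E).Iso (Family.trivial Y) := by
  -- The isomorphism at `y` sends the norm of the frame `e j` to `c j y`; by `hcompat` the same
  -- isomorphism serves every `j` with `y ∈ V j`.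
  have : ∀ y, ∃ φ : (norm pr E).Fiber y ≃ₗ[ℂ] ℂ, ∀ j, y ∈ V j → ∀ t : ℂ,
      φ (t • normSection pr (e j) y) = t * c j y := by
    intro y
    obtain ⟨i, hi⟩ := hc y
    obtain ⟨φ, hφ⟩ := exists_norm_equiv (he i) hi
    refine ⟨φ.trans (LinearEquiv.smulOfNeZero ℂ ℂ (c i y) (h0 i y hi)), fun j hj t => ?_⟩
    have := congrArg φ (hcompat i j y hi hj)
    rw [map_smul, map_smul, hφ, smul_eq_mul, mul_one] at this
    rw [LinearEquiv.trans_apply, map_smul, map_smul, smul_eq_mul]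
    exact congrArg (t * ·) this.symm
  choose φ hφ using this
  refine ⟨φ, fun S y => ⟨?_, fun hS => ?_⟩⟩
  · rintro ⟨V', hV', hyV', e', he', f, hf, hS⟩
    obtain ⟨j, hj⟩ := hc y
    have hVo := (hV j).inter hV'
    obtain ⟨g, hg⟩ := ((he j).mono (Set.preimage_mono Set.inter_subset_left)).exists_change
      (he'.mono (Set.preimage_mono Set.inter_subset_right)) (hVo.preimage hpr)
    have hp := hprod _ hVo g (fun z hz => (hg z hz).2.1) y ⟨hj, hyV'⟩
    refine LawfulHol.congr (LawfulHol.mul hf (LawfulHol.mul hp (hol j y hj))) ?_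
    filter_upwards [hS, hVo.mem_nhds ⟨hj, hyV'⟩] with y' h1 h2
    have h3 : normSection pr e' y' =
        (∏ᶠ i : FiberIndex pr y', g i.1.1) • normSection pr (e j) y' := by
      rw [← normSection_smul]
      exact normSection_congr fun z hz => (hg z (by rw [Set.mem_preimage, hz]; exact h2)).1
    have h4 : S y' = f y' • normSection pr e' y' := h1
    rw [h4, h3, smul_smul]
    exact ((hφ y' j h2.1 _).trans (mul_assoc _ _ _)).symm
  · obtain ⟨j, hj⟩ := hc y
    refine ⟨V j, hV j, hj, e j, he j, _, LawfulHol.mul hS (LawfulHol.inv (hol j y hj) (h0 j y hj)), ?_⟩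
    filter_upwards [(hV j).mem_nhds hj] with y' h1
    refine (φ y').injective ?_
    refine Eq.trans ?_ (hφ y' j h1 _).symm
    exact (inv_mul_cancel_right₀ (h0 j y' h1) _).symm

/-- A trivialization of the norm of a line bundle, in terms of local frames. -/
theorem exists_norm_frames (h : (norm pr E).Iso (Family.trivial Y)) :
    ∃ s : ∀ y, (norm pr E).Fiber y, ∀ y, ∀ V₀ ∈ 𝓝 y, ∃ V : Set Y, IsOpen V ∧ y ∈ V ∧ V ⊆ V₀ ∧
      ∃ e : ∀ z, E.Fiber z, E.IsFrameOn (pr ⁻¹' V) e ∧ ∃ f : Y → ℂ,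
        ∀ y ∈ V, HolSpace.HolAt f y ∧ f y ≠ 0 ∧ s y = f y • normSection pr e y := by
  obtain ⟨φ, hφ⟩ := h
  let s : ∀ y, (norm pr E).Fiber y := fun y => (φ y).symm (1 : ℂ)
  have hs : ∀ y, s y ≠ 0 := fun y h => one_ne_zero (α := ℂ)
    ((LinearEquiv.map_eq_zero_iff (φ y).symm).1 h)
  refine ⟨s, fun y V₀ hV₀ => ?_⟩
  have hhol : (norm pr E).HolAt s y := by
    rw [hφ]
    have : (fun y => φ y (s y)) = fun _ => (1 : ℂ) := funext fun y => (φ y).apply_symm_apply _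
    rw [this]
    exact LawfulHol.const 1 y
  -- By definition a holomorphic section of the norm is written in a frame of `E` over a whole
  -- preimage `pr ⁻¹' V'`. This is where frames over preimages of open sets of the base come from.
  obtain ⟨V', hV', hyV', e, he, f, hf, hsf⟩ := hhol
  have hsf' : ∀ᶠ y' in 𝓝 y, s y' = f y' • normSection pr e y' := hsf
  obtain ⟨V, hV, hVo, hyV⟩ := eventually_nhds_iff.1
    ((LawfulHol.eventually hf).and (hsf'.and (inter_mem (hV'.mem_nhds hyV') hV₀)))
  refine ⟨V, hVo, hyV, fun y' h => (hV y' h).2.2.2, e,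
    he.mono fun z hz => (hV _ hz).2.2.1, f, fun y' h => ⟨(hV y' h).1, fun h0 => ?_, (hV y' h).2.1⟩⟩
  exact hs y' (by rw [(hV y' h).2.1, h0, zero_smul])

end NormCriterion

/-! ### Anti-invariant functions on `(S ×_X S)_0` -/

section Curve

set_option linter.unusedSectionVars false

variable {X : Type u} [TopologicalSpace X] [ChartedSpace ℂ X] [IsManifold 𝓘(ℂ, ℂ) ω X]

/-- The function relating the fibre coordinates of two charts. -/
def crdChange (x₀ x₁ x : X) : ℂ := crd x₁ (pt x₀ x 1)

theorem crd_eq_crdChange_mul {x₀ x₁ : X} {p : TotK X} (hp : p.proj ∈ (chartAt ℂ x₀).source) :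
    crd x₁ p = crdChange x₀ x₁ p.proj * crd x₀ p := by
  obtain ⟨⟨x, η⟩, rfl⟩ : {p' // p' = p} := ⟨p, rfl⟩
  obtain ⟨c, hc⟩ := exists_smul_coordVec hp (coordVec x₁ x)
  have h : ∀ p : TotK X, p.proj = x → crd x₁ p = c * crd x₀ p := by
    rintro ⟨_, η⟩ rfl
    simp only [crd, hc, map_smul, smul_eq_mul]
  rw [h ⟨x, η⟩ rfl, crdChange, h _ (proj_pt hp 1), crd_pt hp, mul_one]

theorem holAt_crdChange {x₀ x₁ x : X} (h₀ : x ∈ (chartAt ℂ x₀).source)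
    (h₁ : x ∈ (chartAt ℂ x₁).source) : HolSpace.HolAt (crdChange x₀ x₁) x := by
  have : ∀ᶠ x' in 𝓝 x, x' ∈ (chartAt ℂ x₀).source ∧ x' ∈ (chartAt ℂ x₁).source :=
    inter_mem ((chartAt ℂ x₀).open_source.mem_nhds h₀) ((chartAt ℂ x₁).open_source.mem_nhds h₁)
  have hd : ∀ᶠ x' in 𝓝 x, MDifferentiableAt 𝓘(ℂ, ℂ) 𝓘(ℂ, ℂ)
      (fun x => crd x₁ (chartPt x₀ (chartAt ℂ x₀ x, 1))) x' := by
    filter_upwards [this] with x' hx'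
    have m1 : MDifferentiableAt 𝓘(ℂ, ℂ) 𝓘(ℂ, ℂ × ℂ) (fun x => (chartAt ℂ x₀ x, (1 : ℂ))) x' :=
      (mdifferentiableAt_atlas (chart_mem_atlas ℂ x₀) hx'.1).prodMk_space mdifferentiableAt_const
    have m2 := (mdifferentiableAt_chartPt (x₀ := x₀) (w := (chartAt ℂ x₀ x', (1 : ℂ)))
      ((chartAt ℂ x₀).map_source hx'.1)).comp x' m1
    refine MDifferentiableAt.comp x' (mdifferentiableAt_crd ?_) m2
    simp only [chartPt]
    rw [(chartAt ℂ x₀).left_inv hx'.1, proj_pt hx'.1]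
    exact hx'.2
  refine LawfulHol.congr (f := fun x => crd x₁ (chartPt x₀ (chartAt ℂ x₀ x, 1))) hd ?_
  filter_upwards [this] with x' hx'
  simp only [chartPt, crdChange]
  rw [(chartAt ℂ x₀).left_inv hx'.1]

namespace HitchinBase

variable {a : HitchinBase X}

/-- Removing the common root `r₁` leaves the same cubic on both sides, and `s₂` is one of its roots.
-/
theorem Fac.mem_of_common {x₀ x : X} {r₁ r₂ r₃ r₄ s₂ s₃ s₄ : ℂ} (h : a.Fac x₀ x r₁ r₂ r₃ r₄)
    (h' : a.Fac x₀ x r₁ s₂ s₃ s₄) : s₂ = r₂ ∨ s₂ = r₃ ∨ s₂ = r₄ := by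
  obtain ⟨e1, e2, e3, -⟩ := quartic_factor_iff.1 (a.fac_iff.1 h)
  obtain ⟨f1, f2, f3, -⟩ := quartic_factor_iff.1 (a.fac_iff.1 h')
  have g1 : r₂ + r₃ + r₄ = s₂ + s₃ + s₄ := by linear_combination e1 - f1
  have g2 : r₂ * r₃ + r₂ * r₄ + r₃ * r₄ = s₂ * s₃ + s₂ * s₄ + s₃ * s₄ := by
    linear_combination f2 - e2 - r₁ * g1
  have g3 : r₂ * r₃ * r₄ = s₂ * s₃ * s₄ := by
    linear_combination e3 - f3 - r₁ * g2
  have : (s₂ - r₂) * ((s₂ - r₃) * (s₂ - r₄)) = 0 := by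
    linear_combination -s₂ ^ 2 * g1 + s₂ * g2 - g3
  rcases mul_eq_zero.1 this with h | h
  · exact Or.inl (sub_eq_zero.1 h)
  · exact Or.inr ((mul_eq_zero.1 h).imp sub_eq_zero.1 sub_eq_zero.1)

variable [T2Space X]

theorem e_eq_crdChange_mul {x₀ x₁ : X} {q : a.SS} (hq : a.base q ∈ (chartAt ℂ x₀).source) :
    a.e₁ x₁ q = crdChange x₀ x₁ (a.base q) * a.e₁ x₀ q ∧
      a.e₂ x₁ q = crdChange x₀ x₁ (a.base q) * a.e₂ x₀ q := by
  refine ⟨crd_eq_crdChange_mul hq, ?_⟩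
  rw [← a.proj_p₂ q]
  exact crd_eq_crdChange_mul (by rw [← a.proj_p₂ q] at hq; exact hq)

/-- Near a ramified point, the two roots are `u ± √d`. -/
theorem IsGeneric.exists_sqrt (ha : a.IsGeneric) {q₀ : a.SS}
    (h : a.e₁ (a.base q₀) q₀ = a.e₂ (a.base q₀) q₀) :
    ∃ u d : ℂ → ℂ, AnalyticAt ℂ u (chartAt ℂ (a.base q₀) (a.base q₀)) ∧
      AnalyticAt ℂ d (chartAt ℂ (a.base q₀) (a.base q₀)) ∧
      u (chartAt ℂ (a.base q₀) (a.base q₀)) = a.e₁ (a.base q₀) q₀ ∧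
      d (chartAt ℂ (a.base q₀) (a.base q₀)) = 0 ∧
      (∀ᶠ z in 𝓝[≠] (chartAt ℂ (a.base q₀) (a.base q₀)), d z ≠ 0) ∧
      ∀ᶠ q in 𝓝 q₀, ∃ w : ℂ, w ^ 2 = d (chartAt ℂ (a.base q₀) (a.base q)) ∧
        a.e₁ (a.base q₀) q = u (chartAt ℂ (a.base q₀) (a.base q)) + w ∧
        a.e₂ (a.base q₀) q = u (chartAt ℂ (a.base q₀) (a.base q)) - w := by
  set x₀ := a.base q₀
  have hx₀ : a.base q₀ ∈ (chartAt ℂ x₀).source := mem_chart_source ℂ _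
  obtain ⟨r₃, r₄, hf⟩ := a.exists_fac hx₀
  rw [← h] at hf
  obtain ⟨h13, h14, h34⟩ := ha.distinct hx₀ hf
  obtain ⟨ρ₃, ρ₄, u, d, hρ₃, hρ₄, hu, hd, e3, e4, hu0, hd0, hev⟩ :=
    a.exists_local_factorization hf h13 h14 h13 h14 h34
  have hd0' : d (chartAt ℂ x₀ x₀) = 0 := by rw [hd0]; ring
  have hu0' : u (chartAt ℂ x₀ x₀) = a.e₁ x₀ q₀ := by rw [hu0]; ring
  refine ⟨u, d, hu, hd, hu0', hd0', ha.eventually_ne_zero hρ₃ hρ₄ hu hd hd0' hev, ?_⟩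
  have hb : Tendsto a.base (𝓝 q₀) (𝓝 x₀) := a.continuous_base.continuousAt
  have hz : Tendsto (fun q => chartAt ℂ x₀ (a.base q)) (𝓝 q₀) (𝓝 (chartAt ℂ x₀ x₀)) :=
    (tendsto_chart x₀).comp hb
  have t3 : Tendsto (fun q => ρ₃ (chartAt ℂ x₀ (a.base q))) (𝓝 q₀) (𝓝 r₃) := by
    rw [← e3]; exact hρ₃.continuousAt.tendsto.comp hz
  have t4 : Tendsto (fun q => ρ₄ (chartAt ℂ x₀ (a.base q))) (𝓝 q₀) (𝓝 r₄) := by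
    rw [← e4]; exact hρ₄.continuousAt.tendsto.comp hz
  have c1 : Tendsto (a.e₁ x₀) (𝓝 q₀) (𝓝 (a.e₁ x₀ q₀)) := a.continuousAt_e₁ hx₀
  have c2 : Tendsto (a.e₂ x₀) (𝓝 q₀) (𝓝 (a.e₁ x₀ q₀)) := by
    rw [h]; exact a.continuousAt_e₂ hx₀
  have key : ∀ {f g : a.SS → ℂ} {s t : ℂ}, Tendsto f (𝓝 q₀) (𝓝 s) → Tendsto g (𝓝 q₀) (𝓝 t) →
      s ≠ t → ∀ᶠ q in 𝓝 q₀, f q ≠ g q := fun hf hg hst =>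
    ((hf.sub hg).eventually_ne (sub_ne_zero.2 hst)).mono fun _ => sub_ne_zero.1
  filter_upwards [hb.eventually hev, hb.eventually (eventually_mem_chart x₀),
    key c1 t3 h13, key c1 t4 h14, key c2 t3 h13, key c2 t4 h14] with q hq hs n1 n2 n3 n4
  obtain ⟨s₃, s₄, hfq⟩ := a.exists_fac (q := q) hs
  have main : ∀ w : ℂ, w ^ 2 = d (chartAt ℂ x₀ (a.base q)) →
      a.e₁ x₀ q = u (chartAt ℂ x₀ (a.base q)) + w →
      a.e₂ x₀ q = u (chartAt ℂ x₀ (a.base q)) - w := by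
    intro w hw h1
    have := hq w hw
    rw [← h1] at this
    rcases this.mem_of_common hfq with h | h | h
    · exact h
    · exact absurd h n3
    · exact absurd h n4
  rcases (hq _ (cpow_half_sq _)).root (a.poly_sc x₀ (a.p₁ q)) with h1 | h1 | h1 | h1
  · exact ⟨_, cpow_half_sq _, h1, main _ (cpow_half_sq _) h1⟩
  -- Here the first root is $u-\sqrt d$, and the other square root of $d$ is taken as `w`.
  · have h2 := (neg_sq (d (chartAt ℂ x₀ (a.base q)) ^ (1 / 2 : ℂ))).trans (cpow_half_sq _)
    have h3 := h1.trans (sub_eq_add_neg _ _)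
    exact ⟨_, h2, h3, main _ h2 h3⟩
  · exact absurd h1 n1
  · exact absurd h1 n2

/-- Anti-invariant functions are divisible by the difference of the two roots. -/
theorem IsGeneric.exists_quotient_of_branch (ha : a.IsGeneric) {q₀ : a.SS}
    (h : a.e₁ (a.base q₀) q₀ = a.e₂ (a.base q₀) q₀) {f : a.SS → ℂ} (hf : HolSpace.HolAt f q₀)
    (hanti : ∀ᶠ q in 𝓝 q₀, f (a.τ q) = -f q) :
    ∃ ψ : ℂ → ℂ, AnalyticAt ℂ ψ (chartAt ℂ (a.base q₀) (a.base q₀)) ∧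
      ∀ᶠ q in 𝓝 q₀, f q = ψ (chartAt ℂ (a.base q₀) (a.base q)) *
        (a.e₁ (a.base q₀) q - a.e₂ (a.base q₀) q) := by
  obtain ⟨u, d, hu, hd, hu0, hd0, hd1, hev⟩ := ha.exists_sqrt h
  set x₀ := a.base q₀
  have hx₀ : a.base q₀ ∈ (chartAt ℂ x₀).source := mem_chart_source ℂ _
  obtain ⟨G, hG, hfG⟩ := exists_cc hx₀ hf
  have hτ : a.τ q₀ = q₀ := SS_ext (x₀ := x₀) (by rwa [base_τ]) (a.base_τ _) h.symm h
  have hτt : Tendsto a.τ (𝓝 q₀) (𝓝 q₀) := by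
    have := a.continuous_τ.tendsto q₀
    rwa [hτ] at this
  set z₀ := chartAt ℂ x₀ x₀
  let κ : ℂ × ℂ → ℂ × ℂ × ℂ := fun w => (w.1, u w.1 + w.2, u w.1 - w.2)
  have hκd : ∀ᶠ w in 𝓝 (z₀, (0 : ℂ)), DifferentiableAt ℂ κ w := by
    have : ∀ᶠ w : ℂ × ℂ in 𝓝 (z₀, (0 : ℂ)), AnalyticAt ℂ u w.1 :=
      (continuousAt_fst (p := (z₀, (0 : ℂ)))).eventually hu.eventually_analyticAt
    filter_upwards [this] with w hw
    have h1 : DifferentiableAt ℂ (fun w : ℂ × ℂ => u w.1) w :=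
      DifferentiableAt.comp (g := u) w hw.differentiableAt differentiableAt_fst
    exact differentiableAt_fst.prodMk
      ((h1.add differentiableAt_snd).prodMk (h1.sub differentiableAt_snd))
  have hκ0 : κ (z₀, 0) = a.cc x₀ q₀ := by
    simp only [κ, cc, hu0, ← h, add_zero, sub_zero]
    rfl
  have hκt : Tendsto κ (𝓝 (z₀, (0 : ℂ))) (𝓝 (a.cc x₀ q₀)) := by
    rw [← hκ0]
    exact hκd.self_of_nhds.continuousAt
  have hnt : Tendsto (fun w : ℂ × ℂ => (w.1, -w.2)) (𝓝 (z₀, (0 : ℂ))) (𝓝 (z₀, (0 : ℂ))) := by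
    have : ContinuousAt (fun w : ℂ × ℂ => (w.1, -w.2)) (z₀, (0 : ℂ)) := by fun_prop
    simpa [ContinuousAt] using this
  have hH : ∀ᶠ w in 𝓝 (z₀, (0 : ℂ)), DifferentiableAt ℂ (fun w => G (κ w)) w := by
    filter_upwards [hκd, hκt.eventually hG] with w h1 h2
    exact DifferentiableAt.comp (g := G) (f := κ) w h2 h1
  have hHo : ∀ᶠ w in 𝓝 (z₀, (0 : ℂ)),
      DifferentiableAt ℂ (fun w => G (κ w) - G (κ (w.1, -w.2))) w := by
    filter_upwards [hH, hnt.eventually hH] with w h1 h2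
    refine h1.sub (DifferentiableAt.comp (g := fun w => G (κ w))
      (f := fun w : ℂ × ℂ => (w.1, -w.2)) w h2 ?_)
    fun_prop
  obtain ⟨ψ, hψ, hψe⟩ := exists_odd_quotient hHo
    (Eventually.of_forall fun w => by simp only [neg_neg, neg_sub]) hd hd0 hd1
  -- The odd function is $G(z,w)-G(z,-w)=2f$, where $w$ is half the difference of the roots; hence
  -- $f=\psi\cdot(\eta_1-\eta_2)/4$.
  refine ⟨fun z => ψ z / 4, hψ.div_const, ?_⟩
  have hb : Tendsto a.base (𝓝 q₀) (𝓝 x₀) := a.continuous_base.continuousAt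
  have hwt : Tendsto (fun q => (chartAt ℂ x₀ (a.base q), (a.e₁ x₀ q - a.e₂ x₀ q) / 2)) (𝓝 q₀)
      (𝓝 (z₀, 0)) := by
    have h0 : (a.e₁ x₀ q₀ - a.e₂ x₀ q₀) / 2 = 0 := by rw [h, sub_self, zero_div]
    refine ((tendsto_chart x₀).comp hb).prodMk_nhds ?_
    rw [← h0]
    exact ((a.continuousAt_e₁ hx₀).sub (a.continuousAt_e₂ hx₀)).div_const 2
  filter_upwards [hev, hanti, hfG, hτt.eventually hfG, hwt.eventually hψe]
    with q ⟨w, hw, h1, h2⟩ k1 k2 k3 k4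
  have hw' : (a.e₁ x₀ q - a.e₂ x₀ q) / 2 = w := by rw [h1, h2]; ring
  rw [hw'] at k4
  have k5 := k4 hw
  have c1 : κ (chartAt ℂ x₀ (a.base q), w) = a.cc x₀ q := by simp only [κ, cc, h1, h2]
  have c2 : κ (chartAt ℂ x₀ (a.base q), -w) = a.cc x₀ (a.τ q) := by
    simp only [κ, cc, e₁_τ, e₂_τ, base_τ, h1, h2, sub_eq_add_neg, neg_neg]
  simp only [c1, c2, ← k2, ← k3, k1] at k5
  rw [h1, h2]
  linear_combination (1 / 2 : ℂ) * k5

end HitchinBase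
end Curve

/-! ### The difference of the roots as generator -/

section Curve

set_option linter.unusedSectionVars false

variable {X : Type u} [TopologicalSpace X] [ChartedSpace ℂ X] [IsManifold 𝓘(ℂ, ℂ) ω X]

namespace HitchinBase

variable {a : HitchinBase X} [T2Space X]

variable (a) in
/-- The projection of `Ŝ₆` to `X`. -/
def base₆ : a.S₆ → X := Quot.lift a.base (by
  rintro q _ rfl
  exact (a.base_τ q).symm)

theorem base₆_πτ (q : a.SS) : a.base₆ (a.πτ q) = a.base q := rfl

theorem continuous_base₆ : Continuous a.base₆ := continuous_quot_lift _ a.continuous_base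

variable (a) in
/-- The difference of the two roots, in a chart. -/
def rootDiff (x₀ : X) (q : a.SS) : ℂ := a.e₁ x₀ q - a.e₂ x₀ q

/-- The fibres of `πτ` are the orbits of `τ`, so neighbourhoods of a fibre are seen at one of its
points and its mirror image. -/
theorem eventually_comap_πτ {p : a.SS → Prop} {q : a.SS} :
    (∀ᶠ q' in comap a.πτ (𝓝 (a.πτ q)), p q') ↔ ∀ᶠ q' in 𝓝 q, p q' ∧ p (a.τ q') := by
  rw [eventually_comap, nhds_πτ, eventually_map]
  refine eventually_congr (Eventually.of_forall fun q' => ⟨fun h => ⟨h _ rfl, h _ (a.πτ_τ q')⟩, ?_⟩)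
  rintro ⟨h1, h2⟩ b hb
  rcases a.πτ_eq_iff.1 hb.symm with rfl | rfl
  · exact h1
  · exact h2

/-- Points off the ramification locus are dense. -/
theorem frequently_rootDiff_ne_zero {x₀ : X} {q : a.SS} (hq : a.base q ∈ (chartAt ℂ x₀).source) :
    ∃ᶠ q' in 𝓝 q, a.rootDiff x₀ q' ≠ 0 := by
  have h : ∃ᶠ p in 𝓝 q.1, p ∈ a.offDiagonal ∧ p.1 ≠ p.2 :=
    (mem_closure_iff_frequently.1 q.2).mono fun p hp => ⟨subset_closure hp, hp.2⟩
  have h' : ∃ᶠ q' in 𝓝 q, a.p₁ q' ≠ a.p₂ q' := by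
    intro hn
    have hc : 𝓝 q = comap (fun q : a.SS => q.1) (𝓝 q.1) := nhds_subtype_eq_comap
    have hn' : ∀ᶠ q' : a.SS in comap (fun q : a.SS => q.1) (𝓝 q.1), ¬ (a.p₁ q' ≠ a.p₂ q') := by
      rw [← hc]
      exact hn
    rw [eventually_comap] at hn'
    exact h (hn'.mono fun p hp hp' => hp ⟨p, hp'.1⟩ rfl hp'.2)
  refine (h'.and_eventually (a.continuous_base.continuousAt.eventually
    ((chartAt ℂ x₀).open_source.mem_nhds hq))).mono fun q' hq' h0 => hq'.1 ?_
  exact S_ext hq'.2 (a.proj_p₂ q').symm (sub_eq_zero.1 h0)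

theorem holAt_rootDiff {x₀ : X} {q : a.SS} (hq : a.base q ∈ (chartAt ℂ x₀).source) :
    HolSpace.HolAt (a.rootDiff x₀) q :=
  holAt_of_cc hq (G := fun w => w.2.1 - w.2.2)
    (Eventually.of_forall fun w => by fun_prop) (Eventually.of_forall fun _ => rfl)

theorem holAt_S₆_comp_base₆ {f : X → ℂ} {y : a.S₆} (hf : HolSpace.HolAt f (a.base₆ y)) :
    HolSpace.HolAt (fun y => f (a.base₆ y)) y := by
  obtain ⟨q, rfl⟩ := a.surjective_πτ y
  exact a.holAt_S₆_iff.2 (a.holAt_comp_base hf)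

/-- A function on `Ŝ₆` with given pull-back. -/
theorem exists_descend {f : a.SS → ℂ} {V : Set a.S₆} (hV : IsOpen V)
    (hf : ∀ q, a.πτ q ∈ V → HolSpace.HolAt f q) (hτ : ∀ q, a.πτ q ∈ V → f (a.τ q) = f q) :
    ∃ k : a.S₆ → ℂ, (∀ y ∈ V, HolSpace.HolAt k y) ∧ ∀ q, a.πτ q ∈ V → k (a.πτ q) = f q := by
  have hk : ∀ q, a.πτ q ∈ V → f (Function.surjInv a.surjective_πτ (a.πτ q)) = f q := fun q hq => by
    have h := Function.surjInv_eq a.surjective_πτ (a.πτ q)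
    rcases a.πτ_eq_iff.1 h.symm with h | h
    · rw [h]
    · rw [h, hτ q hq]
  refine ⟨fun y => f (Function.surjInv a.surjective_πτ y), fun y hy => ?_, hk⟩
  obtain ⟨q, rfl⟩ := a.surjective_πτ y
  refine a.holAt_S₆_iff.2 (LawfulHol.congr (hf q hy) ?_)
  filter_upwards [(hV.preimage a.continuous_πτ).mem_nhds hy] with q' hq'
  exact (hk q' hq').symm

theorem rootDiff_τ (x₀ : X) (q : a.SS) : a.rootDiff x₀ (a.τ q) = -a.rootDiff x₀ q :=
  (neg_sub (a.e₁ x₀ q) (a.e₂ x₀ q)).symm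

/-- Anti-invariant functions are multiples of the difference of the roots. -/
theorem IsGeneric.exists_eq_mul_rootDiff (ha : a.IsGeneric) {x₀ : X} {V : Set a.S₆}
    (hV : IsOpen V) {f : a.SS → ℂ} (hfh : ∀ q, a.πτ q ∈ V → HolSpace.HolAt f q)
    (hfa : ∀ q, a.πτ q ∈ V → f (a.τ q) = -f q) {q : a.SS} (hyV : a.πτ q ∈ V)
    (hq : a.base q ∈ (chartAt ℂ x₀).source) : ∃ k : a.S₆ → ℂ, HolSpace.HolAt k (a.πτ q) ∧
      ∀ᶠ q' in 𝓝 q, f q' = k (a.πτ q') * a.rootDiff x₀ q' := by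
  have hVq : ∀ᶠ q' in 𝓝 q, a.πτ q' ∈ V := (hV.preimage a.continuous_πτ).mem_nhds hyV
  by_cases h0 : a.rootDiff x₀ q = 0
  · have hqx : a.base q ∈ (chartAt ℂ (a.base q)).source := mem_chart_source ℂ _
    have h1 : a.e₁ (a.base q) q = a.e₂ (a.base q) q := by
      obtain ⟨e1, e2⟩ := e_eq_crdChange_mul (x₁ := a.base q) hq
      rw [e1, e2, sub_eq_zero.1 h0]
    obtain ⟨ψ, hψ, hfψ⟩ := ha.exists_quotient_of_branch h1 (hfh q hyV) (hVq.mono hfa)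
    -- At a ramification point the quotient is found in the chart centred there; the factor
    -- `crdChange` passes to the chart at `x₀`.
    refine ⟨fun y => ψ (chartAt ℂ (a.base q) (a.base₆ y)) * crdChange x₀ (a.base q) (a.base₆ y),
      LawfulHol.mul ?_ (holAt_S₆_comp_base₆ (holAt_crdChange hq hqx)), ?_⟩
    · refine a.holAt_S₆_iff.2 (holAt_of_cc hqx (G := fun w => ψ w.1) ?_
        (Eventually.of_forall fun _ => rfl))
      have := (continuousAt_fst (p := a.cc (a.base q) q)).eventually hψ.eventually_analyticAt
      filter_upwards [this] with w hw
      exact DifferentiableAt.comp (g := ψ) w hw.differentiableAt differentiableAt_fst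
    · filter_upwards [hfψ, a.continuous_base.continuousAt.eventually
        ((chartAt ℂ x₀).open_source.mem_nhds hq)] with q' k1 k2
      obtain ⟨e1, e2⟩ := e_eq_crdChange_mul (x₁ := a.base q) k2
      rw [k1, e1, e2, base₆_πτ, rootDiff]
      ring
  -- Off the ramification the difference of roots is invertible, and the quotient of two
  -- anti-invariant functions is invariant, so it descends to $\hat S_6$.
  · let V' : Set a.S₆ := {y | ∃ q, a.πτ q = y ∧ a.πτ q ∈ V ∧ a.base q ∈ (chartAt ℂ x₀).source ∧
      a.rootDiff x₀ q ≠ 0}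
    have hV' : ∀ q, a.πτ q ∈ V' ↔ a.πτ q ∈ V ∧ a.base q ∈ (chartAt ℂ x₀).source ∧
        a.rootDiff x₀ q ≠ 0 := by
      refine fun q => ⟨?_, fun h => ⟨q, rfl, h⟩⟩
      rintro ⟨q', h1, h2, h3, h4⟩
      rcases a.πτ_eq_iff.1 h1 with rfl | rfl
      · exact ⟨h2, h3, h4⟩
      · rw [πτ_τ, base_τ, rootDiff_τ, neg_ne_zero]
        exact ⟨h2, h3, h4⟩
    have hVo : IsOpen V' := by
      refine isOpen_iff_mem_nhds.2 fun y hy => ?_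
      obtain ⟨q, rfl⟩ := a.surjective_πτ y
      obtain ⟨h1, h2, h3⟩ := (hV' q).1 hy
      rw [nhds_πτ, mem_map]
      filter_upwards [(hV.preimage a.continuous_πτ).mem_nhds h1,
        a.continuous_base.continuousAt.eventually ((chartAt ℂ x₀).open_source.mem_nhds h2),
        (LawfulHol.continuousAt (holAt_rootDiff h2)).eventually_ne h3] with q' k1 k2 k3
      exact (hV' q').2 ⟨k1, k2, k3⟩
    have hmem : a.πτ q ∈ V' := (hV' q).2 ⟨hyV, hq, h0⟩
    obtain ⟨k, hk, hkf⟩ := exists_descend (f := fun q => f q * (a.rootDiff x₀ q)⁻¹) hVo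
      (fun q h => LawfulHol.mul (hfh q ((hV' q).1 h).1)
        (LawfulHol.inv (holAt_rootDiff ((hV' q).1 h).2.1) ((hV' q).1 h).2.2))
      (fun q h => by rw [hfa q ((hV' q).1 h).1, rootDiff_τ, inv_neg, neg_mul_neg])
    refine ⟨k, hk _ hmem, ?_⟩
    filter_upwards [(hVo.preimage a.continuous_πτ).mem_nhds hmem] with q' h
    rw [hkf q' h, inv_mul_cancel_right₀ ((hV' q').1 h).2.2]

/-- The difference of the roots freely generates the anti-invariant functions. -/
theorem IsGeneric.isAntiFrameOn_rootDiff (ha : a.IsGeneric) (x₀ : X) :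
    IsAntiFrameOn a.πτ a.τ (Family.trivial a.SS) (fun _ => (LinearMap.id : ℂ →ₗ[ℂ] ℂ))
      (a.base₆ ⁻¹' (chartAt ℂ x₀).source) (a.rootDiff x₀) := by
  refine ⟨⟨fun q hq => holAt_rootDiff hq, fun q _ => rootDiff_τ x₀ q⟩, ?_, ?_⟩
  · intro y hy V hV hyV f hf
    obtain ⟨q, rfl⟩ := a.surjective_πτ y
    change a.SS → ℂ at f
    have hfa : ∀ q, a.πτ q ∈ V → f (a.τ q) = -f q := hf.2
    obtain ⟨k, hk, h⟩ := ha.exists_eq_mul_rootDiff (x₀ := x₀) hV (f := f) hf.1 hfa hyV hy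
    refine ⟨k, hk, eventually_comap_πτ.2 ?_⟩
    filter_upwards [h, (hV.preimage a.continuous_πτ).mem_nhds hyV] with q' h1 h2
    refine ⟨h1, ?_⟩
    change f (a.τ q') = k (a.πτ (a.τ q')) * a.rootDiff x₀ (a.τ q')
    rw [hfa q' h2, rootDiff_τ, πτ_τ, h1, mul_neg]
  · intro y hy k k' hk hk' h
    obtain ⟨q, rfl⟩ := a.surjective_πτ y
    have hc : Tendsto (fun q => k (a.πτ q) - k' (a.πτ q)) (𝓝 q) (𝓝 (k (a.πτ q) - k' (a.πτ q))) :=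
      ((LawfulHol.continuousAt hk).sub (LawfulHol.continuousAt hk')).tendsto.comp
        a.continuous_πτ.continuousAt
    by_contra hne
    have hev := hc.eventually_ne (sub_ne_zero.2 hne)
    -- Coefficients are unique because the difference of roots is nonzero at points arbitrarily
    -- close to `q` and the coefficients are continuous.
    refine frequently_rootDiff_ne_zero (x₀ := x₀) (q := q) hy ?_
    filter_upwards [hev, eventually_comap_πτ.1 h] with q' h1 h2 h3
    have h4 : k (a.πτ q') * a.rootDiff x₀ q' = k' (a.πτ q') * a.rootDiff x₀ q' := h2.1
    exact h1 (sub_eq_zero.2 (mul_right_cancel₀ h3 h4))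

end HitchinBase
end Curve

/-! ### Norms of functions -/

section Fibers

variable {Z : Type u} {Y : Type w} [TopologicalSpace Z] {pr : Z → Y} {y : Y}

open Classical in
theorem finite_fiberIndex {M : Multiset Z} (hM : ∀ z, z ∈ M ↔ pr z = y) :
    Finite (FiberIndex pr y) := by
  have : Finite {z : Z // pr z = y} := by
    refine Finite.of_injective (β := {z : Z // z ∈ M.toFinset})
      (fun z => ⟨z.1, Multiset.mem_toFinset.2 ((hM z.1).2 z.2)⟩) fun z z' h => ?_
    exact Subtype.ext (congrArg (fun t => t.1) h)
  infer_instance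

-- The index type repeats each point of the fibre as often as its multiplicity, so the norm can be
-- computed from any list of the fibre with the right counts.
open Classical in
theorem finprod_fiberIndex {M : Multiset Z} (hM : ∀ z, z ∈ M ↔ pr z = y)
    (hc : ∀ z ∈ M, mult pr z = M.count z) (g : Z → ℂ) :
    ∏ᶠ i : FiberIndex pr y, g i.1.1 = (M.map g).prod := by
  have : Finite {z : Z // pr z = y} := by
    refine Finite.of_injective (β := {z : Z // z ∈ M.toFinset})
      (fun z => ⟨z.1, Multiset.mem_toFinset.2 ((hM z.1).2 z.2)⟩) fun z z' h => ?_
    exact Subtype.ext (congrArg (fun t => t.1) h)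
  have := Fintype.ofFinite {z : Z // pr z = y}
  rw [finprod_eq_prod_of_fintype, Fintype.prod_sigma, Finset.prod_multiset_map_count,
    Finset.prod_subtype (p := fun z => pr z = y) M.toFinset
      (fun z => by rw [Multiset.mem_toFinset, hM])]
  refine Finset.prod_congr rfl fun z _ => ?_
  change ∏ _j : Fin (mult pr z.1), g z.1 = _
  rw [Finset.prod_const, Finset.card_univ, Fintype.card_fin, hc z.1 ((hM z.1).2 z.2)]

end Fibers

section Curve

set_option linter.unusedSectionVars false

variable {X : Type u} [TopologicalSpace X] [ChartedSpace ℂ X] [IsManifold 𝓘(ℂ, ℂ) ω X]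

namespace HitchinBase

variable {a : HitchinBase X} [T2Space X]

-- The topological multiplicity of the covering equals the multiplicity of the root. Genericity
-- leaves only the cases of a simple root and of a single coincidence.
open Classical in
theorem IsGeneric.mult_proj (ha : a.IsGeneric) {x : X} {s₁ s₂ s₃ s₄ : a.S} (h₁ : a.proj s₁ = x)
    (h₂ : a.proj s₂ = x) (h₃ : a.proj s₃ = x) (h₄ : a.proj s₄ = x)
    (h : a.Fac x x (a.sc x s₁) (a.sc x s₂) (a.sc x s₃) (a.sc x s₄)) :
    mult a.proj s₁ = 1 + (if s₁ = s₂ then 1 else 0) + (if s₁ = s₃ then 1 else 0) +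
      (if s₁ = s₄ then 1 else 0) := by
  have hx := mem_chart_source ℂ x
  have key : ∀ {s t : a.S}, a.proj s = x → a.proj t = x → (a.sc x s = a.sc x t ↔ s = t) :=
    fun {s t} hs ht => ⟨S_ext (by rw [hs]; exact hx) (hs.trans ht.symm), fun h => by rw [h]⟩
  simp only [← key h₁ h₂, ← key h₁ h₃, ← key h₁ h₄]
  by_cases e2 : a.sc x s₁ = a.sc x s₂
  · rw [← e2] at h
    obtain ⟨n3, n4, -⟩ := ha.distinct hx h
    rw [ha.mult_proj_of_double h₁ h, if_pos e2, if_neg n3, if_neg n4]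
  by_cases e3 : a.sc x s₁ = a.sc x s₃
  · rw [← e3] at h
    obtain ⟨n3, n4, -⟩ := ha.distinct hx h.swap₂₃
    rw [ha.mult_proj_of_double h₁ h.swap₂₃, if_pos e3, if_neg n3, if_neg n4]
  by_cases e4 : a.sc x s₁ = a.sc x s₄
  · rw [← e4] at h
    obtain ⟨n3, n4, -⟩ := ha.distinct hx h.swap₃₄.swap₂₃
    rw [ha.mult_proj_of_double h₁ h.swap₃₄.swap₂₃, if_pos e4, if_neg n3, if_neg n4]
  rw [mult_proj_of_simple h₁ h e2 e3 e4, if_neg e2, if_neg e3, if_neg e4]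

variable (a) in
/-- The fibre of the four-fold cover, with multiplicities. -/
def fiberS (q q' : a.SS) : Multiset a.S := {a.p₁ q, a.p₂ q, a.p₁ q', a.p₂ q'}

theorem Compl.mem_fiberS {q q' : a.SS} (h : a.Compl q q') (s : a.S) :
    s ∈ a.fiberS q q' ↔ a.proj s = a.base q := by
  have hx := mem_chart_source ℂ (a.base q)
  simp only [fiberS, Multiset.insert_eq_cons, Multiset.mem_cons, Multiset.mem_singleton]
  constructor
  · rintro (rfl | rfl | rfl | rfl)
    · rfl
    · exact a.proj_p₂ q
    · exact h.1
    · exact (a.proj_p₂ q').trans h.1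
  · intro hs
    have hp := a.poly_sc (a.base q) s
    rw [hs] at hp
    have key : ∀ {t : a.S}, a.proj t = a.base q → a.sc (a.base q) s = a.sc (a.base q) t → s = t :=
      fun ht he => S_ext (by rw [hs]; exact hx) (hs.trans ht.symm) he
    rcases h.2.root hp with h' | h' | h' | h'
    · exact Or.inl (key rfl h')
    · exact Or.inr (Or.inl (key (a.proj_p₂ q) h'))
    · exact Or.inr (Or.inr (Or.inl (key h.1 h')))
    · exact Or.inr (Or.inr (Or.inr (key ((a.proj_p₂ q').trans h.1) h')))

open Classical in
theorem IsGeneric.mult_eq_count (ha : a.IsGeneric) {q q' : a.SS} (h : a.Compl q q') :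
    ∀ s ∈ a.fiberS q q', mult a.proj s = (a.fiberS q q').count s := by
  have h₁ : a.proj (a.p₁ q) = a.base q := rfl
  have h₂ := a.proj_p₂ q
  have h₃ : a.proj (a.p₁ q') = a.base q := h.1
  have h₄ := (a.proj_p₂ q').trans h.1
  have hf : a.Fac (a.base q) (a.base q) (a.sc _ (a.p₁ q)) (a.sc _ (a.p₂ q)) (a.sc _ (a.p₁ q'))
    (a.sc _ (a.p₂ q')) := h.2
  intro s hs
  simp only [fiberS, Multiset.insert_eq_cons, Multiset.mem_cons, Multiset.mem_singleton] at hs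
  simp only [fiberS, Multiset.insert_eq_cons, Multiset.count_cons, Multiset.count_singleton]
  rcases hs with rfl | rfl | rfl | rfl
  · rw [ha.mult_proj h₁ h₂ h₃ h₄ hf, if_pos rfl]
    ring
  · rw [ha.mult_proj h₂ h₁ h₃ h₄ hf.swap₁₂, if_pos rfl]
    ring
  · rw [ha.mult_proj h₃ h₄ h₁ h₂ hf.symm, if_pos rfl]
    ring
  · rw [ha.mult_proj h₄ h₃ h₁ h₂ hf.symm.swap₁₂, if_pos rfl]
    ring

theorem IsGeneric.exists_base_eq (ha : a.IsGeneric) (x : X) : ∃ q : a.SS, a.base q = x := by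
  have h : 1 < {η : Cot X x | (⟨x, η⟩ : TotK X) ∈ a.zeroLocus}.encard :=
    lt_of_lt_of_le (by norm_num) (ha.ramification x)
  obtain ⟨η, η', h1, h2, hne⟩ := Set.one_lt_encard_iff.1 h
  refine ⟨⟨(⟨⟨x, η⟩, h1⟩, ⟨⟨x, η'⟩, h2⟩), subset_closure ⟨rfl, fun he => hne ?_⟩⟩, rfl⟩
  have he' : (⟨x, η⟩ : TotK X) = ⟨x, η'⟩ := congrArg Subtype.val he
  simpa using he'

theorem IsGeneric.finite_fiberIndex_proj (ha : a.IsGeneric) (x : X) :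
    Finite (FiberIndex a.proj x) := by
  obtain ⟨q, rfl⟩ := ha.exists_base_eq x
  obtain ⟨q', h⟩ := ha.exists_compl q
  exact finite_fiberIndex h.mem_fiberS

/-- The norm of a function along the four-fold cover. -/
theorem IsGeneric.finprod_proj (ha : a.IsGeneric) {q q' : a.SS} (h : a.Compl q q') (g : a.S → ℂ) :
    ∏ᶠ i : FiberIndex a.proj (a.base q), g i.1.1 =
      g (a.p₁ q) * g (a.p₂ q) * (g (a.p₁ q') * g (a.p₂ q')) := by
  rw [finprod_fiberIndex h.mem_fiberS (ha.mult_eq_count h)]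
  simp only [fiberS, Multiset.insert_eq_cons, Multiset.map_cons, Multiset.map_singleton,
    Multiset.prod_cons, Multiset.prod_singleton]
  ring

theorem IsGeneric.mem_fiber_πσ (ha : a.IsGeneric) (y y' : a.S₆) :
    y' ∈ ({y, a.sig y} : Multiset a.S₆) ↔ a.πσ y' = a.πσ y := by
  rw [eq_comm (a := a.πσ y'), ha.πσ_eq_iff]
  simp

theorem IsGeneric.finite_fiberIndex_πσ (ha : a.IsGeneric) (z : a.S₆σ) :
    Finite (FiberIndex a.πσ z) := by
  obtain ⟨y, rfl⟩ := a.surjective_πσ z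
  exact finite_fiberIndex (ha.mem_fiber_πσ y)

/-- The norm of a function along the quotient by `σ`. -/
theorem IsGeneric.finprod_πσ (ha : a.IsGeneric) (y : a.S₆) (g : a.S₆ → ℂ) :
    ∏ᶠ i : FiberIndex a.πσ (a.πσ y), g i.1.1 = g y * g (a.sig y) := by
  classical
  rw [finprod_fiberIndex (ha.mem_fiber_πσ y) fun y' hy' => ?_]
  · simp
  · rw [ha.mult_πσ]
    have hne := ha.sig_ne y
    simp only [Multiset.insert_eq_cons, Multiset.mem_cons, Multiset.mem_singleton] at hy'
    simp only [Multiset.insert_eq_cons, Multiset.count_cons, Multiset.count_singleton]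
    rcases hy' with rfl | rfl
    · rw [if_neg (Ne.symm hne), if_pos rfl]
    · rw [if_neg hne, if_pos rfl]

/-- Pulled back to $\hat S_6$, the norm is the product of `g` and $g\circ\sigma$, and $\sigma$ is
holomorphic. -/
theorem IsGeneric.holAt_finprod_πσ (ha : a.IsGeneric) {V : Set a.S₆σ} {g : a.S₆ → ℂ}
    (hg : ∀ y ∈ a.πσ ⁻¹' V, HolSpace.HolAt g y) :
    ∀ z ∈ V, HolSpace.HolAt (fun z => ∏ᶠ i : FiberIndex a.πσ z, g i.1.1) z := by
  intro z hz
  obtain ⟨y, rfl⟩ := a.surjective_πσ z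
  rw [ha.holAt_S₆σ_iff]
  simp only [ha.finprod_πσ]
  refine LawfulHol.mul (hg y hz) (ha.holAt_comp_sig (hg _ ?_))
  rwa [Set.mem_preimage, ha.πσ_sig]

end HitchinBase
end Curve

/-! ### The line bundles `𝓛_-` and `T` -/

theorem IsAntiInvariantPart.exists_isAntiIso {Z : Type u} {Y : Type w} [TopologicalSpace Z]
    [HolSpace Z] [TopologicalSpace Y] [HolSpace Y] {pr : Z → Y} {τ : Z → Z} {E : Family.{u, v} Z}
    {θ : ∀ z, E.Fiber z →ₗ[ℂ] E.Fiber (τ z)} {N : Family.{w, v'} Y}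
    (h : IsAntiInvariantPart pr τ E θ N) :
    ∃ φ : ∀ U : Opens Y, N.Sec U ≃ AntiSec pr τ E θ U, IsAntiIso φ := by
  obtain ⟨φ, -, h1, h2⟩ := h
  exact ⟨φ, h1, h2⟩

section Curve

set_option linter.unusedSectionVars false

variable {X : Type u} [TopologicalSpace X] [ChartedSpace ℂ X] [IsManifold 𝓘(ℂ, ℂ) ω X]

namespace HitchinBase

variable {a : HitchinBase X} [T2Space X] {L : Family.{u, v} a.S}

/-- The section `e ⊠ e` of `𝓛`. -/
def boxSq (e : ∀ s, L.Fiber s) (q : a.SS) : (a.calL L).Fiber q :=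
  (e (a.p₁ q) : L.Fiber (a.p₁ q)) ⊗ₜ[ℂ] (e (a.p₂ q) : L.Fiber (a.p₂ q))

theorem boxSq_smul (g : a.S → ℂ) (e : ∀ s, L.Fiber s) (q : a.SS) :
    boxSq (fun s => g s • e s) q = (g (a.p₁ q) * g (a.p₂ q)) • boxSq e q :=
  TensorProduct.smul_tmul_smul _ _ _ _

theorem isFrameOn_boxSq {U : Set a.S} {e : ∀ s, L.Fiber s} (hU : IsOpen U)
    (he : L.IsFrameOn U e) : (a.calL L).IsFrameOn (a.p₁ ⁻¹' U ∩ a.p₂ ⁻¹' U) (boxSq e) :=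
  ((he.pullback hU a.continuous_p₁ a.holAt_comp_p₁).mono Set.inter_subset_left).tensor
    ((he.pullback hU a.continuous_p₂ a.holAt_comp_p₂).mono Set.inter_subset_right)
    ((hU.preimage a.continuous_p₁).inter (hU.preimage a.continuous_p₂))

theorem isFrameOn_boxSq_proj {V : Set X} {e : ∀ s, L.Fiber s} (hV : IsOpen V)
    (he : L.IsFrameOn (a.proj ⁻¹' V) e) :
    (a.calL L).IsFrameOn (a.πτ ⁻¹' (a.base₆ ⁻¹' V)) (boxSq e) := by
  refine (isFrameOn_boxSq (hV.preimage a.continuous_proj) he).mono fun q hq => ⟨hq, ?_⟩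
  change a.proj (a.p₂ q) ∈ V
  rw [a.proj_p₂]
  exact hq

/-- Using the same section `e` in both factors makes the product invariant under the exchange. -/
theorem swapL_boxSq (e : ∀ s, L.Fiber s) (q : a.SS) :
    a.swapL L q (boxSq e q) = boxSq e (a.τ q) := rfl

variable (L) in
/-- There are frames over the preimages of small open subsets of the base. -/
def HasBaseFrames : Prop :=
  ∀ x : X, ∃ V : Set X, IsOpen V ∧ x ∈ V ∧ V ⊆ (chartAt ℂ x).source ∧
    ∃ e : ∀ s, L.Fiber s, L.IsFrameOn (a.proj ⁻¹' V) e

theorem HasBaseFrames.isLineBundle_calL (h : HasBaseFrames L) : (a.calL L).IsLineBundle := by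
  intro q
  obtain ⟨V, hV, hx, -, e, he⟩ := h (a.base q)
  exact ⟨_, (hV.preimage continuous_base₆).preimage a.continuous_πτ, hx, _,
    isFrameOn_boxSq_proj hV he⟩

/-- The frame $e\boxtimes e$ is invariant, so multiplying it by the generator of the anti-invariant
functions gives a generator of $\mathcal L_-$. -/
theorem IsGeneric.isAntiFrameOn_calL (ha : a.IsGeneric) (h : HasBaseFrames L) {x : X}
    {V : Set X} (hV : IsOpen V) (hVx : V ⊆ (chartAt ℂ x).source) {e : ∀ s, L.Fiber s}
    (he : L.IsFrameOn (a.proj ⁻¹' V) e) :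
    IsAntiFrameOn a.πτ a.τ (a.calL L) (a.swapL L) (a.base₆ ⁻¹' V)
      (fun q => a.rootDiff x q • boxSq e q) :=
  ((ha.isAntiFrameOn_rootDiff x).mono (Set.preimage_mono hVx)).smul_frame a.continuous_πτ a.πτ_τ
    h.isLineBundle_calL (hV.preimage continuous_base₆) (isFrameOn_boxSq_proj hV he)
    fun q _ => (swapL_boxSq e q).symm

theorem IsGeneric.exists_isLMinus (ha : a.IsGeneric) (h : HasBaseFrames L) :
    ∃ N : Family.{u, w} a.S₆, a.IsLMinus L N := by
  refine exists_isAntiInvariantPart a.continuous_πτ a.πτ_τ a.holAt_S₆_iff.1 h.isLineBundle_calL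
    fun y => ?_
  obtain ⟨V, hV, hx, hVx, e, he⟩ := h (a.base₆ y)
  exact ⟨_, _, hV.preimage continuous_base₆, hx, ha.isAntiFrameOn_calL h hV hVx he⟩

theorem IsGeneric.exists_isT (ha : a.IsGeneric) : ∃ T : Family.{u, w} a.S₆, a.IsT T :=
  exists_isAntiInvariantPart a.continuous_πτ a.πτ_τ a.holAt_S₆_iff.1 Family.isLineBundle_trivial
    fun y => ⟨_, _, (chartAt ℂ (a.base₆ y)).open_source.preimage continuous_base₆,
      mem_chart_source ℂ (a.base₆ y), ha.isAntiFrameOn_rootDiff _⟩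

/-! ### The line bundle `𝓛_- ⊗ T⁻¹` -/

variable {N T : Family.{u, w} a.S₆}

/-- The frames of `𝓛_- ⊗ T⁻¹` over a small open set. -/
structure IsBoxFrame (φ : ∀ U : Opens a.S₆, N.Sec U ≃ AntiSec a.πτ a.τ (a.calL L) (a.swapL L) U)
    (ψ : ∀ U : Opens a.S₆, T.Sec U ≃
      AntiSec a.πτ a.τ (Family.trivial a.SS) (fun _ => (LinearMap.id : ℂ →ₗ[ℂ] ℂ)) U)
    (x : X) (V : Set X) (e : ∀ s, L.Fiber s) (n : ∀ y, N.Fiber y) (t : ∀ y, T.Fiber y)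
    (l : ∀ y, Module.Dual ℂ (T.Fiber y)) : Prop where
  isOpen : IsOpen V
  subset : V ⊆ (chartAt ℂ x).source
  frameN : N.IsFrameOn (a.base₆ ⁻¹' V) n
  corrN : Corresponds φ (a.base₆ ⁻¹' V) n (fun q => a.rootDiff x q • boxSq e q)
  frameT : T.IsFrameOn (a.base₆ ⁻¹' V) t
  corrT : Corresponds ψ (a.base₆ ⁻¹' V) t (a.rootDiff x)
  frameDual : T.dual.IsFrameOn (a.base₆ ⁻¹' V) l
  dual : ∀ y ∈ a.base₆ ⁻¹' V, l y (t y) = 1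

section BoxFrame

variable {φ : ∀ U : Opens a.S₆, N.Sec U ≃ AntiSec a.πτ a.τ (a.calL L) (a.swapL L) U}
    {ψ : ∀ U : Opens a.S₆, T.Sec U ≃
      AntiSec a.πτ a.τ (Family.trivial a.SS) (fun _ => (LinearMap.id : ℂ →ₗ[ℂ] ℂ)) U}

theorem IsGeneric.exists_isBoxFrame (ha : a.IsGeneric) (h : HasBaseFrames L) (hφ : IsAntiIso φ)
    (hψ : IsAntiIso ψ) (hN : N.IsLineBundle) (hT : T.IsLineBundle) {x : X} {V : Set X}
    (hV : IsOpen V) (hVx : V ⊆ (chartAt ℂ x).source) {e : ∀ s, L.Fiber s}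
    (he : L.IsFrameOn (a.proj ⁻¹' V) e) : ∃ n t l, IsBoxFrame φ ψ x V e n t l := by
  have hW := hV.preimage (continuous_base₆ (a := a))
  obtain ⟨n, hn, -, hnc⟩ := hφ.exists_frame a.πτ_τ hN hW (ha.isAntiFrameOn_calL h hV hVx he)
  obtain ⟨t, ht, -, htc⟩ := hψ.exists_frame a.πτ_τ hT hW
    ((ha.isAntiFrameOn_rootDiff x).mono (Set.preimage_mono hVx))
  obtain ⟨l, hl, hlt⟩ := ht.exists_dual hW
  exact ⟨n, t, l, hV, hVx, hn, hnc, ht, htc, hl, hlt⟩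

variable {x x' : X} {V V' : Set X} {e e' : ∀ s, L.Fiber s} {n n' : ∀ y, N.Fiber y}
  {t t' : ∀ y, T.Fiber y} {l l' : ∀ y, Module.Dual ℂ (T.Fiber y)}

/-- The section `n ⊗ l` of `𝓛_- ⊗ T⁻¹`. -/
def tensorSection (n : ∀ y, N.Fiber y) (l : ∀ y, Module.Dual ℂ (T.Fiber y)) (y : a.S₆) :
    (N.tensor T.dual).Fiber y :=
  (n y ⊗ₜ[ℂ] l y : N.Fiber y ⊗[ℂ] Module.Dual ℂ (T.Fiber y))

theorem IsBoxFrame.isFrameOn (h : IsBoxFrame φ ψ x V e n t l) :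
    (N.tensor T.dual).IsFrameOn (a.base₆ ⁻¹' V) (tensorSection n l) :=
  h.frameN.tensor h.frameDual (h.isOpen.preimage continuous_base₆)

/-- If `e = g e'`, then the frames of `𝓛_- ⊗ T⁻¹` differ by the function `g ⊠ g`. -/
theorem IsBoxFrame.eq_smul (h : IsBoxFrame φ ψ x V e n t l) (h' : IsBoxFrame φ ψ x' V' e' n' t' l')
    (ha : a.IsGeneric) (hφ : IsAntiIso φ) (hψ : IsAntiIso ψ) (hN : N.IsLineBundle)
    (hT : T.IsLineBundle) {g : a.S → ℂ}
    (hg : ∀ s ∈ a.proj ⁻¹' (V ∩ V'), e s = g s • e' s ∧ HolSpace.HolAt g s)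
    {q : a.SS} (hq : a.base q ∈ V ∩ V') :
    tensorSection n l (a.πτ q) =
      (g (a.p₁ q) * g (a.p₂ q)) • tensorSection n' l' (a.πτ q) := by
  have hVo := h.isOpen.inter h'.isOpen
  have hW : IsOpen (a.base₆ ⁻¹' (V ∩ V')) := hVo.preimage continuous_base₆
  have hb : ∀ q : a.SS, a.base q ∈ V ∩ V' → a.p₁ q ∈ a.proj ⁻¹' (V ∩ V') ∧
      a.p₂ q ∈ a.proj ⁻¹' (V ∩ V') := fun q hq =>
    ⟨hq, by rw [Set.mem_preimage, a.proj_p₂]; exact hq⟩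
  have hT' := (ha.isAntiFrameOn_rootDiff x').mono (Set.preimage_mono h'.subset)
  have hTx := (ha.isAntiFrameOn_rootDiff x).mono (Set.preimage_mono h.subset)
  -- The factor `k` compares the root differences in the two charts. It enters `n` directly and `l`
  -- inversely, so it drops out of `n ⊗ l`.
  obtain ⟨k, hk, hkd⟩ := hT'.gen (a.πτ q) hq.2 _ (h.isOpen.preimage continuous_base₆) hq.1 _ hTx.anti
  have hkd' : ∀ᶠ q' in comap a.πτ (𝓝 (a.πτ q)),
    a.rootDiff x q' = k (a.πτ q') * a.rootDiff x' q' := hkd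
  -- The product $g(\eta_1)g(\eta_2)$ is symmetric in the two roots, hence a holomorphic function on
  -- $\hat S_6$.
  obtain ⟨G, hG, hGg⟩ := exists_descend (f := fun q => g (a.p₁ q) * g (a.p₂ q)) hW
    (fun q hq => LawfulHol.mul (a.holAt_comp_p₁ (hg _ (hb q hq).1).2)
      (a.holAt_comp_p₂ (hg _ (hb q hq).2).2)) (fun q _ => mul_comm _ _)
  have hot := h.isOpen.preimage (continuous_base₆ (a := a))
  have hot' := h'.isOpen.preimage (continuous_base₆ (a := a))
  have et : t (a.πτ q) = k (a.πτ q) • t' (a.πτ q) :=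
    hψ.eq_smul hT hW (fun y hy => h.frameT.holAt_self hot hy.1)
      (fun y hy => h'.frameT.holAt_self hot' hy.2)
      (fun U hU => h.corrT U (hU.trans (Set.preimage_mono Set.inter_subset_left)))
      (fun U hU => h'.corrT U (hU.trans (Set.preimage_mono Set.inter_subset_right))) hq hk hkd
  have en : n (a.πτ q) = (k (a.πτ q) * G (a.πτ q)) • n' (a.πτ q) := by
    refine hφ.eq_smul (s := fun q => a.rootDiff x q • boxSq e q)
      (s' := fun q => a.rootDiff x' q • boxSq e' q) hN hW (fun y hy => h.frameN.holAt_self hot hy.1)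
      (fun y hy => h'.frameN.holAt_self hot' hy.2)
      (fun U hU => h.corrN U (hU.trans (Set.preimage_mono Set.inter_subset_left)))
      (fun U hU => h'.corrN U (hU.trans (Set.preimage_mono Set.inter_subset_right))) hq
      (k := fun y => k y * G y) (LawfulHol.mul hk (hG _ hq)) ?_
    filter_upwards [hkd', tendsto_comap.eventually (hW.mem_nhds hq)] with q' h1 h2
    have h3 : boxSq e q' = (g (a.p₁ q') * g (a.p₂ q')) • boxSq e' q' := by
      rw [← boxSq_smul]
      simp only [boxSq]
      rw [(hg _ (hb q' h2).1).1, (hg _ (hb q' h2).2).1]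
    rw [h3, h1, hGg q' h2, smul_smul, smul_smul]
    congr 1
    ring
  have hk0 : k (a.πτ q) ≠ 0 := fun h0 => h.frameT.ne_zero hq.1 (by rw [et, h0, zero_smul])
  have et' : t' (a.πτ q) = (k (a.πτ q))⁻¹ • t (a.πτ q) := by
    rw [et, smul_smul, inv_mul_cancel₀ hk0, one_smul]
  have el := dual_eq_smul (h'.frameT.span hq.2) (h'.dual _ hq.2) (l (a.πτ q))
  rw [et', map_smul, h.dual _ hq.1, smul_eq_mul, mul_one] at el
  rw [tensorSection, en, el, TensorProduct.smul_tmul_smul, hGg q hq, mul_right_comm,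
    mul_inv_cancel₀ hk0, one_mul]
  rfl

end BoxFrame

theorem IsGeneric.base₆_sig (ha : a.IsGeneric) (y : a.S₆) : a.base₆ (a.sig y) = a.base₆ y := by
  obtain ⟨q, rfl⟩ := a.surjective_πτ y
  obtain ⟨q', h⟩ := ha.exists_compl q
  rw [h.sig_eq]
  exact h.1

/-- The projection of `Ŝ₆ / σ` to `X`. -/
def baseσ (ha : a.IsGeneric) : a.S₆σ → X := Quot.lift a.base₆ fun y y' h => by
  rw [(ha.sigmaRel_iff_sig y y').1 h, ha.base₆_sig]

theorem IsGeneric.inPrym_tensor_dual (ha : a.IsGeneric) (hL : InPrym a.proj L)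
    (hN : a.IsLMinus L N) (hT : a.IsT T) (h : HasBaseFrames L) :
    InPrym a.πσ (N.tensor T.dual) := by
  have := ha.lawfulHol_S₆σ
  have := ha.finite_fiberIndex_proj
  have := ha.finite_fiberIndex_πσ
  obtain ⟨φ, hφ⟩ := hN.2.exists_isAntiIso
  obtain ⟨ψ, hψ⟩ := hT.2.exists_isAntiIso
  obtain ⟨s, hs⟩ := exists_norm_frames hL.2
  choose V hV hxV hVx e he f hf using fun x : X => hs x _ ((chartAt ℂ x).open_source.mem_nhds (mem_chart_source ℂ x))
  choose n t l hbox using fun x : X =>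
    ha.exists_isBoxFrame h hφ hψ hN.1 hT.1 (hV x) (hVx x) (he x)
  have hfr := fun x => (hbox x).isFrameOn
  have hVσ : ∀ x, IsOpen (baseσ ha ⁻¹' V x) := fun x =>
    (hV x).preimage (continuous_quot_lift _ continuous_base₆)
  refine ⟨fun y => ⟨_, (hV (a.base₆ y)).preimage continuous_base₆, hxV _, _, hfr _⟩,
    norm_iso_trivial continuous_πσ (fun _ _ _ hg => ha.holAt_finprod_πσ hg) (V := fun x => baseσ ha ⁻¹' V x)
      -- Since `f x` times the norm of `e x` is the global section `s`, the norm of `e x` has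
      -- coordinate $1/f_x$; its pull-back is assigned to the frame of $\mathcal L_-\otimes T^{-1}$.
      hVσ (fun z => ⟨_, hxV (baseσ ha z)⟩) hfr (c := fun x z => (f x (baseσ ha z))⁻¹) ?_ ?_ ?_⟩
  · intro x z hz
    obtain ⟨y, rfl⟩ := a.surjective_πσ z
    have h1 := hf x (a.base₆ y) hz
    exact LawfulHol.inv (ha.holAt_S₆σ_iff.2 (holAt_S₆_comp_base₆ h1.1)) h1.2.1
  · intro x z hz
    exact inv_ne_zero (hf x _ hz).2.1
  · intro x x' z hz hz'
    obtain ⟨y, rfl⟩ := a.surjective_πσ z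
    obtain ⟨q, rfl⟩ := a.surjective_πτ y
    obtain ⟨q', hc⟩ := ha.exists_compl q
    have hq : a.base q ∈ V x ∩ V x' := ⟨hz, hz'⟩
    have hq' : a.base q' ∈ V x ∩ V x' := by rw [hc.1]; exact hq
    obtain ⟨g, hg⟩ := ((he x').mono (Set.preimage_mono Set.inter_subset_right)).exists_change
      ((he x).mono (Set.preimage_mono Set.inter_subset_left))
      (((hV x).inter (hV x')).preimage a.continuous_proj)
    obtain ⟨G, hG⟩ := ((hfr x').mono (Set.preimage_mono Set.inter_subset_right)).exists_change
      ((hfr x).mono (Set.preimage_mono Set.inter_subset_left))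
      (((hV x).inter (hV x')).preimage continuous_base₆)
    have hGg : ∀ q : a.SS, a.base q ∈ V x ∩ V x' → G (a.πτ q) = g (a.p₁ q) * g (a.p₂ q) :=
      fun q hq => Family.smul_left_inj ((hfr x').ne_zero (x := a.πτ q) hq.2)
        ((hG (a.πτ q) hq).1.symm.trans ((hbox x).eq_smul (hbox x') ha hφ hψ hN.1 hT.1
          (fun s hs => ⟨(hg s hs).1, (hg s hs).2.1⟩) hq))
    set P := ∏ᶠ i : FiberIndex a.proj (a.base q), g i.1.1
    -- The heart of the matter: the pair and its complement together run through the four roots with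
    -- multiplicity, so the norm of `G` along $\sigma$ is the norm of `g` along $\pi$.
    have hP : ∏ᶠ i : FiberIndex a.πσ (a.πσ (a.πτ q)), G i.1.1 = P := by
      rw [ha.finprod_πσ, hc.sig_eq, hGg q hq, hGg q' hq']
      exact (ha.finprod_proj hc g).symm
    have h1 : normSection a.πσ (tensorSection (n x) (l x)) (a.πσ (a.πτ q)) =
        P • normSection a.πσ (tensorSection (n x') (l x')) (a.πσ (a.πτ q)) := by
      rw [← hP, ← normSection_smul]
      refine normSection_congr fun y hy => (hG y ?_).1
      have h' : a.base₆ y = a.base q := congrArg (baseσ ha) hy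
      rw [Set.mem_preimage, h']
      exact hq
    have h2 : normSection a.proj (e x) (a.base q) = P • normSection a.proj (e x') (a.base q) := by
      rw [← normSection_smul]
      refine normSection_congr fun s hs => (hg s ?_).1
      rw [Set.mem_preimage, hs]
      exact hq
    have h3 := (hf x (a.base q) hq.1).2.2.symm.trans (hf x' (a.base q) hq.2).2.2
    rw [h2, smul_smul] at h3
    obtain ⟨ρ, hρ⟩ := exists_norm_equiv (he x') hq.2
    have h4 : f x (a.base q) * P = f x' (a.base q) := by
      have := congrArg ρ h3
      -- The norms of `e x` and `e x'` differ by the same factor `P`, and comparing the two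
      -- expressions of `s` gives $f_xP=f_{x'}$.
      rwa [map_smul, map_smul, hρ, smul_eq_mul, smul_eq_mul, mul_one, mul_one] at this
    rw [h1, smul_smul]
    congr 1
    change (f x' (a.base q))⁻¹ * P = (f x (a.base q))⁻¹
    have n1 := (hf x (a.base q) hq.1).2.1
    have n2 := (hf x' (a.base q) hq.2).2.1
    rw [← h4] at n2 ⊢
    field_simp
    exact div_self (right_ne_zero_of_mul n2)

end HitchinBase
end Curve

end SpectralPrym

end

/-! ### The theorem -/

theorem mainTheorem4 {X : Type u} [TopologicalSpace X] [ChartedSpace ℂ X]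
    [IsManifold 𝓘(ℂ, ℂ) ω X] [T2Space X] [CompactSpace X] [ConnectedSpace X]
    (a : SpectralPrym.HitchinBase X) (ha : a.IsGeneric)
    (L : SpectralPrym.Family.{u, v} a.S) (hL : SpectralPrym.InPrym a.proj L) :
    (∃ N : SpectralPrym.Family.{u, w} a.S₆, a.IsLMinus L N) ∧
    (∃ T : SpectralPrym.Family.{u, w} a.S₆, a.IsT T) ∧
    ∀ N T : SpectralPrym.Family.{u, w} a.S₆, a.IsLMinus L N → a.IsT T →
      SpectralPrym.InPrym a.πσ (N.tensor T.dual) := by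
  have h : SpectralPrym.HitchinBase.HasBaseFrames L := by
    obtain ⟨s, hs⟩ := SpectralPrym.exists_norm_frames hL.2
    intro x
    obtain ⟨V, hV, hx, hVx, e, he, -⟩ :=
      hs x _ ((chartAt ℂ x).open_source.mem_nhds (mem_chart_source ℂ x))
    exact ⟨V, hV, hx, hVx, e, he⟩
  exact ⟨ha.exists_isLMinus h, ha.exists_isT, fun N T hN hT => ha.inPrym_tensor_dual hL hN hT h⟩
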